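/- **Setting.** Let $\mathcal Y=Y/G$, where $Y$ is a compact Hausdorff space with a continuous action of a compact Hausdorff group $G$ (for example, a compact manifold with boundary and a compact Lie group), and let $\partial Y\subseteq Y$ be a closed $G$-invariant subset, with $\partial\mathcal Y=\partial Y/G$. Let $\mathbb C(\mathcal Y)$ be the algebra of continuous complex functions on the orbit space $Y/G$. *Kasparov modules.* A Kasparov $\mathbb C(\mathcal Y)$-module $(H,\phi,T)$ is a $\mathbb Z/2$-graded complex Hilbert space $H$ (with grading operator $\varepsilon$), a unital $*$-homomorphism $\phi$ from $\mathbb C(\mathcal Y)$ to the bounded operators of degree $0$ on $H$, and a bounded self-adjoint Fredholm operator $T$ of degree $1$ such that every commutator $[T,\phi(f)]$ is compact. It is degenerate if $T$ is invertible and commutes with every $\phi(f)$. The group $K_0^{fake}(\mathcal Y)$ is the set of Kasparov modules, with direct sum as addition, modulo the equivalence relation generated by unitary equivalence, by homotopy (a norm-continuous path of operators $T_t$ on fixed $(H,\phi)$ for which all $(H,\phi,T_t)$ are Kasparov modules), and by addition of degenerate modules. *K-theory.* The group $K^{0,fake}_{\mathbb Z}(\mathcal Y,\partial\mathcal Y)$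 is the set of pairs $(\mathcal E,\alpha)$, with direct sum as addition, where $\mathcal E$ is a $\mathbb Z/2$-graded Hermitian $G$-vector bundle over $Y$ on whose fibres the isotropy groups act trivially and $\alpha:\mathcal E\to\mathcal E$ is a self-adjoint $G$-equivariant bundle endomorphism of degree $1$ that is invertible over $\partial Y$, modulo the equivalence relation generated by unitary isomorphism, by homotopy (pairs over $Y\times[0,1]$, invertible over $\partial Y\times[0,1]$), and by addition of pairs with $\alpha$ invertible everywhere. Put $K^{0,fake}=K^{0,fake}_{\mathbb Z}\otimes\mathbb C$. *Presentations.* Let $C(\mathcal E)$ be the $\mathbb C(\mathcal Y)$-module of continuous $G$-invariant sections of $\mathcal E$. An idempotent presentation of $C(\mathcal E)$ is an idempotent $n\times n$ matrix $A$ over $\mathbb C(\mathcal Y)$ with an isomorphism of modules $\iota$ from $C(\mathcal E)$ to the range of $A$. It is Hermitian if $A=A^*$, $\iota$ preserves the $\mathbb C(\mathcal Y)$-valued Hermitian products, and $\iota$ has degree $0$ for some $\mathbb Z/2$-grading of the standard basis of $\mathbb C(\mathcal Y)^n$. Given a presentation, let $\tilde H=H\otimes C(\mathcal E)$ be the closed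 subspace $\operatorname{im}\phi(A)$ of $H^n$, with the induced $\mathbb C(\mathcal Y)$-action $\tilde\phi$ and grading operator $\varepsilon\otimes C(\varepsilon)$, and put $$\tilde T=T\otimes' 1-\varepsilon\otimes C(\alpha),$$ where $T\otimes'1$ is the restriction to $\tilde H$ of $\phi(A)\circ T^{\oplus n}$ and $1\otimes C(\alpha)$ is induced by $\iota\, C(\alpha)\,\iota^{-1}$. Say that $(\tilde H,\tilde\phi,\tilde T)$ represents $c\in K_0^{fake}(\mathcal Y)$ if there are a Kasparov module $(K,\psi,S)$ of class $c$ and a bounded invertible linear map $U:\tilde H\to K$ that intertwines the grading operators and the actions, with $U\tilde T-SU$ compact. **Proposition 3.1.** Every $C(\mathcal E)$ as above has a Hermitian idempotent presentation. The fake cap product is well defined. That is, there is a biadditive map $$\cap: K_0^{fake}(\mathcal Y)\times K_{\mathbb Z}^{0,fake}(\mathcal Y,\partial\mathcal Y)\to K_0^{fake}(\mathcal Y)$$ such that, for all representatives $(H,\phi,T)$ and $(\mathcal E,\alpha)$: 1. for every Hermitian idempotent presentation of $C(\mathcal E)$, $(\tilde H,\tilde\phi,\tilde T)$ is a Kasparov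 module, and its class is $[H,\phi,T]\cap[\mathcal E,\alpha]$; 2. for every idempotent presentation of $C(\mathcal E)$, $(\tilde H,\tilde\phi,\tilde T)$ represents $[H,\phi,T]\cap[\mathcal E,\alpha]$ and no other class. The map $\cap$ is the only map of sets with property 1. It induces a unique $\mathbb C$-linear map $$(K_0^{fake}(\mathcal Y)\otimes\mathbb C)\otimes_{\mathbb C} K^{0,fake}(\mathcal Y,\partial\mathcal Y)\to K_0^{fake}(\mathcal Y)\otimes\mathbb C$$ with $(x\otimes 1)\otimes(e\otimes 1)\mapsto (x\cap e)\otimes 1$. -/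

import Mathlib

open scoped TensorProduct

set_option linter.unusedSectionVars false
set_option linter.unusedVariables false

universe u v w z

noncomputable section

namespace FakeCap

/-! ### Graded Hilbert spaces with an action of continuous functions and an operator -/

/-- A complex Hilbert space `H` with bounded operators `ε` (the grading operator) and `T`, and an
action `φ` of the algebra of continuous functions on `X`. The conditions which make it a Kasparov
module are collected in `KData.IsKasparov`. -/
structure KData (X : Type v) [TopologicalSpace X] where
  H : Type u
  [normed : NormedAddCommGroup H]
  [innerProduct : InnerProductSpace ℂ H]
  [complete : CompleteSpace H]
  ε : H →L[ℂ] H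
  φ : C(X, ℂ) →ₐ[ℂ] (H →L[ℂ] H)
  T : H →L[ℂ] H

attribute [instance] KData.normed KData.innerProduct KData.complete

namespace KData

variable {X : Type v} [TopologicalSpace X]

/-- `(H, φ, T)`, graded by `ε`, is a Kasparov module: `ε` is the operator `(-1)^a` of a
`ℤ/2`-grading by orthogonal subspaces, `φ` is a `*`-homomorphism into operators of degree `0`, and
`T` is a self-adjoint Fredholm operator of degree `1` that commutes with every `φ f` up to a compact
operator. -/
structure IsKasparov (D : KData.{u} X) : Prop where
  grading_sq : D.ε * D.ε = 1
  grading_selfAdjoint : IsSelfAdjoint D.ε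
  map_star : ∀ f : C(X, ℂ), D.φ (star f) = star (D.φ f)
  map_even : ∀ f : C(X, ℂ), D.ε * D.φ f = D.φ f * D.ε
  selfAdjoint : IsSelfAdjoint D.T
  odd : D.ε * D.T = -(D.T * D.ε)
  fredholm : D.T.IsFredholm
  compact_commutator : ∀ f : C(X, ℂ), IsCompactOperator ⇑(D.T * D.φ f - D.φ f * D.T)

/-- The same Hilbert space, grading and action, with another operator. -/
def withOp (D : KData.{u} X) (S : D.H →L[ℂ] D.H) : KData.{u} X :=
  { D with T := S }

end KData

section DirectSumOperators

variable {H H' : Type u} [NormedAddCommGroup H] [InnerProductSpace ℂ H] [CompleteSpace H]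
  [NormedAddCommGroup H'] [InnerProductSpace ℂ H'] [CompleteSpace H']

/-- The direct sum of two operators, on the Hilbert space direct sum. -/
def sumOp (S : H →L[ℂ] H) (S' : H' →L[ℂ] H') : WithLp 2 (H × H') →L[ℂ] WithLp 2 (H × H') :=
  (WithLp.prodContinuousLinearEquiv 2 ℂ H H').symm.toContinuousLinearMap ∘L
    (S.prodMap S') ∘L (WithLp.prodContinuousLinearEquiv 2 ℂ H H').toContinuousLinearMap

@[simp] theorem sumOp_fst (S : H →L[ℂ] H) (S' : H' →L[ℂ] H') (x : WithLp 2 (H × H')) :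
    (sumOp S S' x).fst = S x.fst := rfl

@[simp] theorem sumOp_snd (S : H →L[ℂ] H) (S' : H' →L[ℂ] H') (x : WithLp 2 (H × H')) :
    (sumOp S S' x).snd = S' x.snd := rfl

theorem withLp_ext {x y : WithLp 2 (H × H')} (h₁ : x.fst = y.fst) (h₂ : x.snd = y.snd) : x = y := by
  apply (WithLp.equiv 2 (H × H')).injective
  exact Prod.ext h₁ h₂

theorem sumOp_mul (S R : H →L[ℂ] H) (S' R' : H' →L[ℂ] H') :
    sumOp (S * R) (S' * R') = sumOp S S' * sumOp R R' := rfl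

theorem sumOp_one : sumOp (1 : H →L[ℂ] H) (1 : H' →L[ℂ] H') = 1 := rfl

theorem sumOp_add (S R : H →L[ℂ] H) (S' R' : H' →L[ℂ] H') :
    sumOp (S + R) (S' + R') = sumOp S S' + sumOp R R' := rfl

theorem sumOp_sub (S R : H →L[ℂ] H) (S' R' : H' →L[ℂ] H') :
    sumOp (S - R) (S' - R') = sumOp S S' - sumOp R R' := rfl

theorem sumOp_neg (S : H →L[ℂ] H) (S' : H' →L[ℂ] H') :
    sumOp (-S) (-S') = -sumOp S S' := rfl

theorem sumOp_smul (c : ℂ) (S : H →L[ℂ] H) (S' : H' →L[ℂ] H') :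
    sumOp (c • S) (c • S') = c • sumOp S S' := rfl

theorem sumOp_star (S : H →L[ℂ] H) (S' : H' →L[ℂ] H') :
    sumOp (star S) (star S') = star (sumOp S S') := by
  rw [ContinuousLinearMap.star_eq_adjoint (sumOp S S'), ContinuousLinearMap.eq_adjoint_iff]
  intro x y
  simp [WithLp.prod_inner_apply, ContinuousLinearMap.star_eq_adjoint,
    ContinuousLinearMap.adjoint_inner_left, sumOp]

theorem sumOp_eq (S : H →L[ℂ] H) (S' : H' →L[ℂ] H') :
    sumOp S S' =
      ((WithLp.prodContinuousLinearEquiv 2 ℂ H H').symm.toContinuousLinearMap ∘L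
        ContinuousLinearMap.inl ℂ H H') ∘L S ∘L (ContinuousLinearMap.fst ℂ H H' ∘L
          (WithLp.prodContinuousLinearEquiv 2 ℂ H H').toContinuousLinearMap) +
      ((WithLp.prodContinuousLinearEquiv 2 ℂ H H').symm.toContinuousLinearMap ∘L
        ContinuousLinearMap.inr ℂ H H') ∘L S' ∘L (ContinuousLinearMap.snd ℂ H H' ∘L
          (WithLp.prodContinuousLinearEquiv 2 ℂ H H').toContinuousLinearMap) := by
  ext x
  apply withLp_ext <;> simp [sumOp]

theorem sumOp_isCompact {S : H →L[ℂ] H} {S' : H' →L[ℂ] H'} (h : IsCompactOperator ⇑S)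
    (h' : IsCompactOperator ⇑S') : IsCompactOperator ⇑(sumOp S S') := by
  rw [sumOp_eq]
  exact ((h.comp_clm (ContinuousLinearMap.fst ℂ H H' ∘L
      (WithLp.prodContinuousLinearEquiv 2 ℂ H H').toContinuousLinearMap)).clm_comp
      ((WithLp.prodContinuousLinearEquiv 2 ℂ H H').symm.toContinuousLinearMap ∘L
        ContinuousLinearMap.inl ℂ H H')).add
    ((h'.comp_clm (ContinuousLinearMap.snd ℂ H H' ∘L
      (WithLp.prodContinuousLinearEquiv 2 ℂ H H').toContinuousLinearMap)).clm_comp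
      ((WithLp.prodContinuousLinearEquiv 2 ℂ H H').symm.toContinuousLinearMap ∘L
        ContinuousLinearMap.inr ℂ H H'))

theorem sumOp_hasNoetherianRange {S : H →L[ℂ] H} {S' : H' →L[ℂ] H'}
    (h : S.toLinearMap.HasNoetherianRange) (h' : S'.toLinearMap.HasNoetherianRange) :
    (sumOp S S').toLinearMap.HasNoetherianRange := by
  rw [sumOp_eq]
  exact ((h.comp_right _).comp_left _).add ((h'.comp_right _).comp_left _)

theorem sumOp_equiv_id {S R : H →L[ℂ] H} {S' R' : H' →L[ℂ] H'}
    (h : (R.toLinearMap ∘ₗ S.toLinearMap - LinearMap.id).HasNoetherianRange)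
    (h' : (R'.toLinearMap ∘ₗ S'.toLinearMap - LinearMap.id).HasNoetherianRange) :
    ((sumOp R R').toLinearMap ∘ₗ (sumOp S S').toLinearMap -
      LinearMap.id).HasNoetherianRange := by
  have e : (R * S - 1).toLinearMap = R.toLinearMap ∘ₗ S.toLinearMap - LinearMap.id := by
    ext x; simp
  have e' : (R' * S' - 1).toLinearMap = R'.toLinearMap ∘ₗ S'.toLinearMap - LinearMap.id := by
    ext x; simp
  have e'' : (sumOp R R').toLinearMap ∘ₗ (sumOp S S').toLinearMap - LinearMap.id =
      (sumOp (R * S - 1) (R' * S' - 1)).toLinearMap := by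
    ext x
    apply withLp_ext <;> simp
  rw [e'']
  rw [← e] at h
  rw [← e'] at h'
  exact sumOp_hasNoetherianRange h h'

theorem sumOp_isFredholm {S : H →L[ℂ] H} {S' : H' →L[ℂ] H'} (h : S.IsFredholm)
    (h' : S'.IsFredholm) : (sumOp S S').IsFredholm := by
  obtain ⟨R, hl, hr⟩ := ContinuousLinearMap.isFredholm_iff_exists_isQuasiInverse.mp h
  obtain ⟨R', hl', hr'⟩ := ContinuousLinearMap.isFredholm_iff_exists_isQuasiInverse.mp h'
  refine ContinuousLinearMap.isFredholm_iff_exists_isQuasiInverse.mpr ⟨sumOp R R', ?_, ?_⟩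
  · exact LinearMap.FiniteRangeSetoid.equiv_iff_hasNoetherianRange.mpr (sumOp_equiv_id
      (LinearMap.FiniteRangeSetoid.equiv_iff_hasNoetherianRange.mp hl)
      (LinearMap.FiniteRangeSetoid.equiv_iff_hasNoetherianRange.mp hl'))
  · exact LinearMap.FiniteRangeSetoid.equiv_iff_hasNoetherianRange.mpr (sumOp_equiv_id
      (LinearMap.FiniteRangeSetoid.equiv_iff_hasNoetherianRange.mp hr)
      (LinearMap.FiniteRangeSetoid.equiv_iff_hasNoetherianRange.mp hr'))

end DirectSumOperators

namespace KData

variable {X : Type v} [TopologicalSpace X]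

/-- The direct sum `(H ⊕ H', φ ⊕ φ', T ⊕ T')`. -/
def directSum (D D' : KData.{u} X) : KData.{u} X where
  H := WithLp 2 (D.H × D'.H)
  ε := sumOp D.ε D'.ε
  φ := AlgHom.ofLinearMap
    { toFun := fun f => sumOp (D.φ f) (D'.φ f)
      map_add' := fun f g => by simp only [map_add, sumOp_add]
      map_smul' := fun c f => by simp only [map_smul, sumOp_smul, RingHom.id_apply] }
    (by simp only [LinearMap.coe_mk, AddHom.coe_mk, map_one, sumOp_one])
    (fun f g => by simp only [LinearMap.coe_mk, AddHom.coe_mk, map_mul, sumOp_mul])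
  T := sumOp D.T D'.T

theorem IsKasparov.directSum {D D' : KData.{u} X} (h : D.IsKasparov) (h' : D'.IsKasparov) :
    (D.directSum D').IsKasparov where
  grading_sq := by
    change sumOp D.ε D'.ε * sumOp D.ε D'.ε = 1
    rw [← sumOp_mul, h.grading_sq, h'.grading_sq, sumOp_one]
  grading_selfAdjoint := by
    change star (sumOp D.ε D'.ε) = sumOp D.ε D'.ε
    rw [← sumOp_star, h.grading_selfAdjoint.star_eq, h'.grading_selfAdjoint.star_eq]
  map_star f := by
    change sumOp (D.φ (star f)) (D'.φ (star f)) = star (sumOp (D.φ f) (D'.φ f))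
    rw [← sumOp_star, h.map_star, h'.map_star]
  map_even f := by
    change sumOp D.ε D'.ε * sumOp (D.φ f) (D'.φ f) = sumOp (D.φ f) (D'.φ f) * sumOp D.ε D'.ε
    rw [← sumOp_mul, ← sumOp_mul, h.map_even, h'.map_even]
  selfAdjoint := by
    change star (sumOp D.T D'.T) = sumOp D.T D'.T
    rw [← sumOp_star, h.selfAdjoint.star_eq, h'.selfAdjoint.star_eq]
  odd := by
    change sumOp D.ε D'.ε * sumOp D.T D'.T = -(sumOp D.T D'.T * sumOp D.ε D'.ε)
    rw [← sumOp_mul, ← sumOp_mul, h.odd, h'.odd, sumOp_neg]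
  fredholm := sumOp_isFredholm h.fredholm h'.fredholm
  compact_commutator f := by
    change IsCompactOperator ⇑(sumOp D.T D'.T * sumOp (D.φ f) (D'.φ f) -
      sumOp (D.φ f) (D'.φ f) * sumOp D.T D'.T)
    rw [← sumOp_mul, ← sumOp_mul, ← sumOp_sub]
    exact sumOp_isCompact (h.compact_commutator f) (h'.compact_commutator f)

/-- The module with `H = 0`. -/
def zero (X : Type v) [TopologicalSpace X] : KData.{u} X where
  H := EuclideanSpace ℂ PEmpty.{u + 1}
  ε := 0
  φ := AlgHom.ofLinearMap 0 (Subsingleton.elim _ _) (fun _ _ => Subsingleton.elim _ _)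
  T := 0

instance : Subsingleton (zero.{u} X).H :=
  inferInstanceAs (Subsingleton (EuclideanSpace ℂ PEmpty.{u + 1}))

theorem isKasparov_zero : (zero.{u} X).IsKasparov where
  grading_sq := Subsingleton.elim _ _
  grading_selfAdjoint := Subsingleton.elim _ _
  map_star _ := Subsingleton.elim _ _
  map_even _ := Subsingleton.elim _ _
  selfAdjoint := Subsingleton.elim _ _
  odd := Subsingleton.elim _ _
  fredholm := by
    have : (zero.{u} X).T = 1 := Subsingleton.elim _ _
    rw [this]
    exact ContinuousLinearMap.IsFredholm.of_isQuasiInverse (v := 1)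
      (LinearEquiv.refl ℂ (zero.{u} X).H).isQuasiInverse
  compact_commutator f := by
    rw [Subsingleton.elim ((zero.{u} X).T * (zero.{u} X).φ f - (zero.{u} X).φ f * (zero.{u} X).T) 0]
    exact isCompactOperator_zero

end KData

/-! ### Fake K-homology -/

/-- Kasparov modules over the algebra of continuous functions on `X`. -/
def KModule (X : Type v) [TopologicalSpace X] : Type (max v (u + 1)) :=
  { D : KData.{u} X // D.IsKasparov }

namespace KModule

variable {X : Type v} [TopologicalSpace X]

instance : Add (KModule.{u} X) := ⟨fun D D' => ⟨D.1.directSum D'.1, D.2.directSum D'.2⟩⟩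

instance : Zero (KModule.{u} X) := ⟨⟨KData.zero X, KData.isKasparov_zero⟩⟩

/-- Unitary equivalence: a unitary of degree `0` carrying `(φ, T)` to `(φ', T')`. -/
def UnitaryEquiv (D D' : KModule.{u} X) : Prop :=
  ∃ U : D.1.H ≃ₗᵢ[ℂ] D'.1.H, (∀ x, U (D.1.ε x) = D'.1.ε (U x)) ∧
    (∀ f x, U (D.1.φ f x) = D'.1.φ f (U x)) ∧ (∀ x, U (D.1.T x) = D'.1.T (U x))

/-- `T` is invertible and commutes with the action. -/
def IsDegenerate (D : KModule.{u} X) : Prop :=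
  IsUnit D.1.T ∧ ∀ f, D.1.T * D.1.φ f = D.1.φ f * D.1.T

/-- The identifications defining fake K-homology. A homotopy is a norm-continuous path of operators
on a fixed graded Hilbert space with action, all of whose members are Kasparov modules. -/
inductive Rel : KModule.{u} X → KModule.{u} X → Prop
  | unitary (D D' : KModule.{u} X) (h : UnitaryEquiv D D') : Rel D D'
  | homotopy (D : KData.{u} X) (S : unitInterval → (D.H →L[ℂ] D.H)) (hS : Continuous S)
      (h : ∀ t, (D.withOp (S t)).IsKasparov) :
      Rel ⟨D.withOp (S 0), h 0⟩ ⟨D.withOp (S 1), h 1⟩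
  | degenerate (D D' : KModule.{u} X) (h : IsDegenerate D') : Rel (D + D') D

theorem rel_assoc (a b c : KModule.{u} X) : Rel (a + b + c) (a + (b + c)) :=
  .unitary _ _ ⟨LinearIsometryEquiv.withLpProdAssoc 2 ℂ a.1.H b.1.H c.1.H,
    fun _ => rfl, fun _ _ => rfl, fun _ => rfl⟩

theorem rel_comm (a b : KModule.{u} X) : Rel (a + b) (b + a) :=
  .unitary _ _ ⟨LinearIsometryEquiv.withLpProdComm 2 ℂ a.1.H b.1.H,
    fun _ => rfl, fun _ _ => rfl, fun _ => rfl⟩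

theorem rel_add_zero (a : KModule.{u} X) : Rel (a + 0) a :=
  .degenerate a 0 ⟨⟨1, Subsingleton.elim (α := (KData.zero.{u} X).H →L[ℂ] _) _ _⟩,
    fun _ => Subsingleton.elim (α := (KData.zero.{u} X).H →L[ℂ] _) _ _⟩

end KModule

/-- The fake K-homology of a space: Kasparov modules modulo the equivalence relation,
compatible with direct sums, generated by `KModule.Rel`. -/
def KHomology (X : Type v) [TopologicalSpace X] : Type (max v (u + 1)) :=
  (addConGen (KModule.Rel.{u} (X := X))).Quotient

namespace KHomology

variable {X : Type v} [TopologicalSpace X]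

/-- The class of a Kasparov module. -/
def mk (D : KModule.{u} X) : KHomology.{u} X :=
  AddCon.toQuotient (c := addConGen (KModule.Rel.{u} (X := X))) D

theorem sound {D D' : KModule.{u} X} (h : KModule.Rel D D') : mk D = mk D' :=
  (AddCon.eq _).mpr (AddConGen.Rel.of _ _ h)

instance : Add (KHomology.{u} X) :=
  inferInstanceAs (Add (addConGen (KModule.Rel.{u} (X := X))).Quotient)

instance : Zero (KHomology.{u} X) := ⟨mk 0⟩

theorem mk_add (D D' : KModule.{u} X) : mk (D + D') = mk D + mk D' := rfl

theorem mk_zero : mk (0 : KModule.{u} X) = 0 := rfl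

theorem ind {P : KHomology.{u} X → Prop} (h : ∀ D, P (mk D)) (x : KHomology.{u} X) : P x :=
  AddCon.induction_on x h

/-- Addition is the direct sum. -/
instance : AddCommMonoid (KHomology.{u} X) where
  add_assoc a b c := by
    induction a using ind; induction b using ind; induction c using ind
    exact sound (KModule.rel_assoc _ _ _)
  add_comm a b := by
    induction a using ind; induction b using ind
    exact sound (KModule.rel_comm _ _)
  add_zero a := by
    induction a using ind
    exact sound (KModule.rel_add_zero _)
  zero_add a := by
    induction a using ind
    exact (sound (KModule.rel_comm _ _)).trans (sound (KModule.rel_add_zero _))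
  nsmul := nsmulRec

end KHomology

/-! ### Equivariant Hermitian bundles -/

/-- A `G`-equivariant Hermitian vector bundle over `Y`, of finite and locally constant rank: finite
dimensional Hermitian fibres, unitary local trivializations over open sets (`triv x₀` trivializes
over a neighbourhood `U x₀` of `x₀`, with model fibre the fibre at `x₀`) with continuous
transition functions, and a continuous unitary action of `G` covering the action on `Y`. -/
structure HermBundle (G : Type z) (Y : Type v) [Group G] [TopologicalSpace G]
    [TopologicalSpace Y] [MulAction G Y] where
  fiber : Y → Type w
  [normed : ∀ x, NormedAddCommGroup (fiber x)]
  [innerProduct : ∀ x, InnerProductSpace ℂ (fiber x)]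
  [finite : ∀ x, FiniteDimensional ℂ (fiber x)]
  U : Y → Set Y
  isOpen_U : ∀ x₀, IsOpen (U x₀)
  mem_U : ∀ x₀, x₀ ∈ U x₀
  triv : ∀ x₀ x, x ∈ U x₀ → (fiber x ≃ₗᵢ[ℂ] fiber x₀)
  continuous_transition : ∀ x₀ x₁ (e : fiber x₀),
    Continuous fun x : {x // x ∈ U x₀ ∧ x ∈ U x₁} =>
      triv x₁ x.1 x.2.2 ((triv x₀ x.1 x.2.1).symm e)
  act : ∀ (g : G) {x y : Y}, g • x = y → (fiber x ≃ₗᵢ[ℂ] fiber y)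
  act_one : ∀ {x : Y} (h : (1 : G) • x = x) (e : fiber x), act 1 h e = e
  act_mul : ∀ (g g' : G) {x y z : Y} (h : g • x = y) (h' : g' • y = z) (h'' : (g' * g) • x = z)
    (e : fiber x), act (g' * g) h'' e = act g' h' (act g h e)
  continuous_act : ∀ x₀ y₀ (e : fiber x₀),
    Continuous fun q : {q : G × Y // q.2 ∈ U x₀ ∧ q.1 • q.2 ∈ U y₀} =>
      triv y₀ (q.1.1 • q.1.2) q.2.2 (act q.1.1 rfl ((triv x₀ q.1.2 q.2.1).symm e))

attribute [instance] HermBundle.normed HermBundle.innerProduct HermBundle.finite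

/-- The coarse space `|𝒴| = Y/G` of the quotient orbispace, with the quotient topology. -/
abbrev Orb (G : Type z) (Y : Type v) [Group G] [MulAction G Y] : Type v :=
  MulAction.orbitRel.Quotient G Y

/-- The orbit of a point. -/
def orb (G : Type z) {Y : Type v} [Group G] [MulAction G Y] (y : Y) : Orb G Y :=
  Quotient.mk (MulAction.orbitRel G Y) y

theorem orb_eq (G : Type z) {Y : Type v} [Group G] [MulAction G Y] {g : G} {x y : Y}
    (h : g • x = y) : orb G x = orb G y :=
  Quotient.sound' (s₁ := MulAction.orbitRel G Y)
    (((MulAction.orbitRel G Y).symm' ⟨g, h⟩ : (MulAction.orbitRel G Y) x y))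

theorem continuous_orb (G : Type z) {Y : Type v} [Group G] [MulAction G Y] [TopologicalSpace Y] :
    Continuous (orb G : Y → Orb G Y) :=
  continuous_quot_mk

namespace HermBundle

variable {G : Type z} {Y : Type v} [Group G] [TopologicalSpace G] [TopologicalSpace Y]
  [MulAction G Y]

/-- A family of endomorphisms of the fibres is continuous and equivariant, that is, it is an
endomorphism of the `G`-bundle. -/
structure IsEnd (E : HermBundle.{v, w, z} G Y) (L : ∀ x, E.fiber x →ₗ[ℂ] E.fiber x) : Prop where
  continuous : ∀ x₀ (e : E.fiber x₀), Continuous fun x : {x // x ∈ E.U x₀} =>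
    E.triv x₀ x.1 x.2 (L x.1 ((E.triv x₀ x.1 x.2).symm e))
  equivariant : ∀ (g : G) {x y : Y} (h : g • x = y) (e : E.fiber x),
    E.act g h (L x e) = L y (E.act g h e)

/-- A family of unitary isomorphisms of the fibres is continuous and equivariant, that is, it is a
unitary isomorphism of `G`-bundles. -/
structure IsIso (E F : HermBundle.{v, w, z} G Y) (V : ∀ x, E.fiber x ≃ₗᵢ[ℂ] F.fiber x) :
    Prop where
  continuous : ∀ x₀ (e : E.fiber x₀), Continuous fun x : {x // x ∈ E.U x₀ ∧ x ∈ F.U x₀} =>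
    F.triv x₀ x.1 x.2.2 (V x.1 ((E.triv x₀ x.1 x.2.1).symm e))
  equivariant : ∀ (g : G) {x y : Y} (h : g • x = y) (e : E.fiber x),
    F.act g h (V x e) = V y (E.act g h e)

/-- Isotropy groups act trivially on the fibres. -/
def IsotropyTrivial (E : HermBundle.{v, w, z} G Y) : Prop :=
  ∀ (g : G) {x : Y} (h : g • x = x) (e : E.fiber x), E.act g h e = e

/-- Continuous sections of the orbibundle `E/G → Y/G`: the continuous `G`-equivariant sections
of `E`. -/
def sections (E : HermBundle.{v, w, z} G Y) : AddSubgroup (∀ x, E.fiber x) where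
  carrier := {s | (∀ x₀, Continuous fun x : {x // x ∈ E.U x₀} => E.triv x₀ x.1 x.2 (s x.1)) ∧
    ∀ (g : G) {x y : Y} (h : g • x = y), E.act g h (s x) = s y}
  zero_mem' := ⟨fun x₀ => by simpa using continuous_const, fun g x y h => by simp⟩
  add_mem' := fun {s t} hs ht => ⟨fun x₀ => ((hs.1 x₀).add (ht.1 x₀)).congr fun _ => (map_add _ _ _).symm,
    fun g x y h => by simp [hs.2 g h, ht.2 g h]⟩
  neg_mem' := fun {s} hs => ⟨fun x₀ => (hs.1 x₀).neg.congr fun _ => (map_neg _ _).symm,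
    fun g x y h => by simp [hs.2 g h]⟩

/-- Functions on `Y/G` act on sections by pointwise multiplication. -/
instance (E : HermBundle.{v, w, z} G Y) : SMul C(Orb G Y, ℂ) E.sections where
  smul f s := ⟨fun x => f (orb G x) • s.1 x, fun x₀ =>
      ((f.continuous.comp ((continuous_orb G).comp continuous_subtype_val)).smul
        (s.2.1 x₀)).congr fun _ => (map_smul _ _ _).symm, fun g x y h => by simp [s.2.2 g h, orb_eq G h]⟩

theorem smul_apply (E : HermBundle.{v, w, z} G Y) (f : C(Orb G Y, ℂ)) (s : E.sections) (x : Y) :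
    (f • s).1 x = f (orb G x) • s.1 x := rfl

instance (E : HermBundle.{v, w, z} G Y) : Module C(Orb G Y, ℂ) E.sections where
  one_smul s := Subtype.ext (funext fun x => by simp [smul_apply])
  mul_smul f f' s := Subtype.ext (funext fun x => by simp [smul_apply, mul_smul])
  smul_zero f := Subtype.ext (funext fun x => by
    rw [smul_apply]; exact smul_zero _)
  smul_add f s t := Subtype.ext (funext fun x => by
    rw [smul_apply]; exact smul_add _ _ _)
  add_smul f f' s := Subtype.ext (funext fun x => by
    rw [smul_apply]; exact add_smul _ _ _)
  zero_smul s := Subtype.ext (funext fun x => by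
    rw [smul_apply]; exact zero_smul _ _)

/-- An endomorphism maps continuous sections to continuous sections. -/
theorem IsEnd.continuous_section {E : HermBundle.{v, w, z} G Y}
    {L : ∀ x, E.fiber x →ₗ[ℂ] E.fiber x} (hL : E.IsEnd L) (s : E.sections) (x₀ : Y) :
    Continuous fun x : {x // x ∈ E.U x₀} => E.triv x₀ x.1 x.2 (L x.1 (s.1 x.1)) := by
  let b := stdOrthonormalBasis ℂ (E.fiber x₀)
  have key : ∀ x : {x // x ∈ E.U x₀}, E.triv x₀ x.1 x.2 (L x.1 (s.1 x.1)) =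
      ∑ i, (inner ℂ (b i) (E.triv x₀ x.1 x.2 (s.1 x.1))) •
        E.triv x₀ x.1 x.2 (L x.1 ((E.triv x₀ x.1 x.2).symm (b i))) := by
    intro x
    have : s.1 x.1 = (E.triv x₀ x.1 x.2).symm
        (∑ i, (inner ℂ (b i) (E.triv x₀ x.1 x.2 (s.1 x.1))) • b i) := by
      rw [b.sum_repr', LinearIsometryEquiv.symm_apply_apply]
    conv_lhs => rw [this]
    simp only [map_sum, map_smul]
  simp only [key]
  exact continuous_finsetSum _ fun i _ =>
    (continuous_const.inner (s.2.1 x₀)).smul (hL.continuous x₀ (b i))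

/-- The homomorphism `C(L)` induced on sections by an endomorphism `L`. -/
def IsEnd.onSections {E : HermBundle.{v, w, z} G Y}
    {L : ∀ x, E.fiber x →ₗ[ℂ] E.fiber x} (hL : E.IsEnd L) :
    E.sections →ₗ[C(Orb G Y, ℂ)] E.sections where
  toFun s := ⟨fun x => L x (s.1 x), hL.continuous_section s,
    fun g x y h => by rw [hL.equivariant, s.2.2 g h]⟩
  map_add' s t := Subtype.ext (funext fun x => map_add (L x) (s.1 x) (t.1 x))
  map_smul' f s := Subtype.ext (funext fun x => map_smul (L x) (f (orb G x)) (s.1 x))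

/-- The orthogonal direct sum of two bundles. -/
def directSum (E F : HermBundle.{v, w, z} G Y) : HermBundle.{v, w, z} G Y where
  fiber x := WithLp 2 (E.fiber x × F.fiber x)
  finite x := inferInstance
  U x₀ := E.U x₀ ∩ F.U x₀
  isOpen_U x₀ := (E.isOpen_U x₀).inter (F.isOpen_U x₀)
  mem_U x₀ := ⟨E.mem_U x₀, F.mem_U x₀⟩
  triv x₀ x h := LinearIsometryEquiv.withLpProdCongr 2 (E.triv x₀ x h.1) (F.triv x₀ x h.2)
  continuous_transition x₀ x₁ e := by
    have h1 := (E.continuous_transition x₀ x₁ e.fst).comp (Continuous.subtype_mk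
      continuous_subtype_val (fun x : {x // x ∈ E.U x₀ ∩ F.U x₀ ∧ x ∈ E.U x₁ ∩ F.U x₁} =>
        ⟨x.2.1.1, x.2.2.1⟩))
    have h2 := (F.continuous_transition x₀ x₁ e.snd).comp (Continuous.subtype_mk
      continuous_subtype_val (fun x : {x // x ∈ E.U x₀ ∩ F.U x₀ ∧ x ∈ E.U x₁ ∩ F.U x₁} =>
        ⟨x.2.1.2, x.2.2.2⟩))
    exact (WithLp.prodContinuousLinearEquiv 2 ℂ _ _).symm.continuous.comp (h1.prodMk h2)
  act g x y h := LinearIsometryEquiv.withLpProdCongr 2 (E.act g h) (F.act g h)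
  act_one h e := withLp_ext (E.act_one h e.fst) (F.act_one h e.snd)
  act_mul g g' x y z h h' h'' e :=
    withLp_ext (E.act_mul g g' h h' h'' e.fst) (F.act_mul g g' h h' h'' e.snd)
  continuous_act x₀ y₀ e := by
    have h1 := (E.continuous_act x₀ y₀ e.fst).comp (Continuous.subtype_mk
      continuous_subtype_val (fun q : {q : G × Y // q.2 ∈ E.U x₀ ∩ F.U x₀ ∧
        q.1 • q.2 ∈ E.U y₀ ∩ F.U y₀} => ⟨q.2.1.1, q.2.2.1⟩))
    have h2 := (F.continuous_act x₀ y₀ e.snd).comp (Continuous.subtype_mk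
      continuous_subtype_val (fun q : {q : G × Y // q.2 ∈ E.U x₀ ∩ F.U x₀ ∧
        q.1 • q.2 ∈ E.U y₀ ∩ F.U y₀} => ⟨q.2.1.2, q.2.2.2⟩))
    exact (WithLp.prodContinuousLinearEquiv 2 ℂ _ _).symm.continuous.comp (h1.prodMk h2)

/-- The bundle of rank `0`. -/
def zero (G : Type z) (Y : Type v) [Group G] [TopologicalSpace G] [TopologicalSpace Y]
    [MulAction G Y] : HermBundle.{v, w, z} G Y where
  fiber _ := EuclideanSpace ℂ PEmpty.{w + 1}
  U _ := Set.univ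
  isOpen_U _ := isOpen_univ
  mem_U _ := Set.mem_univ _
  triv _ _ _ := LinearIsometryEquiv.refl ℂ _
  continuous_transition _ _ _ := continuous_const
  act _ _ _ _ := LinearIsometryEquiv.refl ℂ _
  act_one _ _ := rfl
  act_mul _ _ _ _ _ _ _ _ _ := rfl
  continuous_act _ _ _ := continuous_const

/-- The pullback of a bundle along a continuous equivariant map. -/
def pullback {Z : Type v} [TopologicalSpace Z] [MulAction G Z] (E : HermBundle.{v, w, z} G Z)
    (f : C(Y, Z)) (hf : ∀ (g : G) (y : Y), f (g • y) = g • f y) : HermBundle.{v, w, z} G Y where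
  fiber y := E.fiber (f y)
  U y₀ := f ⁻¹' E.U (f y₀)
  isOpen_U y₀ := (E.isOpen_U (f y₀)).preimage f.continuous
  mem_U y₀ := E.mem_U (f y₀)
  triv y₀ y h := E.triv (f y₀) (f y) h
  continuous_transition y₀ y₁ e :=
    (E.continuous_transition (f y₀) (f y₁) e).comp (Continuous.subtype_mk
      (f.continuous.comp continuous_subtype_val)
      (fun y : {y // y ∈ f ⁻¹' E.U (f y₀) ∧ y ∈ f ⁻¹' E.U (f y₁)} => y.2))
  act g x y h := E.act g (by rw [← hf, h])
  act_one h e := E.act_one _ e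
  act_mul g g' x y z h h' h'' e := E.act_mul g g' _ _ _ e
  continuous_act x₀ y₀ e := by
    have h := (E.continuous_act (f x₀) (f y₀) e).comp (Continuous.subtype_mk
      ((continuous_fst.prodMk (f.continuous.comp continuous_snd)).comp continuous_subtype_val)
      (fun q : {q : G × Y // q.2 ∈ f ⁻¹' E.U (f x₀) ∧ q.1 • q.2 ∈ f ⁻¹' E.U (f y₀)} =>
        (⟨q.2.1, by have := q.2.2; rwa [Set.mem_preimage, hf] at this⟩ :
          f q.1.2 ∈ E.U (f x₀) ∧ q.1.1 • f q.1.2 ∈ E.U (f y₀))))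
    have aux : ∀ (g : G) (a b : Z) (c : Z) (hab : g • a = b) (hb : b ∈ E.U c)
        (hb' : g • a ∈ E.U c) (v : E.fiber a),
        E.triv c b hb (E.act g hab v) = E.triv c (g • a) hb' (E.act g rfl v) := by
      intro g a b c hab hb hb' v
      subst hab
      rfl
    refine h.congr fun q => (aux _ _ _ _ _ _ _ _).symm

end HermBundle

/-! ### Fake K-theory -/

/-- The direct sum of two linear maps, on the orthogonal direct sum of the spaces. -/
def sumLin {V W : Type w} [NormedAddCommGroup V] [InnerProductSpace ℂ V] [NormedAddCommGroup W]
    [InnerProductSpace ℂ W] (L : V →ₗ[ℂ] V) (M : W →ₗ[ℂ] W) :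
    WithLp 2 (V × W) →ₗ[ℂ] WithLp 2 (V × W) :=
  (L.prodMap M).withLpMap 2

/-- A cocycle for the fake K-group of `(Y/G, B/G)`: a `ℤ/2`-graded Hermitian `G`-bundle (with
grading operator `ε`) on which the isotropy groups act trivially, with a self-adjoint endomorphism
`α` of degree `1` that is an isomorphism at every point of `B`. -/
structure Cocycle (G : Type z) (Y : Type v) [Group G] [TopologicalSpace G] [TopologicalSpace Y]
    [MulAction G Y] (B : Set Y) where
  E : HermBundle.{v, w, z} G Y
  isotropy : E.IsotropyTrivial
  ε : ∀ x, E.fiber x →ₗ[ℂ] E.fiber x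
  ε_isEnd : E.IsEnd ε
  ε_symm : ∀ x, (ε x).IsSymmetric
  ε_sq : ∀ x e, ε x (ε x e) = e
  α : ∀ x, E.fiber x →ₗ[ℂ] E.fiber x
  α_isEnd : E.IsEnd α
  α_symm : ∀ x, (α x).IsSymmetric
  α_odd : ∀ x e, ε x (α x e) = -α x (ε x e)
  α_iso : ∀ x ∈ B, Function.Bijective (α x)

/-- The cylinder `Y × [0,1]`, on which `G` acts through the first factor. -/
def Cyl (Y : Type v) : Type v := Y × unitInterval

instance {Y : Type v} [TopologicalSpace Y] : TopologicalSpace (Cyl Y) :=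
  inferInstanceAs (TopologicalSpace (Y × unitInterval))

instance {G : Type z} {Y : Type v} [Group G] [MulAction G Y] : MulAction G (Cyl Y) where
  smul g p := (g • p.1, p.2)
  one_smul p := Prod.ext (one_smul G p.1) rfl
  mul_smul g h p := Prod.ext (mul_smul g h p.1) rfl

/-- The inclusion of `Y × {t}` in the cylinder. -/
def cylIncl {Y : Type v} [TopologicalSpace Y] (t : unitInterval) : C(Y, Cyl Y) where
  toFun y := (y, t)
  continuous_toFun := continuous_id.prodMk continuous_const

namespace Cocycle

variable {G : Type z} {Y : Type v} [Group G] [TopologicalSpace G] [TopologicalSpace Y]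
  [MulAction G Y] {B : Set Y}

theorem isEnd_sum {E F : HermBundle.{v, w, z} G Y} {L : ∀ x, E.fiber x →ₗ[ℂ] E.fiber x}
    {M : ∀ x, F.fiber x →ₗ[ℂ] F.fiber x} (hL : E.IsEnd L) (hM : F.IsEnd M) :
    (E.directSum F).IsEnd fun x => sumLin (L x) (M x) where
  continuous x₀ e := by
    have h1 := (hL.continuous x₀ e.fst).comp (Continuous.subtype_mk continuous_subtype_val
      (fun x : {x // x ∈ E.U x₀ ∩ F.U x₀} => x.2.1))
    have h2 := (hM.continuous x₀ e.snd).comp (Continuous.subtype_mk continuous_subtype_val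
      (fun x : {x // x ∈ E.U x₀ ∩ F.U x₀} => x.2.2))
    exact (WithLp.prodContinuousLinearEquiv 2 ℂ _ _).symm.continuous.comp (h1.prodMk h2)
  equivariant g x y h e :=
    withLp_ext (hL.equivariant g h e.fst) (hM.equivariant g h e.snd)

theorem isEnd_pullback {E : HermBundle.{v, w, z} G (Cyl Y)}
    {L : ∀ x, E.fiber x →ₗ[ℂ] E.fiber x} (hL : E.IsEnd L) (t : unitInterval) :
    (E.pullback (cylIncl (Y := Y) t) (fun _ _ => rfl)).IsEnd fun x => L (cylIncl t x) where
  continuous x₀ e := (hL.continuous (cylIncl t x₀) e).comp (Continuous.subtype_mk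
    ((cylIncl t).continuous.comp continuous_subtype_val)
    (fun x : {x // x ∈ (cylIncl t) ⁻¹' E.U (cylIncl t x₀)} => x.2))
  equivariant g x y h e := hL.equivariant g _ e

theorem symm_sum {V W : Type w} [NormedAddCommGroup V] [InnerProductSpace ℂ V]
    [NormedAddCommGroup W] [InnerProductSpace ℂ W] {L : V →ₗ[ℂ] V} {M : W →ₗ[ℂ] W}
    (hL : L.IsSymmetric) (hM : M.IsSymmetric) : (sumLin L M).IsSymmetric := fun a b => by
  have h1 := hL a.fst b.fst
  have h2 := hM a.snd b.snd
  change inner ℂ (L a.fst) b.fst + inner ℂ (M a.snd) b.snd =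
    inner ℂ a.fst (L b.fst) + inner ℂ a.snd (M b.snd)
  rw [h1, h2]

theorem bij_sum {V W : Type w} [NormedAddCommGroup V] [InnerProductSpace ℂ V]
    [NormedAddCommGroup W] [InnerProductSpace ℂ W] {L : V →ₗ[ℂ] V} {M : W →ₗ[ℂ] W}
    (hL : Function.Bijective L) (hM : Function.Bijective M) : Function.Bijective (sumLin L M) :=
  (WithLp.equiv 2 (V × W)).symm.bijective.comp
    ((hL.prodMap hM).comp (WithLp.equiv 2 (V × W)).bijective)

instance : Add (Cocycle.{v, w, z} G Y B) where
  add p q :=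
    { E := p.E.directSum q.E
      isotropy := fun g x h e => withLp_ext (p.isotropy g h e.fst) (q.isotropy g h e.snd)
      ε := fun x => sumLin (p.ε x) (q.ε x)
      ε_isEnd := isEnd_sum p.ε_isEnd q.ε_isEnd
      ε_symm := fun x => symm_sum (p.ε_symm x) (q.ε_symm x)
      ε_sq := fun x e => withLp_ext (p.ε_sq x e.fst) (q.ε_sq x e.snd)
      α := fun x => sumLin (p.α x) (q.α x)
      α_isEnd := isEnd_sum p.α_isEnd q.α_isEnd
      α_symm := fun x => symm_sum (p.α_symm x) (q.α_symm x)
      α_odd := fun x e => withLp_ext (p.α_odd x e.fst) (q.α_odd x e.snd)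
      α_iso := fun x hx => bij_sum (p.α_iso x hx) (q.α_iso x hx) }

instance : Zero (Cocycle.{v, w, z} G Y B) where
  zero :=
    { E := HermBundle.zero G Y
      isotropy := fun _ _ _ _ => rfl
      ε := fun _ => LinearMap.id
      ε_isEnd := ⟨fun _ _ => continuous_const, fun _ _ _ _ _ => rfl⟩
      ε_symm := fun _ _ _ => rfl
      ε_sq := fun _ _ => rfl
      α := fun _ => LinearMap.id
      α_isEnd := ⟨fun _ _ => continuous_const, fun _ _ _ _ _ => rfl⟩
      α_symm := fun _ _ _ => rfl
      α_odd := fun _ _ => Subsingleton.elim (α := EuclideanSpace ℂ PEmpty.{w + 1}) _ _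
      α_iso := fun _ _ => Function.bijective_id }

/-- The restriction of a cocycle on the cylinder to `Y × {t}`. -/
def restrict (p : Cocycle.{v, w, z} G (Cyl Y) {q : Cyl Y | q.1 ∈ B}) (t : unitInterval) :
    Cocycle.{v, w, z} G Y B where
  E := p.E.pullback (cylIncl t) (fun _ _ => rfl)
  isotropy g x h e := p.isotropy g _ e
  ε x := p.ε (cylIncl t x)
  ε_isEnd := isEnd_pullback p.ε_isEnd t
  ε_symm x := p.ε_symm _
  ε_sq x := p.ε_sq _
  α x := p.α (cylIncl t x)
  α_isEnd := isEnd_pullback p.α_isEnd t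
  α_symm x := p.α_symm _
  α_odd x := p.α_odd _
  α_iso x hx := p.α_iso _ hx

/-- Isomorphism: a unitary isomorphism of bundles carrying `(ε, α)` to `(ε', α')`. -/
def Iso (p q : Cocycle.{v, w, z} G Y B) : Prop :=
  ∃ V : ∀ x, p.E.fiber x ≃ₗᵢ[ℂ] q.E.fiber x, HermBundle.IsIso p.E q.E V ∧
    (∀ x e, V x (p.ε x e) = q.ε x (V x e)) ∧ (∀ x e, V x (p.α x e) = q.α x (V x e))

/-- `α` has empty support. -/
def IsDegenerate (p : Cocycle.{v, w, z} G Y B) : Prop :=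
  ∀ x, Function.Bijective (p.α x)

/-- The identifications defining the fake K-group. A homotopy is a cocycle on the cylinder. -/
inductive Rel : Cocycle.{v, w, z} G Y B → Cocycle.{v, w, z} G Y B → Prop
  | iso (p q : Cocycle.{v, w, z} G Y B) (h : Iso p q) : Rel p q
  | homotopy (p : Cocycle.{v, w, z} G (Cyl Y) {q : Cyl Y | q.1 ∈ B}) :
      Rel (p.restrict 0) (p.restrict 1)
  | degenerate (p q : Cocycle.{v, w, z} G Y B) (h : IsDegenerate q) : Rel (p + q) p

theorem rel_assoc (a b c : Cocycle.{v, w, z} G Y B) : Rel (a + b + c) (a + (b + c)) :=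
  .iso _ _ ⟨fun x => LinearIsometryEquiv.withLpProdAssoc 2 ℂ (a.E.fiber x) (b.E.fiber x)
    (c.E.fiber x), ⟨fun x₀ e => by
      have h := ((a + b + c).E.continuous_transition x₀ x₀ e).comp (Continuous.subtype_mk
        continuous_subtype_val (fun x : {x // x ∈ (a + b + c).E.U x₀ ∧
          x ∈ (a + (b + c)).E.U x₀} => ⟨x.2.1, x.2.1⟩))
      exact (LinearIsometryEquiv.withLpProdAssoc 2 ℂ (a.E.fiber x₀) (b.E.fiber x₀)
        (c.E.fiber x₀)).continuous.comp h,
    fun _ _ _ _ _ => rfl⟩, fun _ _ => rfl, fun _ _ => rfl⟩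

theorem rel_comm (a b : Cocycle.{v, w, z} G Y B) : Rel (a + b) (b + a) :=
  .iso _ _ ⟨fun x => LinearIsometryEquiv.withLpProdComm 2 ℂ (a.E.fiber x) (b.E.fiber x),
    ⟨fun x₀ e => by
      have h := ((a + b).E.continuous_transition x₀ x₀ e).comp (Continuous.subtype_mk
        continuous_subtype_val (fun x : {x // x ∈ (a + b).E.U x₀ ∧
          x ∈ (b + a).E.U x₀} => ⟨x.2.1, x.2.1⟩))
      exact (LinearIsometryEquiv.withLpProdComm 2 ℂ (a.E.fiber x₀)
        (b.E.fiber x₀)).continuous.comp h,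
    fun _ _ _ _ _ => rfl⟩, fun _ _ => rfl, fun _ _ => rfl⟩

theorem rel_add_zero (a : Cocycle.{v, w, z} G Y B) : Rel (a + 0) a :=
  .degenerate a 0 fun _ => Function.bijective_id

end Cocycle

/-- The fake K-group of `(Y/G, B/G)`: cocycles modulo the equivalence relation, compatible with
direct sums, generated by `Cocycle.Rel`. -/
def KFake (G : Type z) (Y : Type v) [Group G] [TopologicalSpace G] [TopologicalSpace Y]
    [MulAction G Y] (B : Set Y) : Type (max v z (w + 1)) :=
  (addConGen (Cocycle.Rel.{v, w, z} (G := G) (Y := Y) (B := B))).Quotient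

namespace KFake

variable {G : Type z} {Y : Type v} [Group G] [TopologicalSpace G] [TopologicalSpace Y]
  [MulAction G Y] {B : Set Y}

/-- The class of a cocycle. -/
def mk (p : Cocycle.{v, w, z} G Y B) : KFake.{v, w, z} G Y B :=
  AddCon.toQuotient (c := addConGen (Cocycle.Rel.{v, w, z} (G := G) (Y := Y) (B := B))) p

theorem sound {p q : Cocycle.{v, w, z} G Y B} (h : Cocycle.Rel p q) : mk p = mk q :=
  (AddCon.eq _).mpr (AddConGen.Rel.of _ _ h)

instance : Add (KFake.{v, w, z} G Y B) :=
  inferInstanceAs (Add (addConGen (Cocycle.Rel.{v, w, z} (G := G) (Y := Y) (B := B))).Quotient)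

instance : Zero (KFake.{v, w, z} G Y B) := ⟨mk 0⟩

theorem mk_add (p q : Cocycle.{v, w, z} G Y B) : mk (p + q) = mk p + mk q := rfl

theorem mk_zero : mk (0 : Cocycle.{v, w, z} G Y B) = 0 := rfl

theorem ind {P : KFake.{v, w, z} G Y B → Prop} (h : ∀ p, P (mk p)) (x : KFake.{v, w, z} G Y B) :
    P x :=
  AddCon.induction_on x h

/-- Addition is the direct sum. -/
instance : AddCommMonoid (KFake.{v, w, z} G Y B) where
  add_assoc a b c := by
    induction a using ind; induction b using ind; induction c using ind
    exact sound (Cocycle.rel_assoc _ _ _)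
  add_comm a b := by
    induction a using ind; induction b using ind
    exact sound (Cocycle.rel_comm _ _)
  add_zero a := by
    induction a using ind
    exact sound (Cocycle.rel_add_zero _)
  zero_add a := by
    induction a using ind
    exact (sound (Cocycle.rel_comm _ _)).trans (sound (Cocycle.rel_add_zero _))
  nsmul := nsmulRec

end KFake

/-! ### The cap product of representatives -/

/-- An idempotent presentation of the module of sections of `E`: an idempotent matrix `A` with
entries in the continuous functions on `Y/G`, and an isomorphism of modules of the sections of `E`
with the range of `A`. -/
structure Presentation {G : Type z} {Y : Type v} [Group G] [TopologicalSpace G]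
    [TopologicalSpace Y] [MulAction G Y] (E : HermBundle.{v, w, z} G Y) where
  n : ℕ
  A : Matrix (Fin n) (Fin n) C(Orb G Y, ℂ)
  idem : IsIdempotentElem A
  ι : E.sections ≃ₗ[C(Orb G Y, ℂ)] LinearMap.range A.mulVecLin

namespace Presentation

variable {G : Type z} {Y : Type v} [Group G] [TopologicalSpace G] [TopologicalSpace Y]
  [MulAction G Y] {E : HermBundle.{v, w, z} G Y}

/-- The matrix of an endomorphism `L` of the module of sections: `ι L ι⁻¹` on the range of `A`
(and `0` on the kernel of `A`). -/
def matrixOf (P : Presentation E) (L : E.sections →ₗ[C(Orb G Y, ℂ)] E.sections) :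
    Matrix (Fin P.n) (Fin P.n) C(Orb G Y, ℂ) :=
  LinearMap.toMatrix' ((LinearMap.range P.A.mulVecLin).subtype ∘ₗ P.ι.toLinearMap ∘ₗ L ∘ₗ
    P.ι.symm.toLinearMap ∘ₗ P.A.mulVecLin.rangeRestrict)

end Presentation

/-- An idempotent presentation of the sections of a graded Hermitian bundle is Hermitian if `A` is
self-adjoint, the isomorphism `ι` preserves the function-valued Hermitian products, and `ι` has
degree `0` for some `ℤ/2`-grading of the basis of the free module. -/
structure Presentation.IsHermitian {G : Type z} {Y : Type v} [Group G] [TopologicalSpace G]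
    [TopologicalSpace Y] [MulAction G Y] {B : Set Y} {p : Cocycle.{v, w, z} G Y B}
    (P : Presentation p.E) : Prop where
  selfAdjoint : P.A.IsHermitian
  isometry : ∀ (s t : p.E.sections) (y : Y), inner ℂ (s.1 y) (t.1 y) =
    ∑ i, star ((P.ι s).1 i (orb G y)) * (P.ι t).1 i (orb G y)
  graded : ∃ d : Fin P.n → ℤˣ, ∀ (s : p.E.sections) (i : Fin P.n),
    (P.ι (p.ε_isEnd.onSections s)).1 i = ((d i : ℤ) : ℂ) • (P.ι s).1 i

namespace KData

variable {X : Type v} [TopologicalSpace X] (D : KData.{u} X)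

/-- The Hilbert space `H^n`. -/
abbrev Pow (n : ℕ) : Type u := PiLp 2 (fun _ : Fin n => D.H)

/-- The action on `H^n` of a matrix of continuous functions, entrywise through `φ`. -/
def matOp {n : ℕ} (M : Matrix (Fin n) (Fin n) C(X, ℂ)) : D.Pow n →L[ℂ] D.Pow n :=
  (PiLp.continuousLinearEquiv 2 ℂ (fun _ : Fin n => D.H)).symm.toContinuousLinearMap ∘L
    (ContinuousLinearMap.pi fun i => ∑ j, D.φ (M i j) ∘L ContinuousLinearMap.proj j) ∘L
    (PiLp.continuousLinearEquiv 2 ℂ (fun _ : Fin n => D.H)).toContinuousLinearMap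

/-- The operator `S ⊕ ⋯ ⊕ S` on `H^n`. -/
def diagOp (n : ℕ) (S : D.H →L[ℂ] D.H) : D.Pow n →L[ℂ] D.Pow n :=
  (PiLp.continuousLinearEquiv 2 ℂ (fun _ : Fin n => D.H)).symm.toContinuousLinearMap ∘L
    (ContinuousLinearMap.pi fun i => S ∘L ContinuousLinearMap.proj i) ∘L
    (PiLp.continuousLinearEquiv 2 ℂ (fun _ : Fin n => D.H)).toContinuousLinearMap

theorem matOp_apply {n : ℕ} (M : Matrix (Fin n) (Fin n) C(X, ℂ)) (v : D.Pow n) (i : Fin n) :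
    D.matOp M v i = ∑ j, D.φ (M i j) (v j) := by
  simp [matOp]

theorem diagOp_apply (n : ℕ) (S : D.H →L[ℂ] D.H) (v : D.Pow n) (i : Fin n) :
    D.diagOp n S v i = S (v i) := by
  simp [diagOp]

theorem matOp_mul {n : ℕ} (M N : Matrix (Fin n) (Fin n) C(X, ℂ)) :
    D.matOp (M * N) = D.matOp M * D.matOp N := by
  ext v i
  simp only [matOp_apply, mul_apply_eq_comp, Matrix.mul_apply, map_sum, map_mul,
    sum_apply]
  rw [Finset.sum_comm]

theorem matOp_diagOp {n : ℕ} (M : Matrix (Fin n) (Fin n) C(X, ℂ)) (f : C(X, ℂ)) :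
    D.matOp M * D.diagOp n (D.φ f) = D.diagOp n (D.φ f) * D.matOp M := by
  ext v i
  simp only [matOp_apply, diagOp_apply, mul_apply_eq_comp, map_sum]
  refine Finset.sum_congr rfl fun j _ => ?_
  rw [← mul_apply_eq_comp, ← mul_apply_eq_comp, ← map_mul, ← map_mul,
    mul_comm]

/-- The subspace `im A` of `H^n`. -/
abbrev im {n : ℕ} (A : Matrix (Fin n) (Fin n) C(X, ℂ)) : Submodule ℂ (D.Pow n) :=
  LinearMap.range (D.matOp A).toLinearMap

/-- The operator on `im A` induced by an operator `S` on `H^n`: restrict to `im A`, then project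
back to `im A` by `A`. -/
def compress {n : ℕ} (A : Matrix (Fin n) (Fin n) C(X, ℂ)) (S : D.Pow n →L[ℂ] D.Pow n) :
    D.im A →L[ℂ] D.im A :=
  (D.matOp A ∘L S ∘L (D.im A).subtypeL).codRestrict (D.im A)
    (fun v => LinearMap.mem_range_self (D.matOp A).toLinearMap (S v))

theorem compress_apply {n : ℕ} (A : Matrix (Fin n) (Fin n) C(X, ℂ))
    (S : D.Pow n →L[ℂ] D.Pow n) (v : D.im A) :
    (D.compress A S v : D.Pow n) = D.matOp A (S v) := rfl

theorem matOp_of_mem {n : ℕ} {A : Matrix (Fin n) (Fin n) C(X, ℂ)} (hA : IsIdempotentElem A)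
    (v : D.im A) : D.matOp A v = v := by
  obtain ⟨_, w, rfl⟩ := v
  change D.matOp A (D.matOp A w) = D.matOp A w
  rw [← mul_apply_eq_comp, ← matOp_mul, hA.eq]

theorem compress_diagOp_apply {n : ℕ} {A : Matrix (Fin n) (Fin n) C(X, ℂ)}
    (hA : IsIdempotentElem A) (f : C(X, ℂ)) (v : D.im A) (i : Fin n) :
    (D.compress A (D.diagOp n (D.φ f)) v : D.Pow n) i = D.φ f ((v : D.Pow n) i) := by
  rw [compress_apply, ← mul_apply_eq_comp, matOp_diagOp, mul_apply_eq_comp,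
    D.matOp_of_mem hA, diagOp_apply]

theorem im_ext {n : ℕ} {A : Matrix (Fin n) (Fin n) C(X, ℂ)} {S R : D.im A →L[ℂ] D.im A}
    (h : ∀ v i, (S v : D.Pow n) i = (R v : D.Pow n) i) : S = R := by
  ext v i
  exact h v i

/-- The action on `im A` of the continuous functions. -/
def imAction {n : ℕ} {A : Matrix (Fin n) (Fin n) C(X, ℂ)} (hA : IsIdempotentElem A) :
    C(X, ℂ) →ₐ[ℂ] (D.im A →L[ℂ] D.im A) :=
  AlgHom.ofLinearMap
    { toFun := fun f => D.compress A (D.diagOp n (D.φ f))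
      map_add' := fun f g => D.im_ext fun v i => by
        rw [D.compress_diagOp_apply hA, map_add]
        change _ = (D.compress A (D.diagOp n (D.φ f)) v : D.Pow n) i +
          (D.compress A (D.diagOp n (D.φ g)) v : D.Pow n) i
        rw [D.compress_diagOp_apply hA, D.compress_diagOp_apply hA]
        rfl
      map_smul' := fun c f => D.im_ext fun v i => by
        rw [D.compress_diagOp_apply hA, map_smul]
        change _ = c • (D.compress A (D.diagOp n (D.φ f)) v : D.Pow n) i
        rw [D.compress_diagOp_apply hA]
        rfl }
    (D.im_ext fun v i => by
      change (D.compress A (D.diagOp n (D.φ 1)) v : D.Pow n) i = _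
      rw [D.compress_diagOp_apply hA, map_one]
      rfl)
    (fun f g => D.im_ext fun v i => by
      change (D.compress A (D.diagOp n (D.φ (f * g))) v : D.Pow n) i =
        (D.compress A (D.diagOp n (D.φ f)) (D.compress A (D.diagOp n (D.φ g)) v) : D.Pow n) i
      rw [D.compress_diagOp_apply hA, D.compress_diagOp_apply hA, D.compress_diagOp_apply hA,
        map_mul]
      rfl)

end KData

/-- The cap product of representatives, formed with a presentation `P`: on `im A ⊆ H^n`, with the
action and the grading `ε ⊗ C(ε)` induced by those of `H` and of the bundle, the operator
`T ⊗' 1 - ε ⊗ C(α)`, where `T ⊗' 1` is the compression of `T ⊕ ⋯ ⊕ T` by `A`. -/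
def capData {G : Type z} {Y : Type v} [Group G] [TopologicalSpace G] [TopologicalSpace Y]
    [MulAction G Y] {B : Set Y} (D : KModule.{u} (Orb G Y)) (p : Cocycle.{v, w, z} G Y B)
    (P : Presentation p.E) : KData.{u} (Orb G Y) where
  H := D.1.im P.A
  complete := by
    have h : IsIdempotentElem (D.1.matOp P.A) := by
      rw [IsIdempotentElem, ← KData.matOp_mul, P.idem.eq]
    exact (ContinuousLinearMap.IsIdempotentElem.isClosed_range h).completeSpace_coe
  ε := D.1.compress P.A
    (D.1.diagOp P.n D.1.ε * D.1.matOp (P.matrixOf p.ε_isEnd.onSections))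
  φ := D.1.imAction P.idem
  T := D.1.compress P.A (D.1.diagOp P.n D.1.T) -
    D.1.compress P.A (D.1.diagOp P.n D.1.ε * D.1.matOp (P.matrixOf p.α_isEnd.onSections))

/-- A graded Hilbert space with action and operator `T` represents the class of a Kasparov module
`(K, ψ, S)` if, for some inner product defining the same topology, it is that module up to a compact
perturbation of the operator: there is a bounded invertible linear map `U` onto `K`, of degree `0`
and compatible with the actions, such that `U T - S U` is compact. -/
def Represents {X : Type v} [TopologicalSpace X] (D : KData.{u} X) (c : KHomology.{u} X) : Prop :=
  ∃ (K : KModule.{u} X) (U : D.H ≃L[ℂ] K.1.H), KHomology.mk K = c ∧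
    (∀ x, U (D.ε x) = K.1.ε (U x)) ∧ (∀ f x, U (D.φ f x) = K.1.φ f (U x)) ∧
    IsCompactOperator fun x => U (D.T x) - K.1.T (U x)

end FakeCap

end

/-!
# The fake cap product

A cocycle `(E, α)` is turned into an operation on Kasparov modules by realizing the sections of `E`
as the range of an idempotent matrix `A` over the continuous functions on `Y/G`.

*Existence of Hermitian presentations.* Because the isotropy groups act trivially on the fibres,
averaging local sections over `G` gives invariant sections with arbitrary values at a given point
(`HermBundle.exists_section_apply_eq`). By compactness finitely many of them, which may be taken
homogeneous, span every fibre. Multiplication by the power `-1/2` of their frame operator makes them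
a Parseval frame (`HermBundle.exists_parsevalFrame`), and the Gram matrix of a homogeneous Parseval
frame is a Hermitian presentation (`HermBundle.exists_isHermitian`).

*The product is a Kasparov module.* On `im A ⊆ H^n` the operator `ε ⊗ C(α)` is compatible with the
action, and it anticommutes with `T ⊗' 1` up to a compact operator. So the square of
`s T ⊗' 1 - r ε ⊗ C(α)` is `s² (T ⊗' 1)² + r² (1 ⊗ C(α))²` up to a compact operator, and it is
bounded below modulo compact operators as soon as one of its two terms is
(`isFredholm_smul_sub_smul`). Scaling `r` to `0` shows that the class is that of `T ⊗' 1` alone, which does not involve `α`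
(`mk_capData`); scaling `s` to `0` shows that it vanishes if `α` is invertible everywhere
(`mk_capData_eq_zero`).

*Invariance.* Kasparov modules that become isomorphic, up to a compact perturbation of the operator,
by a bounded invertible map which need not be unitary have the same class: pass to the unitary part
of the polar decomposition and use the straight path of operators (`KHomology.mk_eq_of_equiv`). A
matrix of functions commutes with `T` up to compact operators, so isomorphisms of section modules,
in particular changes of presentation, preserve the class (`mk_capBase_eq_of_matrix`). The same
fact handles homotopies of bundles: a Parseval frame over the cylinder gives a norm-continuous path
of idempotents, and idempotents that are close to each other have isomorphic ranges
(`mk_capBase_restrict_eq`).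
-/

noncomputable section

namespace FakeCap

/-! ### Compact and Fredholm operators on Hilbert spaces -/

section HilbertOperators

open Filter Topology

variable {H K L : Type*} [NormedAddCommGroup H] [InnerProductSpace ℂ H] [CompleteSpace H]
  [NormedAddCommGroup K] [InnerProductSpace ℂ K] [CompleteSpace K]
  [NormedAddCommGroup L] [InnerProductSpace ℂ L] [CompleteSpace L]

theorem isCompactOperator_of_hasFiniteRange {S : H →L[ℂ] K}
    (h : S.toLinearMap.HasFiniteRange) : IsCompactOperator ⇑S := by
  have : FiniteDimensional ℂ (LinearMap.range S.toLinearMap) := .of_fg h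
  have hc : IsCompactOperator ⇑(S.codRestrict (LinearMap.range S.toLinearMap)
      fun x => LinearMap.mem_range_self _ x) := by
    have : ProperSpace (LinearMap.range S.toLinearMap) := FiniteDimensional.proper ℂ _
    exact isCompactOperator_of_locallyCompactSpace_dom _
  exact hc.clm_comp (LinearMap.range S.toLinearMap).subtypeL

/-- A compact operator into a Hilbert space is a norm limit of operators of finite rank, obtained by
projecting to the span of a finite net in the image of the unit ball. -/
theorem exists_finiteRange_approx {S : H →L[ℂ] K} (hS : IsCompactOperator ⇑S) {δ : ℝ}
    (hδ : 0 < δ) : ∃ P : K →L[ℂ] K, IsSelfAdjoint P ∧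
      P.toLinearMap.HasFiniteRange ∧ ‖S - P ∘L S‖ ≤ δ := by
  have htb : TotallyBounded (S '' Metric.closedBall 0 1) :=
    (hS.isCompact_closure_image_closedBall (f := S.toLinearMap) 1).totallyBounded.subset
      subset_closure
  obtain ⟨t, htf, ht⟩ := Metric.totallyBounded_iff.mp htb δ hδ
  have : FiniteDimensional ℂ (Submodule.span ℂ t) := FiniteDimensional.span_of_finite ℂ htf
  refine ⟨(Submodule.span ℂ t).starProjection, isSelfAdjoint_starProjection _, ?_, ?_⟩
  · have : LinearMap.range (Submodule.span ℂ t).starProjection.toLinearMap =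
        Submodule.span ℂ t := Submodule.range_starProjection _
    rw [LinearMap.HasFiniteRange, this]
    exact Submodule.FG.of_finite
  · refine ContinuousLinearMap.opNorm_le_of_unit_norm hδ.le fun x hx => ?_
    obtain ⟨y, hy, hxy⟩ := Set.mem_iUnion₂.mp (ht ⟨x, by simp [hx], rfl⟩)
    have h := Submodule.starProjection_minimal (U := Submodule.span ℂ t) (S x)
    have hb : BddBelow (Set.range fun w : Submodule.span ℂ t => ‖S x - w‖) :=
      ⟨0, by rintro _ ⟨w, rfl⟩; exact norm_nonneg _⟩
    change ‖S x - (Submodule.span ℂ t).starProjection (S x)‖ ≤ δ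
    rw [h]
    refine (ciInf_le hb ⟨y, Submodule.subset_span hy⟩).trans ?_
    rw [Metric.mem_ball, dist_eq_norm] at hxy
    exact hxy.le

theorem isCompactOperator_adjoint {S : H →L[ℂ] K} (hS : IsCompactOperator ⇑S) :
    IsCompactOperator ⇑S.adjoint := by
  have h : ∀ n : ℕ, ∃ F : K →L[ℂ] H, IsCompactOperator ⇑F ∧ ‖F - S.adjoint‖ ≤ 1 / (n + 1) := by
    intro n
    obtain ⟨P, hP, hPf, hn⟩ := exists_finiteRange_approx hS (δ := 1 / (n + 1)) (by positivity)
    refine ⟨S.adjoint ∘L P, (isCompactOperator_of_hasFiniteRange hPf).clm_comp S.adjoint, ?_⟩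
    have : S.adjoint ∘L P - S.adjoint = -(S - P ∘L S).adjoint := by
      rw [map_sub, ContinuousLinearMap.adjoint_comp, hP.adjoint_eq, neg_sub]
    rw [this, norm_neg, LinearIsometryEquiv.norm_map]
    exact hn
  choose F hF hFn using h
  refine isCompactOperator_of_tendsto (l := atTop) (F := F) ?_ (Eventually.of_forall hF)
  rw [tendsto_iff_norm_sub_tendsto_zero]
  exact squeeze_zero (fun _ => norm_nonneg _) hFn tendsto_one_div_add_atTop_nhds_zero_nat

/-- `R * S - 1` compact gives a left inverse of `S` modulo operators of finite rank. -/
theorem exists_isLeftQuasiInverse {S R : H →L[ℂ] H} (h : IsCompactOperator ⇑(R * S - 1)) :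
    ∃ V : H →L[ℂ] H, (V * S - 1).toLinearMap.HasNoetherianRange := by
  obtain ⟨P, hP, hPf, hn⟩ := exists_finiteRange_approx h (δ := 1 / 2) (by norm_num)
  set C := R * S - 1 - P ∘L (R * S - 1)
  obtain ⟨Z, hZ⟩ : IsUnit (1 + C) := by
    have := isUnit_one_sub_of_norm_lt_one (x := -C) (by rw [norm_neg]; linarith)
    rwa [sub_neg_eq_add] at this
  refine ⟨↑Z⁻¹ * R, ?_⟩
  have e : ↑Z⁻¹ * R * S - 1 = ((Z⁻¹ : (H →L[ℂ] H)ˣ) : H →L[ℂ] H) * (P * (R * S - 1)) := by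
    have h1 : R * S = Z + P * (R * S - 1) := by
      rw [hZ]; change _ = 1 + (R * S - 1 - P * (R * S - 1)) + P * (R * S - 1); abel
    rw [mul_assoc, sub_eq_iff_eq_add]
    conv_lhs => rw [h1]
    rw [mul_add, Units.inv_mul, add_comm]
  rw [e]
  exact ((hPf.hasNoetherianRange).comp_right _).comp_left _

/-- `S * R - 1` compact gives a right inverse of `S` modulo operators of finite rank. -/
theorem exists_isRightQuasiInverse {S R : H →L[ℂ] H} (h : IsCompactOperator ⇑(S * R - 1)) :
    ∃ V : H →L[ℂ] H, (S * V - 1).toLinearMap.HasNoetherianRange := by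
  obtain ⟨P, hP, hPf, hn⟩ := exists_finiteRange_approx h (δ := 1 / 2) (by norm_num)
  set C := S * R - 1 - P ∘L (S * R - 1)
  obtain ⟨Z, hZ⟩ : IsUnit (1 + C) := by
    have := isUnit_one_sub_of_norm_lt_one (x := -C) (by rw [norm_neg]; linarith)
    rwa [sub_neg_eq_add] at this
  refine ⟨R * ↑Z⁻¹, ?_⟩
  have e : S * (R * ↑Z⁻¹) - 1 = P * (S * R - 1) * ((Z⁻¹ : (H →L[ℂ] H)ˣ) : H →L[ℂ] H) := by
    have h1 : S * R = Z + P * (S * R - 1) := by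
      rw [hZ]; change _ = 1 + (S * R - 1 - P * (S * R - 1)) + P * (S * R - 1); abel
    rw [← mul_assoc, sub_eq_iff_eq_add]
    conv_lhs => rw [h1]
    rw [add_mul, Units.mul_inv, add_comm]
  rw [e]
  exact ((hPf.hasNoetherianRange).comp_right _).comp_right _

/-- Atkinson's criterion. -/
theorem isFredholm_of_inverse_mod_compact {S R R' : H →L[ℂ] H}
    (h : IsCompactOperator ⇑(R * S - 1)) (h' : IsCompactOperator ⇑(S * R' - 1)) :
    S.IsFredholm := by
  obtain ⟨V, hV⟩ := exists_isLeftQuasiInverse h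
  obtain ⟨V', hV'⟩ := exists_isRightQuasiInverse h'
  refine ContinuousLinearMap.isFredholm_iff_exists_isQuasiInverse.mpr ⟨V, ?_, ?_⟩
  · exact LinearMap.FiniteRangeSetoid.equiv_iff_hasNoetherianRange.mpr hV
  · -- `S V - 1 = (S V' - 1) - S V (S V' - 1) + S (V S - 1) V'`
    refine LinearMap.FiniteRangeSetoid.equiv_iff_hasNoetherianRange.mpr ?_
    have e : S * V - 1 = (S * V' - 1) - (S * V) * (S * V' - 1) + S * ((V * S - 1) * V') := by
      noncomm_ring
    change (S * V - 1).toLinearMap.HasNoetherianRange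
    rw [e]
    exact (hV'.sub (hV'.comp_left (S * V).toLinearMap)).add
      ((hV.comp_right V'.toLinearMap).comp_left S.toLinearMap)

theorem isFredholm_inverse_mod_compact {S : H →L[ℂ] H} (h : S.IsFredholm) :
    ∃ R : H →L[ℂ] H, IsCompactOperator ⇑(R * S - 1) ∧ IsCompactOperator ⇑(S * R - 1) := by
  obtain ⟨R, hl, hr⟩ := ContinuousLinearMap.isFredholm_iff_exists_isQuasiInverse.mp h
  exact ⟨R, isCompactOperator_of_hasFiniteRange
      (LinearMap.FiniteRangeSetoid.equiv_iff_hasFiniteRange.mp hl),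
    isCompactOperator_of_hasFiniteRange
      (LinearMap.FiniteRangeSetoid.equiv_iff_hasFiniteRange.mp hr)⟩

theorem isFredholm_of_compact_sub {S S' : H →L[ℂ] H} (h : S.IsFredholm)
    (hc : IsCompactOperator ⇑(S' - S)) : S'.IsFredholm := by
  obtain ⟨R, hl, hr⟩ := isFredholm_inverse_mod_compact h
  refine isFredholm_of_inverse_mod_compact (R := R) (R' := R) ?_ ?_
  · have e : R * S' - 1 = (R * S - 1) + R * (S' - S) := by noncomm_ring
    rw [e]
    exact hl.add (hc.clm_comp R)
  · have e : S' * R - 1 = (S * R - 1) + (S' - S) * R := by noncomm_ring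
    rw [e]
    exact hr.add (hc.comp_clm R)

/-- A self-adjoint operator is Fredholm if its square is bounded below up to a compact operator. -/
theorem isFredholm_of_one_le {S C : H →L[ℂ] H} {k : ℝ}
    (hC : IsCompactOperator ⇑C) (h : 1 ≤ k • (S * S) + C) : S.IsFredholm := by
  obtain ⟨Z, hZ⟩ : IsUnit (k • (S * S) + C) := CStarAlgebra.isUnit_of_le 1 h
  refine isFredholm_of_inverse_mod_compact (R := ↑Z⁻¹ * (k • S)) (R' := (k • S) * ↑Z⁻¹) ?_ ?_
  · have e : ↑Z⁻¹ * (k • S) * S - 1 = -(((Z⁻¹ : (H →L[ℂ] H)ˣ) : H →L[ℂ] H) * C) := by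
      have : k • S * S = Z - C := by rw [hZ]; simp
      rw [mul_assoc, this, mul_sub, Units.inv_mul]; abel
    rw [e]
    exact (hC.clm_comp (Z⁻¹ : (H →L[ℂ] H)ˣ).val).neg
  · have e : S * ((k • S) * ↑Z⁻¹) - 1 = -(C * ((Z⁻¹ : (H →L[ℂ] H)ˣ) : H →L[ℂ] H)) := by
      have : S * (k • S) = Z - C := by rw [hZ]; simp
      rw [← mul_assoc, this, sub_mul, Units.mul_inv]; abel
    rw [e]
    exact (hC.comp_clm (Z⁻¹ : (H →L[ℂ] H)ˣ).val).neg

/-- A bounded operator `S` with a left inverse `R` modulo the compact operator `R * S - 1` is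
bounded below up to a compact operator. -/
theorem exists_one_le_of_inverse_mod_compact {S R : H →L[ℂ] H}
    (h : IsCompactOperator ⇑(R * S - 1)) :
    ∃ (k : ℝ) (C : H →L[ℂ] H), 0 ≤ k ∧ IsCompactOperator ⇑C ∧ 1 ≤ k • (star S * S) + C := by
  obtain ⟨F, hF⟩ : ∃ F, F = R * S - 1 := ⟨_, rfl⟩
  rw [← hF] at h
  have hc : IsCompactOperator ⇑(star F * F) := h.clm_comp (star F)
  have hc2 : IsCompactOperator ⇑((2 : ℝ) • (star F * F)) := hc.smul (2 : ℝ)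
  refine ⟨2 * ‖R‖ ^ 2, (2 : ℝ) • (star F * F), by positivity, hc2, ?_⟩
  · have h1 : (1 : H →L[ℂ] H) = star (R * S - F) * (R * S - F) := by simp [hF]
    have h2 : star (R * S - F) * (R * S - F) ≤
        (2 : ℝ) • (star (R * S) * (R * S)) + (2 : ℝ) • (star F * F) := by
      rw [← sub_nonneg]
      have e : (2 : ℝ) • (star (R * S) * (R * S)) + (2 : ℝ) • (star F * F) -
          star (R * S - F) * (R * S - F) = star (R * S + F) * (R * S + F) := by
        rw [two_smul, two_smul, star_sub, star_add]
        noncomm_ring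
      rw [e]
      exact star_mul_self_nonneg _
    have h3 : star (R * S) * (R * S) ≤ ‖R‖ ^ 2 • (star S * S) := by
      have h4 : star R * R ≤ algebraMap ℝ (H →L[ℂ] H) (‖R‖ ^ 2) :=
        CStarAlgebra.star_mul_le_algebraMap_norm_sq
      have h5 := star_left_conjugate_le_conjugate h4 S
      rw [Algebra.algebraMap_eq_smul_one] at h5
      simpa [mul_assoc] using h5
    rw [h1]
    refine h2.trans ?_
    rw [mul_smul]
    gcongr

/-- The operators that commute with a self-adjoint operator `S` up to a compact operator. -/
def compactCommutant (S : H →L[ℂ] H) (hS : IsSelfAdjoint S) : StarSubalgebra ℂ (H →L[ℂ] H) where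
  carrier := {P | IsCompactOperator ⇑(S * P - P * S)}
  mul_mem' {P Q} hP hQ := by
    have e : S * (P * Q) - P * Q * S = (S * P - P * S) * Q + P * (S * Q - Q * S) := by
      noncomm_ring
    rw [Set.mem_ofPred_eq, e]
    exact (hP.comp_clm Q).add (hQ.clm_comp P)
  add_mem' {P Q} hP hQ := by
    have e : S * (P + Q) - (P + Q) * S = (S * P - P * S) + (S * Q - Q * S) := by
      noncomm_ring
    rw [Set.mem_ofPred_eq, e]
    exact hP.add hQ
  algebraMap_mem' c := by
    have e : S * algebraMap ℂ (H →L[ℂ] H) c - algebraMap ℂ (H →L[ℂ] H) c * S = 0 := by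
      rw [(Algebra.commutes c S).symm, sub_self]
    rw [Set.mem_ofPred_eq, e]
    exact isCompactOperator_zero
  star_mem' {P} hP := by
    have e : S * star P - star P * S = -star (S * P - P * S) := by
      rw [star_sub, star_mul, star_mul, hS.star_eq, neg_sub]
    rw [Set.mem_ofPred_eq, e]
    exact (isCompactOperator_adjoint hP).neg

theorem mem_compactCommutant {S : H →L[ℂ] H} {hS : IsSelfAdjoint S} {P : H →L[ℂ] H} :
    P ∈ compactCommutant S hS ↔ IsCompactOperator ⇑(S * P - P * S) := Iff.rfl

theorem isClosed_compactCommutant (S : H →L[ℂ] H) (hS : IsSelfAdjoint S) :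
    IsClosed (compactCommutant S hS : Set (H →L[ℂ] H)) := by
  have : Continuous fun P : H →L[ℂ] H => S * P - P * S := by fun_prop
  exact (isClosed_setOfPred_isCompactOperator (𝕜₁ := ℂ) (σ₁₂ := RingHom.id ℂ)).preimage this

/-- The operator `P ^ (-1/2)`. -/
def invSqrt (P : H →L[ℂ] H) : H →L[ℂ] H := cfc (fun x : ℝ => (√x)⁻¹) P

theorem isSelfAdjoint_invSqrt (P : H →L[ℂ] H) : IsSelfAdjoint (invSqrt P) :=
  cfc_predicate _ P

theorem continuousOn_inv_sqrt : ContinuousOn (fun x : ℝ => (√x)⁻¹) (Set.Ioi 0) :=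
  Real.continuous_sqrt.continuousOn.inv₀ fun _ hx => (Real.sqrt_pos.mpr hx).ne'

theorem invSqrt_mul_mul_invSqrt {P : H →L[ℂ] H} (hP : IsStrictlyPositive P) :
    invSqrt P * P * invSqrt P = 1 := by
  have hsp : ∀ x ∈ spectrum ℝ P, 0 < x := fun x hx => hP.spectrum_pos hx
  have hc : ContinuousOn (fun x : ℝ => (√x)⁻¹) (spectrum ℝ P) :=
    continuousOn_inv_sqrt.mono hsp
  have hsa : IsSelfAdjoint P := hP.isSelfAdjoint
  have hi : ContinuousOn (fun x : ℝ => x) (spectrum ℝ P) := continuousOn_id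
  have h1 : invSqrt P * P = cfc (fun x : ℝ => (√x)⁻¹ * x) P := by
    conv_lhs => rhs; rw [← cfc_id' ℝ P]
    exact (cfc_mul _ _ P hc hi).symm
  rw [h1, invSqrt, ← cfc_mul (fun x : ℝ => (√x)⁻¹ * x) _ P (hc.mul hi) hc]
  have : cfc (fun x : ℝ => (√x)⁻¹ * x * (√x)⁻¹) P = cfc (fun _ : ℝ => (1 : ℝ)) P := by
    refine cfc_congr fun x hx => ?_
    have hx0 := hsp x hx
    have : √x ≠ 0 := (Real.sqrt_pos.mpr hx0).ne'
    field_simp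
    exact (Real.sq_sqrt hx0.le).symm
  rw [this, cfc_const_one ℝ P]

theorem commute_invSqrt {P Q : H →L[ℂ] H} (h : Commute P Q) : Commute (invSqrt P) Q :=
  h.cfc_real _

theorem invSqrt_mem_compactCommutant {S P : H →L[ℂ] H} (hS : IsSelfAdjoint S)
    (hP : P ∈ compactCommutant S hS) : invSqrt P ∈ compactCommutant S hS :=
  have := isClosed_compactCommutant S hS
  cfc_mem (𝕜' := ℂ) _ hP

theorem invSqrt_conj (V : H ≃ₗᵢ[ℂ] K) {P : H →L[ℂ] H} (hP : IsStrictlyPositive P) :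
    invSqrt (V.conjStarAlgEquiv P) = V.conjStarAlgEquiv (invSqrt P) := by
  have hc : ContinuousOn (fun x : ℝ => (√x)⁻¹) (spectrum ℝ P) :=
    continuousOn_inv_sqrt.mono fun x hx => hP.spectrum_pos hx
  have hcont : Continuous V.conjStarAlgEquiv := by
    change Continuous fun x : H →L[ℂ] H =>
      V.toContinuousLinearEquiv.toContinuousLinearMap ∘L x ∘L
        V.symm.toContinuousLinearEquiv.toContinuousLinearMap
    fun_prop
  exact (StarAlgHomClass.map_cfc (R := ℝ) (S := ℂ) V.conjStarAlgEquiv _ P hc hcont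
    hP.isSelfAdjoint (hP.isSelfAdjoint.map _)).symm

theorem continuousOn_invSqrt {Z : Type*} [TopologicalSpace Z] {a : Z → H →L[ℂ] H} {t : Set Z}
    (ha : ContinuousOn a t) (hp : ∀ x ∈ t, IsStrictlyPositive (a x)) :
    ContinuousOn (fun x => invSqrt (a x)) t := by
  refine ContinuousOn.cfc_of_mem_nhdsSet (s := Set.Ioi 0) _ ?_ ha
    (fun x hx => (hp x hx).isSelfAdjoint) continuousOn_inv_sqrt
  refine isOpen_Ioi.mem_nhdsSet.mpr ?_
  simp only [Set.iUnion_subset_iff]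
  exact fun x hx y hy => (hp x hx).spectrum_pos hy

end HilbertOperators

/-! ### Invariance of K-homology classes -/

section ClassInvariance

variable {X : Type v} [TopologicalSpace X]

theorem KHomology.mk_eq_of_homotopy {D : KData.{u} X} (S : unitInterval → (D.H →L[ℂ] D.H))
    (hS : Continuous S) (h : ∀ t, (D.withOp (S t)).IsKasparov) {S₀ S₁ : D.H →L[ℂ] D.H}
    (e₀ : S 0 = S₀) (e₁ : S 1 = S₁) (h₀ : (D.withOp S₀).IsKasparov)
    (h₁ : (D.withOp S₁).IsKasparov) :
    KHomology.mk ⟨D.withOp S₀, h₀⟩ = KHomology.mk ⟨D.withOp S₁, h₁⟩ := by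
  subst e₀ e₁
  exact KHomology.sound (.homotopy D S hS h)

theorem KHomology.mk_eq_zero_of_isDegenerate {D : KModule.{u} X} (h : D.IsDegenerate) :
    KHomology.mk D = 0 := by
  have := KHomology.sound (.degenerate 0 D h)
  rwa [KHomology.mk_add, KHomology.mk_zero, zero_add] at this

/-- The conditions on a graded Hilbert space with an action which do not involve an operator. -/
structure KData.IsGraded (D : KData.{u} X) : Prop where
  grading_sq : D.ε * D.ε = 1
  grading_selfAdjoint : IsSelfAdjoint D.ε
  map_star : ∀ f : C(X, ℂ), D.φ (star f) = star (D.φ f)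
  map_even : ∀ f : C(X, ℂ), D.ε * D.φ f = D.φ f * D.ε

theorem KData.IsKasparov.isGraded {D : KData.{u} X} (h : D.IsKasparov) : D.IsGraded :=
  ⟨h.grading_sq, h.grading_selfAdjoint, h.map_star, h.map_even⟩

theorem KData.IsGraded.withOp_isKasparov {D : KData.{u} X} (h : D.IsGraded) {S : D.H →L[ℂ] D.H}
    (hS : IsSelfAdjoint S) (hodd : D.ε * S = -(S * D.ε)) (hF : S.IsFredholm)
    (hc : ∀ f : C(X, ℂ), IsCompactOperator ⇑(S * D.φ f - D.φ f * S)) :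
    (D.withOp S).IsKasparov :=
  ⟨h.grading_sq, h.grading_selfAdjoint, h.map_star, h.map_even, hS, hodd, hF, hc⟩

theorem KData.IsKasparov.of_compact_sub {D : KData.{u} X} (h : D.IsKasparov) {S : D.H →L[ℂ] D.H}
    (hS : IsSelfAdjoint S) (hodd : D.ε * S = -(S * D.ε)) (hc : IsCompactOperator ⇑(S - D.T)) :
    (D.withOp S).IsKasparov := by
  refine h.isGraded.withOp_isKasparov hS hodd (isFredholm_of_compact_sub h.fredholm hc) fun f => ?_
  have e : S * D.φ f - D.φ f * S =
      (D.T * D.φ f - D.φ f * D.T) + ((S - D.T) * D.φ f - D.φ f * (S - D.T)) := by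
    noncomm_ring
  rw [e]
  exact (h.compact_commutator f).add ((hc.comp_clm (D.φ f)).sub (hc.clm_comp (D.φ f)))

/-- A compact perturbation of the operator does not change the class: the straight path from one
operator to the other is a homotopy. -/
theorem KHomology.mk_eq_of_compact_sub {D : KData.{u} X} (h : D.IsKasparov) {S : D.H →L[ℂ] D.H}
    (hS : (D.withOp S).IsKasparov) (hc : IsCompactOperator ⇑(S - D.T)) :
    KHomology.mk ⟨D, h⟩ = KHomology.mk ⟨D.withOp S, hS⟩ := by
  refine KHomology.mk_eq_of_homotopy (D := D) (fun t => D.T + (t : ℝ) • (S - D.T))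
    (by fun_prop) (fun t => ?_) (S₀ := D.T) (by simp) (by simp) h hS
  refine h.of_compact_sub ?_ ?_ ?_
  · exact h.selfAdjoint.add ((IsSelfAdjoint.all _).smul (hS.selfAdjoint.sub h.selfAdjoint))
  · have := hS.odd
    change D.ε * S = -(S * D.ε) at this
    rw [mul_add, add_mul, mul_smul_comm, smul_mul_assoc, mul_sub, sub_mul, this, h.odd]
    module
  · rw [add_sub_cancel_left]
    exact hc.smul (t : ℝ)

/-- Modules that become isomorphic through a bounded invertible map, up to a compact perturbation of
the operator, have the same class: the unitary part of the polar decomposition is a unitary with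
the same properties. -/
theorem KHomology.mk_eq_of_equiv {D D' : KModule.{u} X} (U : D.1.H ≃L[ℂ] D'.1.H)
    (hε : ∀ x, U (D.1.ε x) = D'.1.ε (U x)) (hφ : ∀ f x, U (D.1.φ f x) = D'.1.φ f (U x))
    (hT : IsCompactOperator fun x => U (D.1.T x) - D'.1.T (U x)) :
    KHomology.mk D = KHomology.mk D' := by
  obtain ⟨D, h⟩ := D
  obtain ⟨D', h'⟩ := D'
  dsimp only at U hε hφ hT
  let W : D.H →L[ℂ] D'.H := U.toContinuousLinearMap
  let P : D.H →L[ℂ] D.H := W.adjoint ∘L W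
  have hPpos : 0 ≤ P :=
    (ContinuousLinearMap.nonneg_iff_isPositive _).mpr
      (ContinuousLinearMap.isPositive_adjoint_comp_self W)
  have hPunit : IsUnit P := by
    refine ⟨⟨P, U.symm.toContinuousLinearMap ∘L U.symm.toContinuousLinearMap.adjoint, ?_, ?_⟩, rfl⟩
    · have e : W.adjoint ∘L U.symm.toContinuousLinearMap.adjoint = 1 := by
        rw [← ContinuousLinearMap.adjoint_comp]
        have : U.symm.toContinuousLinearMap ∘L W = ContinuousLinearMap.id ℂ D.H := by
          ext x; simp [W]
        rw [this, ContinuousLinearMap.adjoint_id]; rfl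
      ext x
      change W.adjoint (U (U.symm (U.symm.toContinuousLinearMap.adjoint x))) = x
      rw [ContinuousLinearEquiv.apply_symm_apply]
      exact congrArg (fun A : D.H →L[ℂ] D.H => A x) e
    · have e : U.symm.toContinuousLinearMap.adjoint ∘L W.adjoint = 1 := by
        rw [← ContinuousLinearMap.adjoint_comp]
        have : W ∘L U.symm.toContinuousLinearMap = ContinuousLinearMap.id ℂ D'.H := by
          ext x; simp [W]
        rw [this, ContinuousLinearMap.adjoint_id]; rfl
      ext x
      change U.symm (U.symm.toContinuousLinearMap.adjoint (W.adjoint (U x))) = x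
      have e' := congrArg (fun A : D'.H →L[ℂ] D'.H => A (U x)) e
      change U.symm.toContinuousLinearMap.adjoint (W.adjoint (U x)) = U x at e'
      rw [e', ContinuousLinearEquiv.symm_apply_apply]
  have hP : IsStrictlyPositive P := hPunit.isStrictlyPositive hPpos
  -- `P` commutes with every operator that is carried, together with its adjoint, by `U`
  have comm : ∀ (Q : D.H →L[ℂ] D.H) (Q' : D'.H →L[ℂ] D'.H), W ∘L Q = Q' ∘L W →
      W ∘L star Q = star Q' ∘L W → Commute P Q := by
    intro Q Q' h1 h2
    have h3 : Q ∘L W.adjoint = W.adjoint ∘L Q' := by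
      have := congrArg ContinuousLinearMap.adjoint h2
      rw [ContinuousLinearMap.adjoint_comp, ContinuousLinearMap.adjoint_comp,
        ContinuousLinearMap.star_eq_adjoint, ContinuousLinearMap.star_eq_adjoint,
        ContinuousLinearMap.adjoint_adjoint, ContinuousLinearMap.adjoint_adjoint] at this
      exact this
    change (W.adjoint ∘L W) ∘L Q = Q ∘L (W.adjoint ∘L W)
    rw [ContinuousLinearMap.comp_assoc, h1, ← ContinuousLinearMap.comp_assoc, ← h3,
      ContinuousLinearMap.comp_assoc]
  have hWε : W ∘L D.ε = D'.ε ∘L W := by ext x; exact hε x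
  have hWφ : ∀ f, W ∘L D.φ f = D'.φ f ∘L W := fun f => by ext x; exact hφ f x
  have cε : Commute P D.ε := comm _ D'.ε hWε (by
    rw [h.grading_selfAdjoint.star_eq, h'.grading_selfAdjoint.star_eq, hWε])
  have cφ : ∀ f, Commute P (D.φ f) := fun f => comm _ (D'.φ f) (hWφ f) (by
    rw [← h.map_star, ← h'.map_star, hWφ])
  have hWT : IsCompactOperator ⇑(W ∘L D.T - D'.T ∘L W) := hT
  have cT : P ∈ compactCommutant D.T h.selfAdjoint := by
    have h1 : IsCompactOperator ⇑(D.T ∘L W.adjoint - W.adjoint ∘L D'.T) := by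
      have := isCompactOperator_adjoint hWT
      rwa [map_sub, ContinuousLinearMap.adjoint_comp, ContinuousLinearMap.adjoint_comp,
        h.selfAdjoint.adjoint_eq, h'.selfAdjoint.adjoint_eq] at this
    have e : D.T * P - P * D.T = (D.T ∘L W.adjoint - W.adjoint ∘L D'.T) ∘L W -
        W.adjoint ∘L (W ∘L D.T - D'.T ∘L W) := by
      ext x; simp [P]
    rw [mem_compactCommutant, e]
    exact (h1.comp_clm W).sub (hWT.clm_comp W.adjoint)
  set R := invSqrt P with hR
  have hRP : R * P * R = 1 := invSqrt_mul_mul_invSqrt hP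
  have hRcomm : Commute R P := commute_invSqrt (Commute.refl P)
  have hRsa : IsSelfAdjoint R := isSelfAdjoint_invSqrt P
  -- the unitary part `V` of the polar decomposition of `U`
  let V₀ : D.H →L[ℂ] D'.H := W ∘L R
  have hV₀ : ∀ x, ‖V₀ x‖ = ‖x‖ := by
    intro x
    have : inner ℂ (V₀ x) (V₀ x) = inner ℂ x x := by
      have e : V₀.adjoint ∘L V₀ = 1 := by
        rw [ContinuousLinearMap.adjoint_comp, hRsa.adjoint_eq]
        exact hRP
      rw [← ContinuousLinearMap.adjoint_inner_left]
      exact congrArg (fun A : D.H →L[ℂ] D.H => inner ℂ (A x) x) e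
    have h2 : ‖V₀ x‖ ^ 2 = ‖x‖ ^ 2 := by
      rw [← inner_self_eq_norm_sq (𝕜 := ℂ), ← inner_self_eq_norm_sq (𝕜 := ℂ), this]
    exact (sq_eq_sq₀ (norm_nonneg _) (norm_nonneg _)).mp h2
  have hRsurj : Function.Surjective R := fun x => ⟨P (R x), by
    have : (R * P * R) x = x := by rw [hRP]; rfl
    exact this⟩
  let V : D.H ≃ₗᵢ[ℂ] D'.H := LinearIsometryEquiv.ofSurjective ⟨V₀.toLinearMap, hV₀⟩ (by
    intro y
    obtain ⟨x, hx⟩ := hRsurj (U.symm y)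
    refine ⟨x, ?_⟩
    change U (R x) = y
    rw [hx, ContinuousLinearEquiv.apply_symm_apply])
  have hV : ∀ x, V x = U (R x) := fun _ => rfl
  have hVε : ∀ x, V (D.ε x) = D'.ε (V x) := fun x => by
    rw [hV, hV, ← hε]
    exact congrArg (fun A : D.H →L[ℂ] D.H => U (A x)) (commute_invSqrt cε).eq
  have hVφ : ∀ f x, V (D.φ f x) = D'.φ f (V x) := fun f x => by
    rw [hV, hV, ← hφ]
    exact congrArg (fun A : D.H →L[ℂ] D.H => U (A x)) (commute_invSqrt (cφ f)).eq
  let S : D'.H →L[ℂ] D'.H := V.conjStarAlgEquiv D.T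
  have hS : ∀ x, S (V x) = V (D.T x) := fun x => by
    change V (D.T (V.symm (V x))) = _
    rw [LinearIsometryEquiv.symm_apply_apply]
  have hSc : IsCompactOperator ⇑(S - D'.T) := by
    have h1 : IsCompactOperator ⇑((W ∘L D.T - D'.T ∘L W) ∘L R - W ∘L (D.T * R - R * D.T)) :=
      (hWT.comp_clm R).sub
        ((mem_compactCommutant.mp (invSqrt_mem_compactCommutant h.selfAdjoint cT)).clm_comp W)
    have h2 := h1.comp_clm V.symm.toContinuousLinearEquiv.toContinuousLinearMap
    have e : ⇑(S - D'.T) = ⇑((W ∘L D.T - D'.T ∘L W) ∘L R - W ∘L (D.T * R - R * D.T)) ∘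
        ⇑V.symm.toContinuousLinearEquiv.toContinuousLinearMap := by
      ext y
      obtain ⟨x, rfl⟩ := V.surjective y
      change S (V x) - D'.T (V x) = (W (D.T (R (V.symm (V x)))) - D'.T (W (R (V.symm (V x))))) -
        W (D.T (R (V.symm (V x))) - R (D.T (V.symm (V x))))
      rw [hS, LinearIsometryEquiv.symm_apply_apply, map_sub, hV, hV]
      change U (R (D.T x)) - D'.T (U (R x)) =
        U (D.T (R x)) - D'.T (U (R x)) - (U (D.T (R x)) - U (R (D.T x)))
      abel
    rw [e]
    exact h2
  have hSK : (D'.withOp S).IsKasparov := by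
    refine h'.of_compact_sub ?_ ?_ hSc
    · exact h.selfAdjoint.map V.conjStarAlgEquiv
    · ext y
      obtain ⟨x, rfl⟩ := V.surjective y
      change D'.ε (S (V x)) = -S (D'.ε (V x))
      rw [hS, ← hVε, ← hVε, hS, ← map_neg]
      exact congrArg (fun A : D.H →L[ℂ] D.H => V (A x)) h.odd
  have e1 : KHomology.mk ⟨D, h⟩ = KHomology.mk ⟨D'.withOp S, hSK⟩ :=
    KHomology.sound (.unitary _ _ ⟨V, hVε, hVφ, fun x => (hS x).symm⟩)
  rw [e1]
  exact (KHomology.mk_eq_of_compact_sub h' hSK hSc).symm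

end ClassInvariance

/-! ### Matrices of functions acting on powers of a Hilbert space -/

namespace KData

variable {X : Type v} [TopologicalSpace X] (D : KData.{u} X)

/-- The operator `H^n → H^m` of a rectangular matrix of continuous functions, entrywise
through `φ`; for square matrices it is `matOp`. -/
def rectOp {m n : ℕ} (M : Matrix (Fin m) (Fin n) C(X, ℂ)) : D.Pow n →L[ℂ] D.Pow m :=
  (PiLp.continuousLinearEquiv 2 ℂ (fun _ : Fin m => D.H)).symm.toContinuousLinearMap ∘L
    (ContinuousLinearMap.pi fun i => ∑ j, D.φ (M i j) ∘L ContinuousLinearMap.proj j) ∘L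
    (PiLp.continuousLinearEquiv 2 ℂ (fun _ : Fin n => D.H)).toContinuousLinearMap

theorem matOp_eq_rectOp {n : ℕ} (M : Matrix (Fin n) (Fin n) C(X, ℂ)) :
    D.matOp M = D.rectOp M := rfl

variable {l m n : ℕ}

theorem rectOp_apply (M : Matrix (Fin m) (Fin n) C(X, ℂ)) (v : D.Pow n) (i : Fin m) :
    D.rectOp M v i = ∑ j, D.φ (M i j) (v j) := by
  simp [rectOp]

theorem rectOp_mul (M : Matrix (Fin l) (Fin m) C(X, ℂ)) (N : Matrix (Fin m) (Fin n) C(X, ℂ))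
    (v : D.Pow n) : D.rectOp (M * N) v = D.rectOp M (D.rectOp N v) := by
  ext i
  simp only [rectOp_apply, Matrix.mul_apply, map_sum, map_mul, sum_apply, mul_apply_eq_comp]
  rw [Finset.sum_comm]

theorem rectOp_add (M N : Matrix (Fin m) (Fin n) C(X, ℂ)) :
    D.rectOp (M + N) = D.rectOp M + D.rectOp N := by
  ext v i
  simp only [rectOp_apply, Matrix.add_apply, map_add, add_apply, PiLp.add_apply,
    Finset.sum_add_distrib]

/-- An operator commutes with the action. -/
def CommutesAction (S : D.H →L[ℂ] D.H) : Prop := ∀ f, S * D.φ f = D.φ f * S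

/-- An operator commutes with the action up to compact operators. -/
def CommutesActionModCompact (S : D.H →L[ℂ] D.H) : Prop :=
  ∀ f, IsCompactOperator ⇑(S * D.φ f - D.φ f * S)

theorem commutesAction_φ (f : C(X, ℂ)) : D.CommutesAction (D.φ f) := fun g => by
  rw [← map_mul, ← map_mul, mul_comm]

theorem rectOp_diagOp_of_commutes {S : D.H →L[ℂ] D.H} (hS : D.CommutesAction S)
    (M : Matrix (Fin m) (Fin n) C(X, ℂ)) (v : D.Pow n) :
    D.rectOp M (D.diagOp n S v) = D.diagOp m S (D.rectOp M v) := by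
  ext i
  simp only [rectOp_apply, diagOp_apply, map_sum]
  refine Finset.sum_congr rfl fun j _ => ?_
  exact (congrArg (fun A : D.H →L[ℂ] D.H => A (v j)) (hS (M i j))).symm

theorem isCompactOperator_sum {ι E F : Type*} [NormedAddCommGroup E] [NormedSpace ℂ E]
    [NormedAddCommGroup F] [NormedSpace ℂ F] (s : Finset ι) {f : ι → E →L[ℂ] F}
    (h : ∀ i ∈ s, IsCompactOperator ⇑(f i)) : IsCompactOperator ⇑(∑ i ∈ s, f i) := by
  exact (Submodule.sum_mem (compactOperator (RingHom.id ℂ) E F) h :)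

/-- An operator into `H^n` with compact components is compact. -/
theorem isCompactOperator_pow {E : Type*} [NormedAddCommGroup E] [NormedSpace ℂ E]
    {F : E →L[ℂ] D.Pow n} (h : ∀ i, IsCompactOperator fun x => F x i) :
    IsCompactOperator ⇑F := by
  let ι : Fin n → D.H →L[ℂ] D.Pow n := fun i =>
    (PiLp.continuousLinearEquiv 2 ℂ (fun _ : Fin n => D.H)).symm.toContinuousLinearMap ∘L
      ContinuousLinearMap.single ℂ (fun _ : Fin n => D.H) i
  let π : Fin n → D.Pow n →L[ℂ] D.H := fun i =>
    ContinuousLinearMap.proj i ∘L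
      (PiLp.continuousLinearEquiv 2 ℂ (fun _ : Fin n => D.H)).toContinuousLinearMap
  have e : F = ∑ i, ι i ∘L (π i ∘L F) := by
    ext x j
    simp only [sum_apply, WithLp.ofLp_sum, Finset.sum_apply]
    rw [Finset.sum_eq_single j]
    · simp [ι, π]
    · intro i _ hij
      simp [ι, π, hij.symm]
    · simp
  rw [e]
  refine isCompactOperator_sum _ fun i _ => ?_
  have hi : IsCompactOperator ⇑(π i ∘L F) := h i
  exact hi.clm_comp (ι i)

theorem isCompactOperator_diagOp {S : D.H →L[ℂ] D.H} (hS : IsCompactOperator ⇑S) :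
    IsCompactOperator ⇑(D.diagOp n S) := by
  refine D.isCompactOperator_pow fun i => ?_
  exact hS.comp_clm (ContinuousLinearMap.proj i ∘L
      (PiLp.continuousLinearEquiv 2 ℂ (fun _ : Fin n => D.H)).toContinuousLinearMap)

theorem isCompactOperator_rectOp_diagOp {S : D.H →L[ℂ] D.H} (hS : D.CommutesActionModCompact S)
    (M : Matrix (Fin m) (Fin n) C(X, ℂ)) :
    IsCompactOperator ⇑(D.diagOp m S ∘L D.rectOp M - D.rectOp M ∘L D.diagOp n S) := by
  refine D.isCompactOperator_pow fun i => ?_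
  have h : IsCompactOperator ⇑(∑ j : Fin n, (S * D.φ (M i j) - D.φ (M i j) * S) ∘L
      (ContinuousLinearMap.proj j ∘L
      (PiLp.continuousLinearEquiv 2 ℂ (fun _ : Fin n => D.H)).toContinuousLinearMap)) :=
    isCompactOperator_sum _ fun j _ => (hS (M i j)).comp_clm _
  refine (congrArg IsCompactOperator (funext fun v => ?_)).mp h
  simp [rectOp_apply, diagOp_apply]

theorem inner_rectOp (hφ : ∀ f : C(X, ℂ), D.φ (star f) = star (D.φ f))
    (M : Matrix (Fin m) (Fin n) C(X, ℂ)) (x : D.Pow n) (y : D.Pow m) :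
    inner ℂ (D.rectOp M x) y = inner ℂ x (D.rectOp M.conjTranspose y) := by
  simp only [PiLp.inner_apply, rectOp_apply, sum_inner, inner_sum, Matrix.conjTranspose_apply, hφ]
  rw [Finset.sum_comm]
  refine Finset.sum_congr rfl fun j _ => Finset.sum_congr rfl fun i _ => ?_
  rw [ContinuousLinearMap.star_eq_adjoint, ContinuousLinearMap.adjoint_inner_right]

/-! ### Operators induced on the range of an idempotent matrix -/

variable {A : Matrix (Fin n) (Fin n) C(X, ℂ)} {A' : Matrix (Fin m) (Fin m) C(X, ℂ)}
  {A'' : Matrix (Fin l) (Fin l) C(X, ℂ)}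

/-- The operator `S ⊗' 1` on `im A`: the compression of `S ⊕ ⋯ ⊕ S`. -/
abbrev ampl (A : Matrix (Fin n) (Fin n) C(X, ℂ)) (S : D.H →L[ℂ] D.H) : D.im A →L[ℂ] D.im A :=
  D.compress A (D.diagOp n S)

/-- The operator `im A → im A'` induced by a matrix `M`. -/
def imMap (A : Matrix (Fin n) (Fin n) C(X, ℂ)) (A' : Matrix (Fin m) (Fin m) C(X, ℂ))
    (M : Matrix (Fin m) (Fin n) C(X, ℂ)) : D.im A →L[ℂ] D.im A' :=
  (D.matOp A' ∘L D.rectOp M ∘L (D.im A).subtypeL).codRestrict (D.im A')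
    (fun v => LinearMap.mem_range_self (D.matOp A').toLinearMap (D.rectOp M v))

theorem coe_imMap (M : Matrix (Fin m) (Fin n) C(X, ℂ)) (v : D.im A) :
    (D.imMap A A' M v : D.Pow m) = D.matOp A' (D.rectOp M v) := rfl

theorem imMap_apply {M : Matrix (Fin m) (Fin n) C(X, ℂ)} (hM : A' * M = M) (v : D.im A) :
    (D.imMap A A' M v : D.Pow m) = D.rectOp M v := by
  rw [coe_imMap, matOp_eq_rectOp, ← rectOp_mul, hM]

theorem coe_ampl (S : D.H →L[ℂ] D.H) (v : D.im A) :
    (D.ampl A S v : D.Pow n) = D.rectOp A (D.diagOp n S v) := rfl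

theorem rectOp_coe (hA : IsIdempotentElem A) (v : D.im A) : D.rectOp A v = v :=
  D.matOp_of_mem hA v

theorem ampl_apply_of_commutes (hA : IsIdempotentElem A) {S : D.H →L[ℂ] D.H}
    (hS : D.CommutesAction S) (v : D.im A) :
    (D.ampl A S v : D.Pow n) = D.diagOp n S v := by
  rw [coe_ampl, D.rectOp_diagOp_of_commutes hS, D.rectOp_coe hA]

theorem imMap_imMap {M : Matrix (Fin m) (Fin n) C(X, ℂ)} {N : Matrix (Fin l) (Fin m) C(X, ℂ)}
    (hM : A' * M = M) (hN : A'' * N = N) (v : D.im A) :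
    D.imMap A' A'' N (D.imMap A A' M v) = D.imMap A A'' (N * M) v := by
  apply Subtype.ext
  rw [D.imMap_apply hN, D.imMap_apply hM, D.imMap_apply (by rw [← Matrix.mul_assoc, hN]),
    rectOp_mul]

theorem imMap_self (hA : IsIdempotentElem A) (v : D.im A) : D.imMap A A A v = v := by
  apply Subtype.ext
  rw [D.imMap_apply hA.eq, D.rectOp_coe hA]

theorem imMap_ampl_of_commutes {S : D.H →L[ℂ] D.H} (hA : IsIdempotentElem A)
    (hA' : IsIdempotentElem A') (hS : D.CommutesAction S) {M : Matrix (Fin m) (Fin n) C(X, ℂ)}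
    (hM : A' * M = M) (v : D.im A) :
    D.imMap A A' M (D.ampl A S v) = D.ampl A' S (D.imMap A A' M v) := by
  apply Subtype.ext
  rw [D.imMap_apply hM, D.ampl_apply_of_commutes hA hS, D.ampl_apply_of_commutes hA' hS,
    D.imMap_apply hM, D.rectOp_diagOp_of_commutes hS]

theorem isCompactOperator_into_im {E : Type*} [NormedAddCommGroup E] [NormedSpace ℂ E]
    (hA : IsIdempotentElem A) {F : E →L[ℂ] D.im A} {F' : E →L[ℂ] D.Pow n}
    (hF' : IsCompactOperator ⇑F') (h : ∀ x, (F x : D.Pow n) = F' x) : IsCompactOperator ⇑F := by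
  have hi : IsIdempotentElem (D.matOp A) := by
    rw [IsIdempotentElem, ← matOp_mul, hA.eq]
  have hc : IsClosed (D.im A : Set (D.Pow n)) :=
    ContinuousLinearMap.IsIdempotentElem.isClosed_range hi
  have h2 := hF'.codRestrict (V := D.im A) (fun x => h x ▸ (F x).2) hc
  exact (congrArg IsCompactOperator (funext fun x => Subtype.ext (h x).symm)).mp h2

theorem isCompactOperator_ampl (hA : IsIdempotentElem A) {S : D.H →L[ℂ] D.H}
    (hS : IsCompactOperator ⇑S) : IsCompactOperator ⇑(D.ampl A S) :=
  D.isCompactOperator_into_im hA (F' := D.rectOp A ∘L D.diagOp n S ∘L (D.im A).subtypeL)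
    (((D.isCompactOperator_diagOp hS).comp_clm (D.im A).subtypeL).clm_comp (D.rectOp A))
    fun _ => rfl

/-- The operator induced by a matrix `M` commutes with `S ⊗' 1` up to a compact operator. -/
theorem isCompactOperator_imMap_ampl {S : D.H →L[ℂ] D.H} (hA : IsIdempotentElem A)
    (hA' : IsIdempotentElem A') (hS : D.CommutesActionModCompact S)
    {M : Matrix (Fin m) (Fin n) C(X, ℂ)} (hM : A' * M = M) (hM' : M * A = M) :
    IsCompactOperator
      ⇑(D.imMap A A' M ∘L D.ampl A S - D.ampl A' S ∘L D.imMap A A' M) := by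
  refine D.isCompactOperator_into_im hA'
    (F' := -(D.rectOp A' ∘L (D.diagOp m S ∘L D.rectOp M - D.rectOp M ∘L D.diagOp n S) ∘L
      (D.im A).subtypeL))
    ((((D.isCompactOperator_rectOp_diagOp hS M).comp_clm (D.im A).subtypeL).clm_comp
      (D.rectOp A')).neg) fun v => ?_
  change (D.imMap A A' M (D.ampl A S v) : D.Pow m) - D.ampl A' S (D.imMap A A' M v) =
    -(D.rectOp A' (D.diagOp m S (D.rectOp M v) - D.rectOp M (D.diagOp n S v)))
  rw [D.imMap_apply hM, coe_ampl, coe_ampl, D.imMap_apply hM, ← rectOp_mul, hM', map_sub,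
    ← rectOp_mul, hM]
  abel

theorem ampl_mul_of_commutes_left (hA : IsIdempotentElem A) {S : D.H →L[ℂ] D.H}
    (hS : D.CommutesAction S) (R : D.H →L[ℂ] D.H) :
    D.ampl A (S * R) = D.ampl A S * D.ampl A R := by
  ext1 v
  apply Subtype.ext
  change _ = (D.ampl A S (D.ampl A R v) : D.Pow n)
  rw [D.ampl_apply_of_commutes hA hS, coe_ampl, coe_ampl, ← D.rectOp_diagOp_of_commutes hS]
  rfl

theorem ampl_mul_of_commutes_right (hA : IsIdempotentElem A) (R : D.H →L[ℂ] D.H)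
    {S : D.H →L[ℂ] D.H} (hS : D.CommutesAction S) :
    D.ampl A (R * S) = D.ampl A R * D.ampl A S := by
  ext1 v
  apply Subtype.ext
  change _ = (D.ampl A R (D.ampl A S v) : D.Pow n)
  rw [coe_ampl, coe_ampl, D.ampl_apply_of_commutes hA hS]
  rfl

theorem isCompactOperator_ampl_mul (hA : IsIdempotentElem A) {S : D.H →L[ℂ] D.H}
    (hS : D.CommutesActionModCompact S) :
    IsCompactOperator ⇑(D.ampl A (S * S) - D.ampl A S * D.ampl A S) := by
  refine D.isCompactOperator_into_im hA
    (F' := D.rectOp A ∘L (D.diagOp n S ∘L D.rectOp A - D.rectOp A ∘L D.diagOp n S) ∘L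
      (-(D.diagOp n S ∘L (D.im A).subtypeL)))
    (((D.isCompactOperator_rectOp_diagOp hS A).comp_clm
      (-(D.diagOp n S ∘L (D.im A).subtypeL))).clm_comp (D.rectOp A)) fun v => ?_
  change D.rectOp A (D.diagOp n S (D.diagOp n S v)) -
      D.rectOp A (D.diagOp n S (D.rectOp A (D.diagOp n S v))) =
    D.rectOp A (D.diagOp n S (D.rectOp A (-(D.diagOp n S v))) -
      D.rectOp A (D.diagOp n S (-(D.diagOp n S v))))
  rw [map_sub, ← rectOp_mul, hA.eq]
  simp only [map_neg]
  abel

theorem ampl_one (hA : IsIdempotentElem A) : D.ampl A 1 = 1 := by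
  ext1 v
  apply Subtype.ext
  rw [D.ampl_apply_of_commutes hA (fun f => by rw [one_mul, mul_one])]
  rfl

theorem ampl_neg (S : D.H →L[ℂ] D.H) : D.ampl A (-S) = -D.ampl A S := by
  ext1 v
  apply Subtype.ext
  change D.rectOp A (D.diagOp n (-S) v) = -D.rectOp A (D.diagOp n S v)
  rw [← map_neg]
  rfl

theorem ampl_add (S R : D.H →L[ℂ] D.H) : D.ampl A (S + R) = D.ampl A S + D.ampl A R := by
  ext1 v
  apply Subtype.ext
  change D.rectOp A (D.diagOp n (S + R) v) =
    D.rectOp A (D.diagOp n S v) + D.rectOp A (D.diagOp n R v)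
  rw [← map_add]
  rfl

theorem ampl_smul (c : ℂ) (S : D.H →L[ℂ] D.H) : D.ampl A (c • S) = c • D.ampl A S := by
  ext1 v
  apply Subtype.ext
  change D.rectOp A (D.diagOp n (c • S) v) = c • D.rectOp A (D.diagOp n S v)
  rw [← map_smul]
  rfl

theorem ampl_sub (S R : D.H →L[ℂ] D.H) : D.ampl A (S - R) = D.ampl A S - D.ampl A R := by
  rw [sub_eq_add_neg, ampl_add, ampl_neg, sub_eq_add_neg]

theorem continuous_into_im {Z E : Type*} [TopologicalSpace Z] [NormedAddCommGroup E]
    [NormedSpace ℂ E] {F : Z → E →L[ℂ] D.im A}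
    (h : Continuous fun z => (D.im A).subtypeL ∘L F z) : Continuous F := by
  have hi : Isometry fun G : E →L[ℂ] D.im A => (D.im A).subtypeL ∘L G := by
    refine Isometry.of_dist_eq fun G G' => ?_
    rw [dist_eq_norm, dist_eq_norm, ← ContinuousLinearMap.comp_sub]
    exact LinearIsometry.norm_toContinuousLinearMap_comp (D.im A).subtypeₗᵢ
  exact hi.isUniformInducing.isInducing.continuous_iff.mpr h

theorem continuous_diagOp : Continuous (D.diagOp n) := by
  let ι : Fin n → D.H →L[ℂ] D.Pow n := fun i =>
    (PiLp.continuousLinearEquiv 2 ℂ (fun _ : Fin n => D.H)).symm.toContinuousLinearMap ∘L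
      ContinuousLinearMap.single ℂ (fun _ : Fin n => D.H) i
  let π : Fin n → D.Pow n →L[ℂ] D.H := fun i =>
    ContinuousLinearMap.proj i ∘L
      (PiLp.continuousLinearEquiv 2 ℂ (fun _ : Fin n => D.H)).toContinuousLinearMap
  have e : D.diagOp n = fun S => ∑ i, ι i ∘L S ∘L π i := by
    ext S x j
    simp only [sum_apply, WithLp.ofLp_sum, Finset.sum_apply]
    rw [Finset.sum_eq_single j]
    · simp [ι, π, diagOp_apply]
    · intro i _ hij
      simp [ι, π, hij.symm]
    · simp
  rw [e]
  fun_prop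

theorem continuous_ampl : Continuous (D.ampl A) := by
  refine D.continuous_into_im ?_
  have : Continuous fun S => D.matOp A ∘L D.diagOp n S ∘L (D.im A).subtypeL := by
    have := D.continuous_diagOp (n := n)
    fun_prop
  exact this

/-! ### Self-adjointness for a Hermitian idempotent -/

section Hermitian

variable (hφ : ∀ f : C(X, ℂ), D.φ (star f) = star (D.φ f))

include hφ

theorem isSelfAdjoint_ampl [CompleteSpace (D.im A)] (hA : IsIdempotentElem A)
    (hA' : A.IsHermitian) (S : D.H →L[ℂ] D.H) :
    D.ampl A (star S) = star (D.ampl A S) := by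
  rw [ContinuousLinearMap.star_eq_adjoint (D.ampl A S), ContinuousLinearMap.eq_adjoint_iff]
  intro x y
  have h1 : ∀ (x : D.im A) (z : D.Pow n),
      inner ℂ (x : D.Pow n) (D.rectOp A z) = inner ℂ (x : D.Pow n) z := fun x z => by
    have := D.inner_rectOp hφ A x z
    rw [hA'.eq, D.rectOp_coe hA] at this
    exact this.symm
  rw [Submodule.coe_inner, Submodule.coe_inner, coe_ampl, coe_ampl, D.inner_rectOp hφ, hA'.eq,
    D.rectOp_coe hA, h1]
  simp only [PiLp.inner_apply, diagOp_apply, ContinuousLinearMap.star_eq_adjoint,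
    ContinuousLinearMap.adjoint_inner_left]

theorem isSelfAdjoint_imMap [CompleteSpace (D.im A)] {M : Matrix (Fin n) (Fin n) C(X, ℂ)}
    (hM : A * M = M) (hM' : M.IsHermitian) : IsSelfAdjoint (D.imMap A A M) := by
  rw [ContinuousLinearMap.isSelfAdjoint_iff', eq_comm, ContinuousLinearMap.eq_adjoint_iff]
  intro x y
  rw [Submodule.coe_inner, Submodule.coe_inner, D.imMap_apply hM, D.imMap_apply hM,
    D.inner_rectOp hφ, hM'.eq]

theorem ampl_mono [CompleteSpace (D.im A)] (hA : IsIdempotentElem A) (hA' : A.IsHermitian)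
    {S R : D.H →L[ℂ] D.H} (h : S ≤ R) : D.ampl A S ≤ D.ampl A R := by
  rw [ContinuousLinearMap.le_def] at h ⊢
  rw [← ampl_sub]
  refine (ContinuousLinearMap.isPositive_def').mpr ⟨?_, fun x => ?_⟩
  · rw [IsSelfAdjoint, ← D.isSelfAdjoint_ampl hφ hA hA', h.isSelfAdjoint.star_eq]
  · rw [ContinuousLinearMap.reApplyInnerSelf_apply, Submodule.coe_inner, coe_ampl,
      D.inner_rectOp hφ, hA'.eq, D.rectOp_coe hA, PiLp.inner_apply, map_sum]
    exact Finset.sum_nonneg fun i _ => by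
      rw [diagOp_apply]
      exact h.re_inner_nonneg_left _

end Hermitian

end KData

/-! ### The operator of the cap product is Fredholm -/

section ProductOperator

variable {H : Type*} [NormedAddCommGroup H] [InnerProductSpace ℂ H] [CompleteSpace H]

/-- If `T` anticommutes with the involution `e`, which commutes with `a`, and `T` commutes with `a`
up to compact operators, then the cross terms in the square of `s T - r e a` form a compact
operator. Hence it is Fredholm if `s² T² + r² a²` is bounded below up to a compact operator. -/
theorem isFredholm_smul_sub_smul {T a e C : H →L[ℂ] H} (heT : e * T = -(T * e))
    (hea : e * a = a * e) (he : e * e = 1) (hTa : IsCompactOperator ⇑(T * a - a * T))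
    {s r k : ℝ} (hC : IsCompactOperator ⇑C)
    (h : 1 ≤ k • (s ^ 2 • (T * T) + r ^ 2 • (a * a)) + C) :
    (s • T - r • (e * a)).IsFredholm := by
  have e1 : e * a * (e * a) = a * a := by
    calc e * a * (e * a) = (a * e) * (e * a) := by rw [hea]
      _ = a * (e * e) * a := by noncomm_ring
      _ = a * a := by rw [he, mul_one]
  have e2 : T * (e * a) = -(e * (T * a)) := by
    rw [← mul_assoc, ← mul_assoc, heT, neg_mul, neg_neg]
  have sq : (s • T - r • (e * a)) * (s • T - r • (e * a)) =
      s ^ 2 • (T * T) + r ^ 2 • (a * a) + (s * r) • (e * (T * a - a * T)) := by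
    rw [sub_mul, mul_sub, mul_sub]
    simp only [smul_mul_smul_comm]
    rw [e1, e2, mul_sub, mul_assoc e a T]
    module
  refine isFredholm_of_one_le (k := k) (C := C - (k * (s * r)) • (e * (T * a - a * T))) ?_ ?_
  · have h1 : IsCompactOperator ⇑(e * (T * a - a * T)) := hTa.clm_comp e
    have h2 : IsCompactOperator ⇑((k * (s * r)) • (e * (T * a - a * T))) := h1.smul (k * (s * r))
    exact hC.sub h2
  · refine h.trans (le_of_eq ?_)
    rw [sq]
    module

end ProductOperator

/-- The properties of `T ⊗' 1`, `ε ⊗ 1` and `1 ⊗ C(α)`, as operators `T`, `e` and `a` on the graded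
Hilbert space with action underlying the cap product, on which its class depends. -/
structure KData.IsProduct {X : Type v} [TopologicalSpace X] (K : KData.{u} X)
    (T e a : K.H →L[ℂ] K.H) : Prop where
  graded : K.IsGraded
  T_selfAdjoint : IsSelfAdjoint T
  e_selfAdjoint : IsSelfAdjoint e
  a_selfAdjoint : IsSelfAdjoint a
  e_T : e * T = -(T * e)
  e_a : e * a = a * e
  e_e : e * e = 1
  T_a : IsCompactOperator ⇑(T * a - a * T)
  T_odd : K.ε * T = -(T * K.ε)
  ea_odd : K.ε * (e * a) = -(e * a * K.ε)
  T_φ : ∀ f, IsCompactOperator ⇑(T * K.φ f - K.φ f * T)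
  ea_φ : ∀ f, e * a * K.φ f = K.φ f * (e * a)
  bounded_below : ∃ (k : ℝ) (C : K.H →L[ℂ] K.H), 0 ≤ k ∧ IsCompactOperator ⇑C ∧
    1 ≤ (k : ℂ) • (T * T) + C

namespace KData.IsProduct

variable {X : Type v} [TopologicalSpace X] {K : KData.{u} X} {T e a : K.H →L[ℂ] K.H}
  (h : K.IsProduct T e a)

include h

theorem mul_self_nonneg : 0 ≤ T * T ∧ 0 ≤ a * a := by
  refine ⟨?_, ?_⟩
  · conv_rhs => lhs; rw [← h.T_selfAdjoint.star_eq]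
    exact star_mul_self_nonneg T
  · conv_rhs => lhs; rw [← h.a_selfAdjoint.star_eq]
    exact star_mul_self_nonneg a

theorem isKasparov_interpolation {s r k : ℝ} {C : K.H →L[ℂ] K.H} (hC : IsCompactOperator ⇑C)
    (hk : 1 ≤ k • (s ^ 2 • (T * T) + r ^ 2 • (a * a)) + C) :
    (K.withOp (s • T - r • (e * a))).IsKasparov := by
  refine h.graded.withOp_isKasparov ?_ ?_
    (isFredholm_smul_sub_smul h.e_T h.e_a h.e_e h.T_a hC hk) fun f => ?_
  · refine ((IsSelfAdjoint.all s).smul h.T_selfAdjoint).sub ((IsSelfAdjoint.all r).smul ?_)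
    rw [IsSelfAdjoint, star_mul, h.e_selfAdjoint.star_eq, h.a_selfAdjoint.star_eq, h.e_a]
  · rw [mul_sub, sub_mul, mul_smul_comm, mul_smul_comm, h.T_odd, h.ea_odd, smul_mul_assoc,
      smul_mul_assoc]
    module
  · have e1 : (s • T - r • (e * a)) * K.φ f - K.φ f * (s • T - r • (e * a)) =
        s • (T * K.φ f - K.φ f * T) := by
      rw [mul_sub, sub_mul, mul_smul_comm, mul_smul_comm, smul_mul_assoc, smul_mul_assoc, h.ea_φ]
      module
    rw [e1]
    exact (h.T_φ f).smul s

/-- The second term of the cap product may be scaled. -/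
theorem isKasparov_scale (t : ℝ) : (K.withOp (T - t • (e * a))).IsKasparov := by
  obtain ⟨k, C, hk, hC, hb⟩ := h.bounded_below
  rw [Complex.coe_smul] at hb
  have h1 := h.isKasparov_interpolation (s := 1) (r := t) (k := k) hC (by
    refine hb.trans ?_
    rw [one_pow, one_smul, smul_add]
    gcongr
    exact le_add_of_nonneg_right (smul_nonneg hk (smul_nonneg (sq_nonneg t) h.mul_self_nonneg.2)))
  rwa [one_smul] at h1

theorem isKasparov_left : (K.withOp T).IsKasparov := by
  simpa using h.isKasparov_scale 0

theorem isKasparov_sub : (K.withOp (T - e * a)).IsKasparov := by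
  simpa using h.isKasparov_scale 1

/-- Scaling the second term to zero does not change the class. -/
theorem mk_sub : KHomology.mk ⟨K.withOp (T - e * a), h.isKasparov_sub⟩ =
    KHomology.mk ⟨K.withOp T, h.isKasparov_left⟩ := by
  refine (KHomology.mk_eq_of_homotopy (D := K) (fun t => T - (t : ℝ) • (e * a)) (by fun_prop)
    (fun t => h.isKasparov_scale t) ?_ ?_ _ _).symm
  · simp
  · simp

/-- If `a` is invertible, then the first term may be scaled to zero, which leaves a degenerate
module. -/
theorem mk_sub_eq_zero (ha : IsUnit a) :
    KHomology.mk ⟨K.withOp (T - e * a), h.isKasparov_sub⟩ = 0 := by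
  obtain ⟨R, hR⟩ := ha.exists_left_inv
  obtain ⟨k, C, hk, hC, hb⟩ := exists_one_le_of_inverse_mod_compact (S := a) (R := R)
    (by rw [hR, sub_self]; exact isCompactOperator_zero)
  rw [h.a_selfAdjoint.star_eq] at hb
  have hK : ∀ s : ℝ, (K.withOp (s • T - e * a)).IsKasparov := fun s => by
    have := h.isKasparov_interpolation (s := s) (r := 1) (k := k) hC (by
      refine hb.trans ?_
      rw [one_pow, one_smul, smul_add]
      gcongr
      exact le_add_of_nonneg_left (smul_nonneg hk (smul_nonneg (sq_nonneg s) h.mul_self_nonneg.1)))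
    rwa [one_smul] at this
  have h0 : (K.withOp (-(e * a))).IsKasparov := by simpa using hK 0
  have e1 : KHomology.mk ⟨K.withOp (-(e * a)), h0⟩ =
      KHomology.mk ⟨K.withOp (T - e * a), h.isKasparov_sub⟩ := by
    refine KHomology.mk_eq_of_homotopy (D := K) (fun t => (t : ℝ) • T - e * a) (by fun_prop)
      (fun t => hK t) ?_ ?_ _ _
    · simp
    · simp
  rw [← e1]
  refine KHomology.mk_eq_zero_of_isDegenerate ⟨?_, fun f => ?_⟩
  · have he : IsUnit e := ⟨⟨e, e, h.e_e, h.e_e⟩, rfl⟩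
    exact (he.mul ha).neg
  · change -(e * a) * K.φ f = K.φ f * -(e * a)
    rw [neg_mul, h.ea_φ, mul_neg]

end KData.IsProduct

/-! ### Presentations and the operators induced by maps of sections -/

namespace Presentation

variable {G : Type z} {Y : Type v} [Group G] [TopologicalSpace G] [TopologicalSpace Y]
  [MulAction G Y] {E E' E'' : HermBundle.{v, w, z} G Y}

/-- The matrix of a map of section modules with respect to two presentations: `ι' L ι⁻¹` on the
range of `A`, and `0` on the kernel of `A`. -/
def mat (P : Presentation E) (P' : Presentation E')
    (L : E.sections →ₗ[C(Orb G Y, ℂ)] E'.sections) :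
    Matrix (Fin P'.n) (Fin P.n) C(Orb G Y, ℂ) :=
  LinearMap.toMatrix' ((LinearMap.range P'.A.mulVecLin).subtype ∘ₗ P'.ι.toLinearMap ∘ₗ L ∘ₗ
    P.ι.symm.toLinearMap ∘ₗ P.A.mulVecLin.rangeRestrict)

variable (P : Presentation E) (P' : Presentation E') (P'' : Presentation E'')

theorem mulVec_coe (x : LinearMap.range P.A.mulVecLin) : P.A.mulVec x.1 = x.1 := by
  obtain ⟨_, y, rfl⟩ := x
  simp only [Matrix.mulVecLin_apply, Matrix.mulVec_mulVec, P.idem.eq]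

theorem mat_mulVec (L : E.sections →ₗ[C(Orb G Y, ℂ)] E'.sections)
    (x : Fin P.n → C(Orb G Y, ℂ)) :
    (P.mat P' L).mulVec x = (P'.ι (L (P.ι.symm (P.A.mulVecLin.rangeRestrict x)))).1 := by
  rw [mat, LinearMap.toMatrix'_mulVec]
  rfl

theorem mat_mulVec_ι (L : E.sections →ₗ[C(Orb G Y, ℂ)] E'.sections) (s : E.sections) :
    (P.mat P' L).mulVec (P.ι s).1 = (P'.ι (L s)).1 := by
  rw [mat_mulVec]
  have : P.A.mulVecLin.rangeRestrict (P.ι s).1 = P.ι s := Subtype.ext (P.mulVec_coe _)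
  rw [this, LinearEquiv.symm_apply_apply]

theorem ext_mulVec {m n : ℕ} {M N : Matrix (Fin m) (Fin n) C(Orb G Y, ℂ)}
    (h : ∀ x, M.mulVec x = N.mulVec x) : M = N :=
  Matrix.mulVec_injective (funext h)

theorem mat_mul_mat (L : E.sections →ₗ[C(Orb G Y, ℂ)] E'.sections)
    (L' : E'.sections →ₗ[C(Orb G Y, ℂ)] E''.sections) :
    P'.mat P'' L' * P.mat P' L = P.mat P'' (L' ∘ₗ L) := by
  refine ext_mulVec fun x => ?_
  rw [← Matrix.mulVec_mulVec, P.mat_mulVec P' L, mat_mulVec_ι, mat_mulVec]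
  rfl

theorem mat_id : P.mat P LinearMap.id = P.A := by
  refine ext_mulVec fun x => ?_
  rw [mat_mulVec, LinearMap.id_apply, LinearEquiv.apply_symm_apply]
  rfl

theorem mul_mat (L : E.sections →ₗ[C(Orb G Y, ℂ)] E'.sections) :
    P'.A * P.mat P' L = P.mat P' L := by
  rw [← mat_id, mat_mul_mat, LinearMap.id_comp]

theorem mat_mul (L : E.sections →ₗ[C(Orb G Y, ℂ)] E'.sections) :
    P.mat P' L * P.A = P.mat P' L := by
  rw [← mat_id P, mat_mul_mat, LinearMap.comp_id]

theorem mat_add (L L' : E.sections →ₗ[C(Orb G Y, ℂ)] E'.sections) :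
    P.mat P' (L + L') = P.mat P' L + P.mat P' L' := by
  refine ext_mulVec fun x => ?_
  rw [Matrix.add_mulVec, mat_mulVec, mat_mulVec, mat_mulVec, LinearMap.add_apply, map_add]
  rfl

variable (D : KData.{u} (Orb G Y))

/-- The operator `1 ⊗ L : H ⊗ C(E) → H ⊗ C(E')` induced by a map `L` of section modules. -/
def op (L : E.sections →ₗ[C(Orb G Y, ℂ)] E'.sections) : D.im P.A →L[ℂ] D.im P'.A :=
  D.imMap P.A P'.A (P.mat P' L)

theorem op_op (L : E.sections →ₗ[C(Orb G Y, ℂ)] E'.sections)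
    (L' : E'.sections →ₗ[C(Orb G Y, ℂ)] E''.sections) (v : D.im P.A) :
    P'.op P'' D L' (P.op P' D L v) = P.op P'' D (L' ∘ₗ L) v := by
  rw [op, op, D.imMap_imMap (P.mul_mat P' L) (P'.mul_mat P'' L'), mat_mul_mat]
  rfl

theorem op_id (v : D.im P.A) : P.op P D LinearMap.id v = v := by
  rw [op, mat_id, D.imMap_self P.idem]

theorem op_mul_op (L L' : E.sections →ₗ[C(Orb G Y, ℂ)] E.sections) :
    P.op P D L' * P.op P D L = P.op P D (L' ∘ₗ L) := by
  ext1 v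
  exact P.op_op P P D L L' v

theorem op_add (L L' : E.sections →ₗ[C(Orb G Y, ℂ)] E'.sections) :
    P.op P' D (L + L') = P.op P' D L + P.op P' D L' := by
  ext1 v
  apply Subtype.ext
  change _ = (P.op P' D L v : D.Pow P'.n) + P.op P' D L' v
  rw [op, op, op, D.imMap_apply (P.mul_mat P' _), D.imMap_apply (P.mul_mat P' _),
    D.imMap_apply (P.mul_mat P' _), mat_add, D.rectOp_add]
  rfl

theorem op_zero (v : D.im P.A) : P.op P' D 0 v = 0 := by
  have h := congrArg (fun S : D.im P.A →L[ℂ] D.im P'.A => S v) (P.op_add P' D 0 0)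
  rw [add_zero] at h
  exact left_eq_add.mp h

theorem op_neg (L : E.sections →ₗ[C(Orb G Y, ℂ)] E'.sections) (v : D.im P.A) :
    P.op P' D (-L) v = -P.op P' D L v := by
  have h := congrArg (fun S : D.im P.A →L[ℂ] D.im P'.A => S v) (P.op_add P' D (-L) L)
  rw [neg_add_cancel] at h
  exact eq_neg_of_add_eq_zero_left (h.symm.trans (P.op_zero P' D v))

theorem op_ampl {S : D.H →L[ℂ] D.H} (hS : D.CommutesAction S)
    (L : E.sections →ₗ[C(Orb G Y, ℂ)] E'.sections) (v : D.im P.A) :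
    P.op P' D L (D.ampl P.A S v) = D.ampl P'.A S (P.op P' D L v) :=
  D.imMap_ampl_of_commutes P.idem P'.idem hS (P.mul_mat P' L) v

theorem isCompactOperator_op_ampl {S : D.H →L[ℂ] D.H} (hS : D.CommutesActionModCompact S)
    (L : E.sections →ₗ[C(Orb G Y, ℂ)] E'.sections) :
    IsCompactOperator ⇑(P.op P' D L ∘L D.ampl P.A S - D.ampl P'.A S ∘L P.op P' D L) :=
  D.isCompactOperator_imMap_ampl P.idem P'.idem hS (P.mul_mat P' L) (P.mat_mul P' L)

theorem completeSpace_im : CompleteSpace (D.im P.A) := by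
  have h : IsIdempotentElem (D.matOp P.A) := by
    rw [IsIdempotentElem, ← KData.matOp_mul, P.idem.eq]
  exact (ContinuousLinearMap.IsIdempotentElem.isClosed_range h).completeSpace_coe

end Presentation


theorem KData.isGraded_of_mul {X : Type v} [TopologicalSpace X] {K : KData.{u} X}
    {e o : K.H →L[ℂ] K.H} (hε : K.ε = e * o) (he : e * e = 1) (ho : o * o = 1)
    (heo : e * o = o * e) (hes : IsSelfAdjoint e) (hos : IsSelfAdjoint o)
    (hφ : ∀ f : C(X, ℂ), K.φ (star f) = star (K.φ f)) (heφ : ∀ f, e * K.φ f = K.φ f * e)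
    (hoφ : ∀ f, o * K.φ f = K.φ f * o) : K.IsGraded := by
  refine ⟨?_, ?_, hφ, fun f => ?_⟩
  · calc K.ε * K.ε = e * (o * e) * o := by rw [hε]; noncomm_ring
      _ = (e * e) * (o * o) := by rw [← heo]; noncomm_ring
      _ = 1 := by rw [he, ho, one_mul]
  · rw [hε, IsSelfAdjoint, star_mul, hes.star_eq, hos.star_eq, heo]
  · rw [hε, mul_assoc, hoφ, ← mul_assoc, heφ, mul_assoc]

section CapData

variable {G : Type z} {Y : Type v} [Group G] [TopologicalSpace G] [TopologicalSpace Y]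
  [MulAction G Y] {B : Set Y} {D : KData.{u} (Orb G Y)} (hD : D.IsKasparov)
  {p : Cocycle.{v, w, z} G Y B} (P : Presentation p.E)

include hD in
theorem KData.IsKasparov.commutesAction_ε : D.CommutesAction D.ε := hD.map_even

theorem compress_diagOp_mul_matOp (S : D.H →L[ℂ] D.H)
    (L : p.E.sections →ₗ[C(Orb G Y, ℂ)] p.E.sections) :
    D.compress P.A (D.diagOp P.n S * D.matOp (P.matrixOf L)) =
      D.ampl P.A S * P.op P D L := by
  ext1 v
  apply Subtype.ext
  change D.matOp P.A (D.diagOp P.n S (D.matOp (P.matrixOf L) v)) =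
    D.matOp P.A (D.diagOp P.n S (P.op P D L v : D.Pow P.n))
  rw [Presentation.op, KData.imMap_apply _ (P.mul_mat P L)]
  rfl

theorem capData_ε : (capData ⟨D, hD⟩ p P).ε =
    D.ampl P.A D.ε * P.op P D p.ε_isEnd.onSections :=
  compress_diagOp_mul_matOp P D.ε _

theorem capData_T : (capData ⟨D, hD⟩ p P).T =
    D.ampl P.A D.T - D.ampl P.A D.ε * P.op P D p.α_isEnd.onSections :=
  congrArg (fun x => D.ampl P.A D.T - x)
    (compress_diagOp_mul_matOp P D.ε p.α_isEnd.onSections)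

variable {P}

/-- The section presented by a column of the idempotent. -/
def Presentation.colSection (P : Presentation p.E) (j : Fin P.n) : p.E.sections :=
  P.ι.symm (P.A.mulVecLin.rangeRestrict (Pi.single j 1))

omit hD in
theorem Presentation.ι_colSection (i j : Fin P.n) : (P.ι (P.colSection j)).1 i = P.A i j := by
  rw [Presentation.colSection, LinearEquiv.apply_symm_apply]
  change P.A.mulVec (Pi.single j 1) i = _
  rw [Matrix.mulVec_single_one]
  rfl

omit hD in
theorem Presentation.mat_apply_eq_colSection
    (L : p.E.sections →ₗ[C(Orb G Y, ℂ)] p.E.sections) (i j : Fin P.n) :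
    P.mat P L i j = (P.ι (L (P.colSection j))).1 i := by
  have h := congrFun (P.mat_mulVec P L (Pi.single j 1)) i
  rw [Matrix.mulVec_single_one] at h
  exact h

omit hD in
/-- The matrix of a symmetric endomorphism in a Hermitian presentation is Hermitian. -/
theorem Presentation.IsHermitian.isHermitian_mat (hP : P.IsHermitian)
    {L : ∀ x, p.E.fiber x →ₗ[ℂ] p.E.fiber x} (hL : p.E.IsEnd L) (h : ∀ x, (L x).IsSymmetric) :
    (P.mat P hL.onSections).IsHermitian := by
  have key : ∀ i j (y : Y), inner ℂ ((P.colSection i).1 y) (L y ((P.colSection j).1 y)) =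
      P.mat P hL.onSections i j (orb G y) := by
    intro i j y
    have h1 := hP.isometry (P.colSection i) (hL.onSections (P.colSection j)) y
    refine h1.trans ?_
    conv_rhs => rw [← P.mul_mat P hL.onSections, Matrix.mul_apply]
    simp only [ContinuousMap.sum_apply, ContinuousMap.mul_apply, P.ι_colSection,
      P.mat_apply_eq_colSection]
    refine Finset.sum_congr rfl fun k _ => ?_
    congr 1
    exact congrArg (fun f : C(Orb G Y, ℂ) => f (orb G y)) (hP.selfAdjoint.apply i k)
  ext i j q
  obtain ⟨y, rfl⟩ := Quotient.exists_rep q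
  change star (P.mat P hL.onSections j i (orb G y)) = P.mat P hL.onSections i j (orb G y)
  rw [← key, ← key]
  refine (inner_conj_symm _ _).trans ?_
  exact h y _ _

omit hD in
/-- In a Hermitian presentation the grading of the sections is diagonal, with entries `±1`, and
commutes with the idempotent. -/
theorem Presentation.IsHermitian.mat_ε_apply (hP : P.IsHermitian) {d : Fin P.n → ℤˣ}
    (hd : ∀ (s : p.E.sections) (i : Fin P.n),
      (P.ι (p.ε_isEnd.onSections s)).1 i = ((d i : ℤ) : ℂ) • (P.ι s).1 i) :
    (∀ i j, P.mat P p.ε_isEnd.onSections i j = ((d i : ℤ) : ℂ) • P.A i j) ∧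
      ∀ i j, ((d i : ℤ) : ℂ) • P.A i j = ((d j : ℤ) : ℂ) • P.A i j := by
  have h1 : ∀ i j, P.mat P p.ε_isEnd.onSections i j = ((d i : ℤ) : ℂ) • P.A i j := fun i j => by
    rw [P.mat_apply_eq_colSection, hd, P.ι_colSection]
  refine ⟨h1, fun i j => ?_⟩
  rw [← h1, ← (hP.isHermitian_mat p.ε_isEnd p.ε_symm).apply i j, h1, star_smul,
    hP.selfAdjoint.apply i j]
  simp

omit hD in
theorem Presentation.IsHermitian.exists_grading (hP : P.IsHermitian) :
    ∃ d : Fin P.n → ℤˣ, (∀ i j, P.mat P p.ε_isEnd.onSections i j = ((d i : ℤ) : ℂ) • P.A i j) ∧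
      ∀ i j, ((d i : ℤ) : ℂ) • P.A i j = ((d j : ℤ) : ℂ) • P.A i j :=
  let ⟨d, hd⟩ := hP.graded
  ⟨d, hP.mat_ε_apply hd⟩

/-- In a Hermitian presentation `1 ⊗ C(ε)` commutes exactly with every `S ⊗' 1`. -/
theorem op_ε_ampl (hP : P.IsHermitian) (S : D.H →L[ℂ] D.H) :
    P.op P D p.ε_isEnd.onSections * D.ampl P.A S =
      D.ampl P.A S * P.op P D p.ε_isEnd.onSections := by
  ext1 v
  change P.op P D p.ε_isEnd.onSections (D.ampl P.A S v) =
      D.ampl P.A S (P.op P D p.ε_isEnd.onSections v)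
  obtain ⟨d, hd, hdA⟩ := hP.exists_grading
  have h1 : ∀ w : D.im P.A, ∀ i, (P.op P D p.ε_isEnd.onSections w : D.Pow P.n) i =
      ((d i : ℤ) : ℂ) • (w : D.Pow P.n) i := by
    intro w i
    rw [Presentation.op, KData.imMap_apply _ (P.mul_mat P _), KData.rectOp_apply]
    conv_rhs => rw [← D.rectOp_coe P.idem w, KData.rectOp_apply, Finset.smul_sum]
    refine Finset.sum_congr rfl fun j _ => ?_
    rw [hd, map_smul]
    rfl
  apply Subtype.ext
  ext i
  rw [h1, KData.coe_ampl, KData.coe_ampl, KData.rectOp_apply, KData.rectOp_apply, Finset.smul_sum]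
  refine Finset.sum_congr rfl fun j _ => ?_
  rw [KData.diagOp_apply, KData.diagOp_apply, h1, map_smul, map_smul]
  have := congrArg (fun f => D.φ f (S ((v : D.Pow P.n) j))) (hdA i j)
  simpa only [map_smul, smul_apply] using this

omit hD in
theorem IsEnd_comp_onSections {E : HermBundle.{v, w, z} G Y} {L M : ∀ x, E.fiber x →ₗ[ℂ] E.fiber x}
    (hL : E.IsEnd L) (hM : E.IsEnd M) (N : E.sections →ₗ[C(Orb G Y, ℂ)] E.sections)
    (h : ∀ (s : E.sections) x, (N s).1 x = L x (M x (s.1 x))) :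
    hL.onSections ∘ₗ hM.onSections = N :=
  LinearMap.ext fun s => Subtype.ext (funext fun x => (h s x).symm)

theorem op_ε_sq : P.op P D p.ε_isEnd.onSections * P.op P D p.ε_isEnd.onSections = 1 := by
  rw [P.op_mul_op, IsEnd_comp_onSections p.ε_isEnd p.ε_isEnd LinearMap.id
    fun s x => (p.ε_sq x _).symm]
  ext1 v
  exact P.op_id D v

theorem op_α_op_ε : P.op P D p.ε_isEnd.onSections * P.op P D p.α_isEnd.onSections =
    -(P.op P D p.α_isEnd.onSections * P.op P D p.ε_isEnd.onSections) := by
  rw [P.op_mul_op, P.op_mul_op, IsEnd_comp_onSections p.ε_isEnd p.α_isEnd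
    (-(p.α_isEnd.onSections ∘ₗ p.ε_isEnd.onSections)) fun s x => (p.α_odd x _).symm]
  ext1 v
  exact P.op_neg P D _ v

theorem op_mul_ampl (L : p.E.sections →ₗ[C(Orb G Y, ℂ)] p.E.sections) {S : D.H →L[ℂ] D.H}
    (hS : D.CommutesAction S) :
    P.op P D L * D.ampl P.A S = D.ampl P.A S * P.op P D L := by
  ext1 v
  exact P.op_ampl P D hS L v

include hD in
theorem ampl_ε_sq : D.ampl P.A D.ε * D.ampl P.A D.ε = 1 := by
  rw [← D.ampl_mul_of_commutes_left P.idem hD.commutesAction_ε, hD.grading_sq, D.ampl_one P.idem]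

include hD in
theorem isSelfAdjoint_ampl_of_isHermitian [CompleteSpace (D.im P.A)] (hP : P.IsHermitian)
    {S : D.H →L[ℂ] D.H} (hS : IsSelfAdjoint S) : IsSelfAdjoint (D.ampl P.A S) := by
  rw [IsSelfAdjoint, ← D.isSelfAdjoint_ampl hD.map_star P.idem hP.selfAdjoint, hS.star_eq]

theorem ampl_mul_ampl_φ (S : D.H →L[ℂ] D.H) (f : C(Orb G Y, ℂ)) :
    D.ampl P.A S * D.ampl P.A (D.φ f) = D.ampl P.A (S * D.φ f) :=
  (D.ampl_mul_of_commutes_right P.idem S (D.commutesAction_φ f)).symm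

theorem ampl_φ_mul_ampl (S : D.H →L[ℂ] D.H) (f : C(Orb G Y, ℂ)) :
    D.ampl P.A (D.φ f) * D.ampl P.A S = D.ampl P.A (D.φ f * S) :=
  (D.ampl_mul_of_commutes_left P.idem (D.commutesAction_φ f) S).symm

include hD in
theorem ampl_ε_mul_ampl_φ (f : C(Orb G Y, ℂ)) :
    D.ampl P.A D.ε * D.ampl P.A (D.φ f) = D.ampl P.A (D.φ f) * D.ampl P.A D.ε := by
  rw [ampl_mul_ampl_φ, ampl_φ_mul_ampl, hD.map_even]

theorem capData_isGraded (hP : P.IsHermitian) : (capData ⟨D, hD⟩ p P).IsGraded := by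
  have := P.completeSpace_im D
  refine KData.isGraded_of_mul (K := capData ⟨D, hD⟩ p P) (e := D.ampl P.A D.ε)
    (o := P.op P D p.ε_isEnd.onSections) (capData_ε hD P) (ampl_ε_sq hD) op_ε_sq
    (op_mul_ampl _ hD.commutesAction_ε).symm
    (isSelfAdjoint_ampl_of_isHermitian hD hP hD.grading_selfAdjoint)
    (D.isSelfAdjoint_imMap hD.map_star (P.mul_mat P _) (hP.isHermitian_mat p.ε_isEnd p.ε_symm))
    (fun f => ?_) (ampl_ε_mul_ampl_φ hD) (fun f => op_mul_ampl _ (D.commutesAction_φ f))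
  have h1 := D.isSelfAdjoint_ampl hD.map_star P.idem hP.selfAdjoint (D.φ f)
  rw [← hD.map_star] at h1
  exact h1

include hD in
theorem ampl_ε_mul_ampl_T :
    D.ampl P.A D.ε * D.ampl P.A D.T = -(D.ampl P.A D.T * D.ampl P.A D.ε) := by
  rw [← D.ampl_mul_of_commutes_left P.idem hD.commutesAction_ε, hD.odd, D.ampl_neg,
    D.ampl_mul_of_commutes_right P.idem _ hD.commutesAction_ε]

theorem mul_anticomm {R : Type*} [Ring R] {e o T : R} (heT : e * T = -(T * e))
    (hoT : o * T = T * o) : e * o * T = -(T * (e * o)) := by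
  rw [mul_assoc, hoT, ← mul_assoc, heT, neg_mul, mul_assoc]

theorem mul_anticomm_mul {R : Type*} [Ring R] {e o a : R} (heo : e * o = o * e)
    (hea : e * a = a * e) (hoa : o * a = -(a * o)) :
    e * o * (e * a) = -(e * a * (e * o)) := by
  calc e * o * (e * a) = e * (o * e) * a := by noncomm_ring
    _ = e * e * (o * a) := by rw [← heo]; noncomm_ring
    _ = -(e * (e * a) * o) := by rw [hoa]; noncomm_ring
    _ = -(e * (a * e) * o) := by rw [hea]
    _ = -(e * a * (e * o)) := by noncomm_ring

include hD in
theorem exists_one_le_ampl [CompleteSpace (D.im P.A)] (hP : P.IsHermitian) :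
    ∃ (k : ℝ) (C : D.im P.A →L[ℂ] D.im P.A), 0 ≤ k ∧ IsCompactOperator ⇑C ∧
      1 ≤ (k : ℂ) • (D.ampl P.A D.T * D.ampl P.A D.T) + C := by
  obtain ⟨R, hR, -⟩ := isFredholm_inverse_mod_compact hD.fredholm
  obtain ⟨k, C, hk, hC, h⟩ := exists_one_le_of_inverse_mod_compact hR
  have h1 := D.ampl_mono hD.map_star P.idem hP.selfAdjoint h
  rw [D.ampl_one P.idem, D.ampl_add, ← Complex.coe_smul, D.ampl_smul, hD.selfAdjoint.star_eq] at h1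
  refine ⟨k, D.ampl P.A C + (k : ℂ) • (D.ampl P.A (D.T * D.T) -
    D.ampl P.A D.T * D.ampl P.A D.T), hk, ?_, h1.trans (le_of_eq ?_)⟩
  · exact (D.isCompactOperator_ampl P.idem hC).add
      ((D.isCompactOperator_ampl_mul P.idem hD.compact_commutator).smul (k : ℂ))
  · rw [smul_sub]
    abel

theorem capData_isProduct (hP : P.IsHermitian) : (capData ⟨D, hD⟩ p P).IsProduct
    (D.ampl P.A D.T) (D.ampl P.A D.ε) (P.op P D p.α_isEnd.onSections) := by
  have := P.completeSpace_im D
  refine ⟨capData_isGraded hD hP, ?_, ?_, ?_, ?_, ?_, ?_, ?_, ?_, ?_, fun f => ?_, fun f => ?_, ?_⟩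
  · exact isSelfAdjoint_ampl_of_isHermitian hD hP hD.selfAdjoint
  · exact isSelfAdjoint_ampl_of_isHermitian hD hP hD.grading_selfAdjoint
  · exact D.isSelfAdjoint_imMap hD.map_star (P.mul_mat P _) (hP.isHermitian_mat p.α_isEnd p.α_symm)
  · exact ampl_ε_mul_ampl_T hD
  · exact (op_mul_ampl _ hD.commutesAction_ε).symm
  · exact ampl_ε_sq hD
  · have h1 := P.isCompactOperator_op_ampl P D hD.compact_commutator p.α_isEnd.onSections
    have h2 := h1.neg
    refine (congrArg IsCompactOperator (funext fun x => ?_)).mp h2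
    exact neg_sub _ _
  · rw [capData_ε hD P]
    exact mul_anticomm (ampl_ε_mul_ampl_T hD) (op_ε_ampl hP D.T)
  · rw [capData_ε hD P]
    exact mul_anticomm_mul (op_mul_ampl _ hD.commutesAction_ε).symm
      (op_mul_ampl _ hD.commutesAction_ε).symm op_α_op_ε
  · have h1 : D.ampl P.A D.T * D.ampl P.A (D.φ f) - D.ampl P.A (D.φ f) * D.ampl P.A D.T =
        D.ampl P.A (D.T * D.φ f - D.φ f * D.T) := by
      rw [ampl_mul_ampl_φ, ampl_φ_mul_ampl, D.ampl_sub]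
    have h2 := D.isCompactOperator_ampl P.idem (hD.compact_commutator f)
    rw [← h1] at h2
    exact h2
  · have h1 : D.ampl P.A D.ε * P.op P D p.α_isEnd.onSections * D.ampl P.A (D.φ f) =
        D.ampl P.A (D.φ f) * (D.ampl P.A D.ε * P.op P D p.α_isEnd.onSections) := by
      rw [mul_assoc, op_mul_ampl _ (D.commutesAction_φ f), ← mul_assoc, ampl_ε_mul_ampl_φ hD,
        mul_assoc]
    exact h1
  · exact exists_one_le_ampl hD hP

/-- The module of the cap product with the operator `T ⊗' 1` alone. -/
def capBase (hD : D.IsKasparov) (hP : P.IsHermitian) : KModule.{u} (Orb G Y) :=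
  ⟨(capData ⟨D, hD⟩ p P).withOp (D.ampl P.A D.T), (capData_isProduct hD hP).isKasparov_left⟩

theorem capData_isKasparov (hP : P.IsHermitian) : (capData ⟨D, hD⟩ p P).IsKasparov := by
  have h := (capData_isProduct hD hP).isKasparov_sub
  have e : (capData ⟨D, hD⟩ p P).withOp (D.ampl P.A D.T -
      D.ampl P.A D.ε * P.op P D p.α_isEnd.onSections) = capData ⟨D, hD⟩ p P :=
    congrArg (capData ⟨D, hD⟩ p P).withOp (capData_T hD P).symm
  exact e ▸ h

theorem mk_capData (hP : P.IsHermitian) :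
    KHomology.mk ⟨capData ⟨D, hD⟩ p P, capData_isKasparov hD hP⟩ =
      KHomology.mk (capBase hD hP) := by
  have h := (capData_isProduct hD hP).mk_sub
  refine Eq.trans (congrArg KHomology.mk (Subtype.ext ?_)) h
  exact congrArg (capData ⟨D, hD⟩ p P).withOp (capData_T hD P)

theorem mk_capData_eq_zero (hP : P.IsHermitian)
    (hα : ∃ L : p.E.sections →ₗ[C(Orb G Y, ℂ)] p.E.sections,
      L ∘ₗ p.α_isEnd.onSections = LinearMap.id ∧ p.α_isEnd.onSections ∘ₗ L = LinearMap.id) :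
    KHomology.mk ⟨capData ⟨D, hD⟩ p P, capData_isKasparov hD hP⟩ = 0 := by
  have hu : IsUnit (P.op P D p.α_isEnd.onSections) := by
    obtain ⟨L, hL, hL'⟩ := hα
    refine ⟨⟨P.op P D p.α_isEnd.onSections, P.op P D L, ?_, ?_⟩, rfl⟩
    · rw [P.op_mul_op, hL']; ext1 v; exact P.op_id D v
    · rw [P.op_mul_op, hL]; ext1 v; exact P.op_id D v
  have h := (capData_isProduct hD hP).mk_sub_eq_zero hu
  refine Eq.trans (congrArg KHomology.mk (Subtype.ext ?_)) h
  exact congrArg (capData ⟨D, hD⟩ p P).withOp (capData_T hD P)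

end CapData

/-! ### Continuity in local trivializations -/

namespace HermBundle

open Topology Filter MeasureTheory

variable {G : Type z} {Y : Type v} [Group G] [TopologicalSpace G] [TopologicalSpace Y]
  [MulAction G Y]

instance completeSpace_fiber (E : HermBundle.{v, w, z} G Y) (x : Y) : CompleteSpace (E.fiber x) :=
  FiniteDimensional.complete ℂ _

variable (E : HermBundle.{v, w, z} G Y)

open Classical in
/-- The trivialization around `x₀` as a map into the fibre at `x₀`, extended by `0` to the points
outside of its domain. -/
def tr (x₀ x : Y) : E.fiber x →L[ℂ] E.fiber x₀ :=
  if h : x ∈ E.U x₀ then (E.triv x₀ x h).toContinuousLinearEquiv.toContinuousLinearMap else 0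

open Classical in
/-- The inverse of the trivialization around `x₀`, extended by `0` to the points outside of its
domain. -/
def trInv (x₀ x : Y) : E.fiber x₀ →L[ℂ] E.fiber x :=
  if h : x ∈ E.U x₀ then (E.triv x₀ x h).symm.toContinuousLinearEquiv.toContinuousLinearMap else 0

variable {E}

theorem tr_apply {x₀ x : Y} (h : x ∈ E.U x₀) (e : E.fiber x) : E.tr x₀ x e = E.triv x₀ x h e := by
  rw [tr, dif_pos h]; rfl

theorem trInv_apply {x₀ x : Y} (h : x ∈ E.U x₀) (e : E.fiber x₀) :
    E.trInv x₀ x e = (E.triv x₀ x h).symm e := by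
  rw [trInv, dif_pos h]; rfl

theorem tr_trInv {x₀ x : Y} (h : x ∈ E.U x₀) (e : E.fiber x₀) :
    E.tr x₀ x (E.trInv x₀ x e) = e := by
  rw [tr_apply h, trInv_apply h, LinearIsometryEquiv.apply_symm_apply]

theorem trInv_tr {x₀ x : Y} (h : x ∈ E.U x₀) (e : E.fiber x) :
    E.trInv x₀ x (E.tr x₀ x e) = e := by
  rw [tr_apply h, trInv_apply h, LinearIsometryEquiv.symm_apply_apply]

theorem inner_tr {x₀ x : Y} (h : x ∈ E.U x₀) (e e' : E.fiber x) :
    inner ℂ (E.tr x₀ x e) (E.tr x₀ x e') = inner ℂ e e' := by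
  rw [tr_apply h, tr_apply h, LinearIsometryEquiv.inner_map_map]

theorem continuousOn_transition (x₀ x₁ : Y) :
    ContinuousOn (fun x => E.tr x₁ x ∘L E.trInv x₀ x) (E.U x₀ ∩ E.U x₁) := by
  rw [continuousOn_clm_apply]
  intro e
  rw [continuousOn_iff_continuous_domRestrict]
  refine (E.continuous_transition x₀ x₁ e).congr fun x => ?_
  change _ = E.tr x₁ x.1 (E.trInv x₀ x.1 e)
  rw [trInv_apply x.2.1, tr_apply x.2.2]

theorem continuous_triv_iff {s : ∀ x, E.fiber x} {x₀ : Y} :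
    (Continuous fun x : {x // x ∈ E.U x₀} => E.triv x₀ x.1 x.2 (s x.1)) ↔
      ContinuousOn (fun x => E.tr x₀ x (s x)) (E.U x₀) := by
  rw [continuousOn_iff_continuous_domRestrict]
  refine continuous_congr fun x => ?_
  exact (tr_apply x.2 _).symm

/-- Continuity of a section may be checked at each point in the trivialization around it. -/
theorem continuousOn_tr_of_continuousAt {s : ∀ x, E.fiber x}
    (h : ∀ x, ContinuousAt (fun y => E.tr x y (s y)) x) (x₀ : Y) :
    ContinuousOn (fun x => E.tr x₀ x (s x)) (E.U x₀) := by
  intro x hx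
  refine ContinuousAt.continuousWithinAt ?_
  have hU : E.U x ∩ E.U x₀ ∈ 𝓝 x :=
    ((E.isOpen_U x).inter (E.isOpen_U x₀)).mem_nhds ⟨E.mem_U x, hx⟩
  have h1 := ((continuousOn_transition (E := E) x x₀).continuousAt hU).clm_apply (h x)
  refine h1.congr ?_
  filter_upwards [hU] with y hy
  change E.tr x₀ y (E.trInv x y (E.tr x y (s y))) = _
  rw [trInv_tr hy.1]

theorem continuousAt_tr (s : E.sections) (x₀ : Y) :
    ContinuousAt (fun x => E.tr x₀ x (s.1 x)) x₀ :=
  (continuous_triv_iff.mp (s.2.1 x₀)).continuousAt ((E.isOpen_U x₀).mem_nhds (E.mem_U x₀))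

/-- The section with given values, if they are continuous at each point in the trivialization around
it, and equivariant. -/
def mkSection (s : ∀ x, E.fiber x) (h : ∀ x, ContinuousAt (fun y => E.tr x y (s y)) x)
    (hg : ∀ (g : G) {x y : Y} (h : g • x = y), E.act g h (s x) = s y) : E.sections :=
  ⟨s, fun x₀ => continuous_triv_iff.mpr (continuousOn_tr_of_continuousAt h x₀), hg⟩

theorem continuous_inner_sections (s t : E.sections) :
    Continuous fun y => inner ℂ (s.1 y) (t.1 y) := by
  rw [continuous_iff_continuousAt]
  intro x
  refine ((continuousAt_tr s x).inner (𝕜 := ℂ) (continuousAt_tr t x)).congr ?_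
  filter_upwards [(E.isOpen_U x).mem_nhds (E.mem_U x)] with y hy
  exact inner_tr hy _ _

theorem isEnd_iff {L : ∀ x, E.fiber x →L[ℂ] E.fiber x} :
    E.IsEnd (fun x => (L x).toLinearMap) ↔
      (∀ x₀, ContinuousOn (fun x => E.tr x₀ x ∘L L x ∘L E.trInv x₀ x) (E.U x₀)) ∧
      ∀ (g : G) {x y : Y} (h : g • x = y) (e : E.fiber x),
        E.act g h (L x e) = L y (E.act g h e) := by
  have key : ∀ x₀, ContinuousOn (fun x => E.tr x₀ x ∘L L x ∘L E.trInv x₀ x) (E.U x₀) ↔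
      ∀ e : E.fiber x₀, Continuous fun x : {x // x ∈ E.U x₀} =>
        E.triv x₀ x.1 x.2 (L x.1 ((E.triv x₀ x.1 x.2).symm e)) := by
    intro x₀
    rw [continuousOn_clm_apply]
    refine forall_congr' fun e => ?_
    rw [continuousOn_iff_continuous_domRestrict]
    refine continuous_congr fun x => ?_
    change E.tr x₀ x.1 (L x.1 (E.trInv x₀ x.1 e)) = _
    rw [trInv_apply x.2, tr_apply x.2]
  refine ⟨fun h => ⟨fun x₀ => (key x₀).mpr (h.continuous x₀), h.equivariant⟩,
    fun h => ⟨fun x₀ => (key x₀).mp (h.1 x₀), h.2⟩⟩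

theorem act_act (g g' : G) {x y z : Y} (h : g • x = y) (h' : g' • y = z) (e : E.fiber x) :
    E.act g' h' (E.act g h e) = E.act (g' * g) (by rw [mul_smul, h, h']) e :=
  (E.act_mul g g' h h' _ e).symm

/-! ### Invariant sections by averaging over the group -/

theorem tr_act_eq {g : G} {a b : Y} (c : Y) (hab : g • a = b) (e : E.fiber a) :
    E.tr c b (E.act g hab e) = E.tr c (g • a) (E.act g rfl e) := by
  subst hab; rfl

theorem continuousOn_act (x₀ y₀ : Y) (e : E.fiber x₀) :
    ContinuousOn (fun q : G × Y => E.tr y₀ (q.1 • q.2) (E.act q.1 rfl (E.trInv x₀ q.2 e)))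
      {q | q.2 ∈ E.U x₀ ∧ q.1 • q.2 ∈ E.U y₀} := by
  rw [continuousOn_iff_continuous_domRestrict]
  refine (E.continuous_act x₀ y₀ e).congr fun q => ?_
  change _ = E.tr y₀ (q.1.1 • q.1.2) (E.act q.1.1 rfl (E.trInv x₀ q.1.2 e))
  rw [trInv_apply q.2.1, tr_apply q.2.2]

/-- The value at `y` of the translate by `g` of the local section around `x₀` that is constant in
the trivialization. -/
def translate (E : HermBundle.{v, w, z} G Y) (x₀ : Y) (e : E.fiber x₀) (y : Y) (g : G) :
    E.fiber y :=
  E.act g (smul_inv_smul g y) (E.trInv x₀ (g⁻¹ • y) e)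

theorem act_translate (x₀ : Y) (e : E.fiber x₀) {y y' : Y} (h g : G) (hy : h • y = y') :
    E.act h hy (E.translate x₀ e y g) = E.translate x₀ e y' (h * g) := by
  have aux : ∀ (a b : Y) (k : G) (hab : a = b) (ha : k • a = y') (hb : k • b = y'),
      E.act k ha (E.trInv x₀ a e) = E.act k hb (E.trInv x₀ b e) := by
    intro a b k hab ha hb
    subst hab; rfl
  rw [translate, act_act]
  refine aux _ _ _ ?_ _ _
  rw [← hy, mul_inv_rev, mul_smul, inv_smul_smul]

variable [IsTopologicalGroup G] [ContinuousSMul G Y]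

theorem continuousAt_tr_translate (x₀ x₁ : Y) (e : E.fiber x₀) {q : Y × G} (h1 : q.1 ∈ E.U x₁)
    (h0 : q.2⁻¹ • q.1 ∈ E.U x₀) :
    ContinuousAt (fun q : Y × G => E.tr x₁ q.1 (E.translate x₀ e q.1 q.2)) q := by
  have hm : Continuous fun q : Y × G => (q.2, q.2⁻¹ • q.1) := by fun_prop
  have hopen : IsOpen {q : G × Y | q.2 ∈ E.U x₀ ∧ q.1 • q.2 ∈ E.U x₁} :=
    ((E.isOpen_U x₀).preimage continuous_snd).inter ((E.isOpen_U x₁).preimage continuous_smul)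
  have h2 := ((continuousOn_act x₀ x₁ e).continuousAt (x := (q.2, q.2⁻¹ • q.1))
    (hopen.mem_nhds ⟨h0, by simpa using h1⟩))
  refine (ContinuousAt.comp (f := fun q : Y × G => (q.2, q.2⁻¹ • q.1)) h2 hm.continuousAt).congr ?_
  exact Eventually.of_forall fun q' => (tr_act_eq x₁ _ _).symm

/-- The function `ρ` cuts the translated local section off outside the domain of the
trivialization. -/
theorem continuousOn_cutoff (x₀ x₁ : Y) (e : E.fiber x₀) (ρ : C(Y, ℝ))
    (hρ : tsupport ρ ⊆ E.U x₀) :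
    ContinuousOn (fun q : Y × G => E.tr x₁ q.1 ((ρ (q.2⁻¹ • q.1) : ℂ) •
      E.translate x₀ e q.1 q.2)) (E.U x₁ ×ˢ Set.univ) := by
  rintro q ⟨hq, -⟩
  refine ContinuousAt.continuousWithinAt ?_
  have hρc : Continuous fun q : Y × G => (ρ (q.2⁻¹ • q.1) : ℂ) := by fun_prop
  by_cases h0 : q.2⁻¹ • q.1 ∈ E.U x₀
  · simp only [map_smul]
    exact hρc.continuousAt.smul (continuousAt_tr_translate x₀ x₁ e hq h0)
  · have hcl : IsOpen {q : Y × G | q.2⁻¹ • q.1 ∉ tsupport ρ} :=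
      (isClosed_tsupport ρ).isOpen_compl.preimage (by fun_prop)
    refine (continuousAt_const (y := (0 : E.fiber x₁))).congr ?_
    filter_upwards [hcl.mem_nhds fun h => h0 (hρ h)] with q' hq'
    rw [image_eq_zero_of_notMem_tsupport hq']
    simp

variable [CompactSpace G] [MeasurableSpace G] [BorelSpace G] (μ : Measure G) [μ.IsHaarMeasure]

/-- The average over the group of a local section, cut off by `ρ`. -/
def average (E : HermBundle.{v, w, z} G Y) (x₀ : Y) (e : E.fiber x₀) (ρ : C(Y, ℝ))
    (hρ : tsupport ρ ⊆ E.U x₀) : E.sections :=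
  mkSection (fun y => ∫ g, (ρ (g⁻¹ • y) : ℂ) • E.translate x₀ e y g ∂μ)
    (fun x => by
      have h1 : ContinuousOn (fun y => ∫ g, E.tr x y ((ρ (g⁻¹ • y) : ℂ) •
          E.translate x₀ e y g) ∂μ) (E.U x) :=
        continuousOn_integral_of_compact_support isCompact_univ
          (continuousOn_cutoff x₀ x e ρ hρ) fun _ _ _ h => absurd (Set.mem_univ _) h
      have hU := (E.isOpen_U x).mem_nhds (E.mem_U x)
      refine (h1.continuousAt hU).congr ?_
      filter_upwards [hU] with y hy
      have h2 := (E.triv x y hy).toContinuousLinearEquiv.integral_comp_comm (μ := μ)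
        fun g => (ρ (g⁻¹ • y) : ℂ) • E.translate x₀ e y g
      rw [tr_apply hy]
      refine Eq.trans ?_ h2
      refine integral_congr_ae (Eventually.of_forall fun g => ?_)
      exact tr_apply hy _)
    (fun h x y hxy => by
      have h2 := (E.act h hxy).toContinuousLinearEquiv.integral_comp_comm (μ := μ)
        fun g => (ρ (g⁻¹ • x) : ℂ) • E.translate x₀ e x g
      refine h2.symm.trans ?_
      have h3 := integral_mul_left_eq_self (μ := μ)
        (fun g => (ρ (g⁻¹ • y) : ℂ) • E.translate x₀ e y g) h
      refine Eq.trans ?_ h3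
      refine integral_congr_ae (Eventually.of_forall fun g => ?_)
      change E.act h hxy (_ • _) = _
      rw [map_smul, act_translate]
      have : (h * g)⁻¹ • y = g⁻¹ • x := by rw [← hxy, mul_inv_rev, mul_smul, inv_smul_smul]
      simp only [this])

end HermBundle

namespace HermBundle

open Topology Filter MeasureTheory

variable {G : Type z} {Y : Type v} [Group G] [TopologicalSpace G] [TopologicalSpace Y]
  [MulAction G Y] {E : HermBundle.{v, w, z} G Y}

/-- The values at a point of the invariant sections. -/
def sectionValues (E : HermBundle.{v, w, z} G Y) (y : Y) : Submodule ℂ (E.fiber y) where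
  carrier := {e | ∃ s : E.sections, s.1 y = e}
  zero_mem' := ⟨0, rfl⟩
  add_mem' := by
    rintro _ _ ⟨s, rfl⟩ ⟨t, rfl⟩
    exact ⟨s + t, rfl⟩
  smul_mem' := by
    rintro c _ ⟨s, rfl⟩
    exact ⟨ContinuousMap.const (Orb G Y) c • s, rfl⟩

variable [IsTopologicalGroup G] [CompactSpace G] [CompactSpace Y] [T2Space Y] [ContinuousSMul G Y]

/-- Because the isotropy group of `y` acts trivially on the fibre at `y`, the averages over `G` of
local sections that are supported in a small neighbourhood of `y` have enough values at `y`. -/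
theorem exists_section_apply_eq (hE : E.IsotropyTrivial) (y : Y) (e : E.fiber y) :
    ∃ s : E.sections, s.1 y = e := by
  let _ : MeasurableSpace G := borel G
  have : BorelSpace G := ⟨rfl⟩
  suffices h : E.sectionValues y = ⊤ by
    have : e ∈ E.sectionValues y := h ▸ Submodule.mem_top
    exact this
  by_contra hne
  have hne' : (E.sectionValues y)ᗮ ≠ ⊥ := fun h => hne (Submodule.orthogonal_eq_bot_iff.mp h)
  obtain ⟨e, he, he0⟩ := Submodule.exists_mem_ne_zero_of_ne_bot hne'
  set c : E.fiber y := E.tr y y e with hc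
  have htc : E.trInv y y c = e := trInv_tr (E.mem_U y) e
  -- the translate by an element of the isotropy group is `e`
  have hstab : ∀ g : G, g⁻¹ • y = y → E.translate y c y g = e := by
    intro g hg
    have aux : ∀ (a : Y) (h1 : a = y) (ha : g • a = y), E.act g ha (E.trInv y a c) = e := by
      intro a h1 ha
      subst h1
      rw [hE, htc]
    exact aux _ hg _
  have hcont : ∀ g : G, g⁻¹ • y ∈ E.U y → ContinuousAt (fun g => E.translate y c y g) g := by
    intro g hg
    have h1 := (continuousAt_tr_translate (E := E) y y c (q := (y, g)) (E.mem_U y) hg).comp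
      (f := fun g : G => (y, g)) (by fun_prop)
    refine ((E.trInv y y).continuous.continuousAt.comp h1).congr (Eventually.of_forall fun g' => ?_)
    exact trInv_tr (E.mem_U y) _
  set O : Set G := {g | g⁻¹ • y ∈ E.U y ∧ 0 < (inner ℂ e (E.translate y c y g)).re} with hO
  have hOopen : IsOpen O := by
    rw [isOpen_iff_mem_nhds]
    rintro g ⟨h1, h2⟩
    have h3 : ContinuousAt (fun g : G => g⁻¹ • y) g := by fun_prop
    have h4 : ContinuousAt (fun g => (inner ℂ e (E.translate y c y g)).re) g :=
      Complex.continuous_re.continuousAt.comp (continuousAt_const.inner (𝕜 := ℂ) (hcont g h1))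
    filter_upwards [h3 ((E.isOpen_U y).mem_nhds h1), h4 (isOpen_Ioi.mem_nhds h2)] with g' h5 h6
    exact ⟨h5, h6⟩
  have he1 : 0 < (inner ℂ e e).re := by
    rw [inner_self_eq_norm_sq_to_K]
    norm_cast
    exact pow_pos (norm_pos_iff.mpr he0) 2
  have hq : Continuous fun g : G => g⁻¹ • y := by fun_prop
  have hKc : IsClosed ((fun g : G => g⁻¹ • y) '' Oᶜ) :=
    (hOopen.isClosed_compl.isCompact.image hq).isClosed
  set W : Set Y := ((fun g : G => g⁻¹ • y) '' Oᶜ)ᶜ ∩ E.U y with hW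
  have hyW : y ∈ W := by
    refine ⟨?_, E.mem_U y⟩
    rintro ⟨g, hg, hgy⟩
    refine hg ⟨?_, ?_⟩
    · have hgy' : g⁻¹ • y = y := hgy
      rw [hgy']; exact E.mem_U y
    · rw [hstab g hgy]; exact he1
  have hWopen : IsOpen W := hKc.isOpen_compl.inter (E.isOpen_U y)
  obtain ⟨ρ, hρ, hρ1, hρ0⟩ := exists_tsupport_one_of_isOpen_isClosed hWopen
    isClosed_closure.isCompact (isClosed_singleton (x := y)) (Set.singleton_subset_iff.mpr hyW)
  have hρU : tsupport ρ ⊆ E.U y := hρ.trans Set.inter_subset_right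
  set μ : Measure G := Measure.haar
  set f : G → E.fiber y := fun g => (ρ (g⁻¹ • y) : ℂ) • E.translate y c y g with hf
  have hfc : Continuous f := by
    have h1 : Continuous fun g => E.tr y y (f g) := by
      rw [← continuousOn_univ]
      exact (continuousOn_cutoff y y c ρ hρU).comp (f := fun g : G => (y, g))
        (by fun_prop) fun g _ => ⟨E.mem_U y, Set.mem_univ _⟩
    refine ((E.trInv y y).continuous.comp h1).congr fun g => ?_
    exact trInv_tr (E.mem_U y) _
  have hint : Integrable f μ := hfc.integrable_of_hasCompactSupport
    (HasCompactSupport.of_compactSpace f)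
  have h0 : inner ℂ e ((E.average μ y c ρ hρU).1 y) = 0 :=
    Submodule.inner_left_of_mem_orthogonal (K := E.sectionValues y) ⟨_, rfl⟩ he
  have h1 : ∫ g, (inner ℂ e (f g)).re ∂μ = 0 := by
    have h2 := integral_inner (𝕜 := ℂ) hint e
    have h3 := integral_re (𝕜 := ℂ) (hint.const_inner (𝕜 := ℂ) e)
    rw [h2] at h3
    refine h3.trans ?_
    exact congrArg Complex.re h0
  have hval : ∀ g, (inner ℂ e (f g)).re = ρ (g⁻¹ • y) * (inner ℂ e (E.translate y c y g)).re := by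
    intro g
    rw [hf]
    simp only [inner_smul_right, Complex.re_ofReal_mul]
  have hpos : 0 < ∫ g, (inner ℂ e (f g)).re ∂μ := by
    refine Continuous.integral_pos_of_hasCompactSupport_nonneg_nonzero (x := 1) ?_
      (HasCompactSupport.of_compactSpace _) ?_ ?_
    · exact Complex.continuous_re.comp (continuous_const.inner hfc)
    · intro g
      change 0 ≤ (inner ℂ e (f g)).re
      rw [hval]
      by_cases hg : g ∈ O
      · exact mul_nonneg (hρ0 _).1 hg.2.le
      · have : g⁻¹ • y ∉ tsupport ρ := fun h => (hρ h).1 ⟨g, hg, rfl⟩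
        rw [image_eq_zero_of_notMem_tsupport this, zero_mul]
    · rw [hval, hstab 1 (by simp), inv_one, one_smul, hρ1 rfl]
      simpa using he1.ne'
  exact hpos.ne' h1

end HermBundle

/-! ### Frames -/

section Frames

variable {ι : Type*} [Fintype ι] {H K : Type*} [NormedAddCommGroup H] [InnerProductSpace ℂ H]
  [CompleteSpace H] [NormedAddCommGroup K] [InnerProductSpace ℂ K] [CompleteSpace K]

/-- The frame operator `∑ i, ⟪v i, ·⟫ v i` of a family of vectors. -/
def frameOp (x : ι → H) : H →L[ℂ] H := ∑ i, InnerProductSpace.rankOne ℂ (x i) (x i)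

theorem frameOp_apply (x : ι → H) (e : H) : frameOp x e = ∑ i, inner ℂ (x i) e • x i := by
  simp [frameOp]

theorem frameOp_nonneg (x : ι → H) : 0 ≤ frameOp x :=
  Finset.sum_nonneg fun i _ => (ContinuousLinearMap.nonneg_iff_isPositive _).mpr
    (InnerProductSpace.isPositive_rankOne_self (x i))

theorem continuous_frameOp : Continuous fun x : ι → H => frameOp x := by
  unfold frameOp
  refine continuous_finsetSum _ fun i _ => ?_
  have h : Continuous fun e : H => InnerProductSpace.rankOne ℂ e e := by
    have h1 : Continuous fun e : H => ContinuousLinearMap.toSpanSingleton ℂ e :=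
      (ContinuousLinearMap.toSpanSingletonCLE (𝕜 := ℂ) (E := H)).continuous
    have h2 : Continuous fun e : H => innerSL ℂ e := (innerSL ℂ).continuous
    exact h1.clm_comp h2
  exact h.comp (continuous_apply i)

theorem frameOp_map (V : H ≃ₗᵢ[ℂ] K) (x : ι → H) :
    frameOp (fun i => V (x i)) = V.conjStarAlgEquiv (frameOp x) := by
  ext e
  have : V.conjStarAlgEquiv (frameOp x) e = V (frameOp x (V.symm e)) := rfl
  rw [this, frameOp_apply, frameOp_apply, map_sum]
  refine Finset.sum_congr rfl fun i _ => ?_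
  rw [map_smul, ← V.inner_map_map (x i), V.apply_symm_apply]

theorem frameOp_isStrictlyPositive [FiniteDimensional ℂ H] {x : ι → H}
    (hx : ∀ e, (∀ i, inner ℂ (x i) e = 0) → e = 0) : IsStrictlyPositive (frameOp x) := by
  refine IsUnit.isStrictlyPositive ?_ (frameOp_nonneg x)
  rw [ContinuousLinearMap.isUnit_iff_bijective]
  have hinj : Function.Injective (frameOp x).toLinearMap := by
    rw [injective_iff_map_eq_zero]
    intro e he
    refine hx e fun i => ?_
    have h1 : ∑ i, (‖inner ℂ (x i) e‖ ^ 2 : ℝ) = 0 := by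
      have h2 : inner ℂ e (frameOp x e) = 0 := by
        have he' : frameOp x e = 0 := he
        rw [he', inner_zero_right]
      rw [frameOp_apply, inner_sum] at h2
      have h3 : ∀ i, inner ℂ e (inner ℂ (x i) e • x i) = ((‖inner ℂ (x i) e‖ ^ 2 : ℝ) : ℂ) := by
        intro i
        rw [inner_smul_right, ← inner_conj_symm e (x i), RCLike.mul_conj]; push_cast; rfl
      simp only [h3] at h2
      exact_mod_cast h2
    have h4 := (Finset.sum_eq_zero_iff_of_nonneg fun i _ => by positivity).mp h1 i
      (Finset.mem_univ i)
    simpa using h4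
  exact ⟨hinj, LinearMap.injective_iff_surjective.mp hinj⟩

/-- The Parseval frame `L ^ (-1/2) v i`, where `L` is the frame operator. -/
def parseval (x : ι → H) (i : ι) : H := invSqrt (frameOp x) (x i)

/-- The Parseval frame is natural for unitaries; this makes it continuous in trivializations and
equivariant. -/
theorem parseval_map (V : H ≃ₗᵢ[ℂ] K) {x : ι → H} (hx : IsStrictlyPositive (frameOp x)) (i : ι) :
    parseval (fun i => V (x i)) i = V (parseval x i) := by
  rw [parseval, frameOp_map, invSqrt_conj V hx]
  change V (invSqrt (frameOp x) (V.symm (V (x i)))) = _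
  rw [V.symm_apply_apply, parseval]

theorem sum_parseval {x : ι → H} (hx : IsStrictlyPositive (frameOp x)) (e : H) :
    ∑ i, inner ℂ (parseval x i) e • parseval x i = e := by
  have h1 := congrArg (fun S : H →L[ℂ] H => S e) (invSqrt_mul_mul_invSqrt hx)
  change invSqrt (frameOp x) (frameOp x (invSqrt (frameOp x) e)) = e at h1
  rw [frameOp_apply, map_sum] at h1
  refine Eq.trans (Finset.sum_congr rfl fun i _ => ?_) h1
  rw [map_smul, parseval]
  congr 1
  rw [← ContinuousLinearMap.adjoint_inner_right, ← ContinuousLinearMap.star_eq_adjoint,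
    (isSelfAdjoint_invSqrt _).star_eq]

/-- If every `x i` is an eigenvector of the symmetric operator `o` with eigenvalue `±1`, then `o`
commutes with the frame operator, so that the Parseval frame consists of eigenvectors as well. -/
theorem map_parseval {o : H →L[ℂ] H} (ho : ∀ e f, inner ℂ (o e) f = inner ℂ e (o f)) {x : ι → H}
    {d : ι → ℤˣ} (hd : ∀ i, o (x i) = ((d i : ℤ) : ℂ) • x i) (i : ι) :
    o (parseval x i) = ((d i : ℤ) : ℂ) • parseval x i := by
  have hc : Commute (frameOp x) o := by
    change frameOp x * o = o * frameOp x
    ext e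
    change frameOp x (o e) = o (frameOp x e)
    rw [frameOp_apply, frameOp_apply, map_sum]
    refine Finset.sum_congr rfl fun i _ => ?_
    rw [map_smul, hd, ← ho, hd, inner_smul_left, smul_smul, mul_comm]
    simp
  have h1 := congrArg (fun S : H →L[ℂ] H => S (x i)) (commute_invSqrt hc).eq
  change invSqrt (frameOp x) (o (x i)) = o (invSqrt (frameOp x) (x i)) at h1
  rw [parseval, ← h1, hd, map_smul]

theorem continuousOn_parseval {Z : Type*} [TopologicalSpace Z] {x : Z → ι → H} {t : Set Z}
    (hx : ContinuousOn x t) (hp : ∀ y ∈ t, IsStrictlyPositive (frameOp (x y))) (i : ι) :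
    ContinuousOn (fun y => parseval (x y) i) t := by
  have h1 : ContinuousOn (fun y => frameOp (x y)) t :=
    continuous_frameOp.comp_continuousOn hx
  exact (continuousOn_invSqrt h1 hp).clm_apply ((continuous_apply i).comp_continuousOn hx)

end Frames

namespace HermBundle

open Topology Filter MeasureTheory

variable {G : Type z} {Y : Type v} [Group G] [TopologicalSpace G] [TopologicalSpace Y]
  [MulAction G Y] {E : HermBundle.{v, w, z} G Y}

/-- The sections span the fibre at `y`. -/
def Spans {ι : Type*} (s : ι → E.sections) (y : Y) : Prop :=
  ∀ e : E.fiber y, (∀ i, inner ℂ ((s i).1 y) e = 0) → e = 0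

theorem Spans.isStrictlyPositive {ι : Type*} [Fintype ι] {s : ι → E.sections} {y : Y}
    (h : Spans s y) : IsStrictlyPositive (frameOp fun i => (s i).1 y) :=
  frameOp_isStrictlyPositive h

/-- Spanning a fibre is an open condition, because the invertible operators form an open set. -/
theorem Spans.eventually {ι : Type*} [Fintype ι] {s : ι → E.sections} {y : Y} (h : Spans s y) :
    ∀ᶠ x in 𝓝 y, Spans s x := by
  have h1 : ContinuousAt (fun x => frameOp fun i => E.tr y x ((s i).1 x)) y := by
    refine continuous_frameOp.continuousAt.comp ?_
    exact continuousAt_pi.mpr fun i => continuousAt_tr (s i) y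
  have h2 : IsUnit (frameOp fun i => E.tr y y ((s i).1 y)) := by
    refine (frameOp_isStrictlyPositive fun e he => ?_).isUnit
    have h3 : E.trInv y y e = 0 := h _ fun i => by
      rw [← inner_tr (E.mem_U y), tr_trInv (E.mem_U y)]
      exact he i
    rw [← tr_trInv (E.mem_U y) e, h3, map_zero]
  filter_upwards [h1 (Units.isOpen.mem_nhds h2), (E.isOpen_U y).mem_nhds (E.mem_U y)] with x hx hxU
  intro e he
  have hinj := (ContinuousLinearMap.isUnit_iff_bijective.mp hx).1
  have h4 : E.tr y x e = 0 := by
    refine hinj ?_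
    rw [map_zero, frameOp_apply]
    refine Finset.sum_eq_zero fun i _ => ?_
    rw [inner_tr hxU, he i, zero_smul]
  rw [← trInv_tr hxU e, h4, map_zero]

/-- Finitely many sections, homogeneous of degrees given by signs, that form a Parseval frame in
every fibre. -/
structure ParsevalFrame {B : Set Y} (p : Cocycle.{v, w, z} G Y B) (n : ℕ) where
  s : Fin n → p.E.sections
  sum_eq : ∀ y (e : p.E.fiber y), ∑ i, inner ℂ ((s i).1 y) e • (s i).1 y = e
  d : Fin n → ℤˣ
  ε_eq : ∀ i y, p.ε y ((s i).1 y) = ((d i : ℤ) : ℂ) • (s i).1 y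

theorem exists_finset_spans [IsTopologicalGroup G] [CompactSpace G] [CompactSpace Y] [T2Space Y]
    [ContinuousSMul G Y] (hE : E.IsotropyTrivial) :
    ∃ T : Finset E.sections, ∀ y, Spans (fun s : T => s.1) y := by
  classical
  have mono : ∀ {T T' : Finset E.sections} {y : Y}, T ⊆ T' → Spans (fun s : T => s.1) y →
      Spans (fun s : T' => s.1) y := fun hT h e he => h e fun i => he ⟨i.1, hT i.2⟩
  suffices h : ∃ T : Finset E.sections, ∀ y ∈ (Set.univ : Set Y), Spans (fun s : T => s.1) y by
    obtain ⟨T, hT⟩ := h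
    exact ⟨T, fun y => hT y (Set.mem_univ y)⟩
  refine isCompact_univ.induction_on (p := fun S : Set Y => ∃ T : Finset E.sections,
    ∀ y ∈ S, Spans (fun s : T => s.1) y) ⟨∅, fun y hy => hy.elim⟩ ?_ ?_ ?_
  · rintro S S' hS ⟨T, hT⟩
    exact ⟨T, fun y hy => hT y (hS hy)⟩
  · rintro S S' ⟨T, hT⟩ ⟨T', hT'⟩
    refine ⟨T ∪ T', fun y hy => ?_⟩
    rcases hy with hy | hy
    · exact mono Finset.subset_union_left (hT y hy)
    · exact mono Finset.subset_union_right (hT' y hy)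
  · intro y _
    choose s hs using exists_section_apply_eq (E := E) hE y
    let b := stdOrthonormalBasis ℂ (E.fiber y)
    have h1 : Spans (fun t : (Finset.univ.image fun i => s (b i) : Finset E.sections) =>
        t.1) y := by
      intro e he
      rw [← b.sum_repr' e]
      refine Finset.sum_eq_zero fun i _ => ?_
      have h2 := he ⟨s (b i), Finset.mem_image_of_mem _ (Finset.mem_univ i)⟩
      simp only [hs] at h2
      rw [h2, zero_smul]
    exact ⟨_, mem_nhdsWithin_of_mem_nhds h1.eventually, _, fun x hx => hx⟩

/-- The Parseval frame made from sections that span every fibre. -/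
def parsevalSection {ι : Type*} [Fintype ι] (s : ι → E.sections) (h : ∀ y, Spans s y) (i : ι) :
    E.sections :=
  mkSection (fun y => parseval (fun i => (s i).1 y) i)
    (fun x => by
      have hpos : ∀ y, (hy : y ∈ E.U x) → IsStrictlyPositive
          (frameOp fun i => E.tr x y ((s i).1 y)) := by
        intro y hy
        simp only [tr_apply hy]
        rw [frameOp_map (E.triv x y hy)]
        exact ⟨map_nonneg _ (h y).isStrictlyPositive.nonneg,
          (h y).isStrictlyPositive.isUnit.map _⟩
      have h1 : ContinuousOn (fun y => parseval (fun i => E.tr x y ((s i).1 y)) i) (E.U x) :=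
        continuousOn_parseval (x := fun y i => E.tr x y ((s i).1 y))
          (continuousOn_pi.mpr fun i => continuous_triv_iff.mp ((s i).2.1 x)) hpos i
      have hU := (E.isOpen_U x).mem_nhds (E.mem_U x)
      refine (h1.continuousAt hU).congr ?_
      filter_upwards [hU] with y hy
      simp only [tr_apply hy]
      exact parseval_map (E.triv x y hy) (h y).isStrictlyPositive i)
    (fun g x y hxy => by
      rw [← parseval_map (E.act g hxy) (h x).isStrictlyPositive i]
      congr 1
      funext j
      exact (s j).2.2 g hxy)

theorem exists_parsevalFrame [IsTopologicalGroup G] [CompactSpace G] [CompactSpace Y] [T2Space Y]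
    [ContinuousSMul G Y] {B : Set Y} (p : Cocycle.{v, w, z} G Y B) :
    ∃ n, Nonempty (ParsevalFrame p n) := by
  obtain ⟨T, hT⟩ := exists_finset_spans p.isotropy
  -- the sections `t ± ε t` are homogeneous and span the same subspaces as the sections `t`, `ε t`
  let s : T × ℤˣ → p.E.sections := fun t => t.1.1 +
    ContinuousMap.const (Orb G Y) ((t.2 : ℤ) : ℂ) • p.ε_isEnd.onSections t.1.1
  have hs : ∀ t y, (s t).1 y = t.1.1.1 y + ((t.2 : ℤ) : ℂ) • p.ε y (t.1.1.1 y) := fun _ _ => rfl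
  have hspan : ∀ y, Spans s y := by
    intro y e he
    refine hT y e fun i => ?_
    have h1 := he (i, 1)
    have h2 := he (i, -1)
    rw [hs, inner_add_left, inner_smul_left] at h1 h2
    simp only [Units.val_one, Units.val_neg, Int.cast_one, Int.cast_neg, map_one, map_neg] at h1 h2
    linear_combination (h1 + h2) / 2
  let f := Fintype.equivFin (T × ℤˣ)
  refine ⟨_, ⟨⟨fun i => parsevalSection s hspan (f.symm i), fun y e => ?_, fun i => (f.symm i).2,
    fun i y => ?_⟩⟩⟩
  · exact (Equiv.sum_comp f.symm fun t => inner ℂ ((parsevalSection s hspan t).1 y) e •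
      (parsevalSection s hspan t).1 y).trans (sum_parseval (hspan y).isStrictlyPositive e)
  · refine map_parseval (o := LinearMap.toContinuousLinearMap (p.ε y)) (p.ε_symm y)
      (d := fun t => t.2) (fun t => ?_) (f.symm i)
    rw [hs]
    change p.ε y _ = _
    rw [map_add, map_smul, p.ε_sq, smul_add, smul_smul, add_comm]
    congr 1
    rcases Int.units_eq_one_or t.2 with h | h <;> simp [h]

end HermBundle

/-! ### Hermitian presentations -/

namespace HermBundle

open Topology Filter

variable {G : Type z} {Y : Type v} [Group G] [TopologicalSpace G] [TopologicalSpace Y]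
  [MulAction G Y] {E F : HermBundle.{v, w, z} G Y}

/-- The function-valued Hermitian product of two invariant sections. -/
def innerFun (s t : E.sections) : C(Orb G Y, ℂ) where
  toFun := Quotient.lift (fun y => inner ℂ (s.1 y) (t.1 y)) (by
    rintro a b ⟨g, hg⟩
    have hg' : g • b = a := hg
    change inner ℂ (s.1 a) (t.1 a) = inner ℂ (s.1 b) (t.1 b)
    rw [← s.2.2 g hg', ← t.2.2 g hg', LinearIsometryEquiv.inner_map_map])
  continuous_toFun := continuous_quot_lift _ (continuous_inner_sections s t)

theorem innerFun_orb (s t : E.sections) (y : Y) :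
    innerFun s t (orb G y) = inner ℂ (s.1 y) (t.1 y) := rfl

theorem ext_orb {f g : C(Orb G Y, ℂ)} (h : ∀ y, f (orb G y) = g (orb G y)) : f = g :=
  ContinuousMap.ext fun x => Quotient.inductionOn x h

theorem sections_sum_apply {ι : Type*} (T : Finset ι) (s : ι → E.sections) (y : Y) :
    (∑ i ∈ T, s i).1 y = ∑ i ∈ T, (s i).1 y := by
  classical
  induction T using Finset.induction_on with
  | empty => rfl
  | insert a T ha ih => rw [Finset.sum_insert ha, Finset.sum_insert ha, ← ih]; rfl

namespace ParsevalFrame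

variable {B : Set Y} {p : Cocycle.{v, w, z} G Y B} {n : ℕ} (F : ParsevalFrame p n)

/-- The Gram matrix of a Parseval frame, which is a self-adjoint idempotent. -/
def gram : Matrix (Fin n) (Fin n) C(Orb G Y, ℂ) := Matrix.of fun i j => innerFun (F.s i) (F.s j)

theorem gram_mulVec_orb (x : Fin n → C(Orb G Y, ℂ)) (i : Fin n) (y : Y) :
    F.gram.mulVec x i (orb G y) =
      inner ℂ ((F.s i).1 y) (∑ j, x j (orb G y) • (F.s j).1 y) := by
  simp only [Matrix.mulVec, dotProduct, ContinuousMap.sum_apply, ContinuousMap.mul_apply, inner_sum,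
    inner_smul_right]
  refine Finset.sum_congr rfl fun j _ => mul_comm _ _

theorem gram_mulVec_coeff (t : p.E.sections) :
    F.gram.mulVec (fun j => innerFun (F.s j) t) = fun i => innerFun (F.s i) t := by
  funext i
  refine ext_orb fun y => ?_
  rw [gram_mulVec_orb]
  simp only [innerFun_orb]
  rw [F.sum_eq]

theorem gram_idem : IsIdempotentElem F.gram := by
  refine Matrix.ext_of_mulVec_single fun j => ?_
  rw [← Matrix.mulVec_mulVec, Matrix.mulVec_single_one]
  exact F.gram_mulVec_coeff (F.s j)

/-- The isomorphism of the sections with the range of the Gram matrix takes a section to its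
coefficients with respect to the frame. -/
def presentation : Presentation p.E where
  n := n
  A := F.gram
  idem := F.gram_idem
  ι :=
    { toFun := fun t => ⟨fun i => innerFun (F.s i) t, _, F.gram_mulVec_coeff t⟩
      map_add' := fun s t => Subtype.ext (funext fun i => ext_orb fun y => inner_add_right _ _ _)
      map_smul' := fun f t => Subtype.ext (funext fun i => ext_orb fun y => inner_smul_right _ _ _)
      invFun := fun x => ∑ j, x.1 j • F.s j
      left_inv := fun t => Subtype.ext (funext fun y => by
        rw [sections_sum_apply]
        exact F.sum_eq y (t.1 y))
      right_inv := by
        rintro ⟨_, x, rfl⟩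
        refine Subtype.ext (funext fun i => ext_orb fun y => ?_)
        change inner ℂ ((F.s i).1 y) ((∑ j, (F.gram.mulVec x) j • F.s j : p.E.sections).1 y) =
          F.gram.mulVec x i (orb G y)
        rw [sections_sum_apply]
        conv_rhs => rw [← F.gram_idem.eq, ← Matrix.mulVec_mulVec, gram_mulVec_orb]
        rfl }

theorem presentation_graded (t : p.E.sections) (i : Fin n) :
    (F.presentation.ι (p.ε_isEnd.onSections t)).1 i =
      ((F.d i : ℤ) : ℂ) • (F.presentation.ι t).1 i := by
  refine ext_orb fun y => ?_
  change inner ℂ ((F.s i).1 y) (p.ε y (t.1 y)) =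
    ((F.d i : ℤ) : ℂ) • (inner ℂ ((F.s i).1 y) (t.1 y) : ℂ)
  rw [← p.ε_symm, F.ε_eq, inner_smul_left]
  simp

theorem presentation_isHermitian : F.presentation.IsHermitian where
  selfAdjoint := by
    refine Matrix.ext fun i j => ext_orb fun y => ?_
    exact inner_conj_symm _ _
  isometry s t y := by
    conv_lhs => rw [← F.sum_eq y (t.1 y), inner_sum]
    refine Finset.sum_congr rfl fun i _ => ?_
    rw [inner_smul_right, mul_comm]
    congr 1
    exact (inner_conj_symm _ _).symm
  graded := ⟨F.d, F.presentation_graded⟩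

end ParsevalFrame

theorem exists_isHermitian [IsTopologicalGroup G] [CompactSpace G] [CompactSpace Y] [T2Space Y]
    [ContinuousSMul G Y] {B : Set Y} (p : Cocycle.{v, w, z} G Y B) :
    ∃ P : Presentation p.E, P.IsHermitian := by
  obtain ⟨n, ⟨F⟩⟩ := exists_parsevalFrame p
  exact ⟨F.presentation, F.presentation_isHermitian⟩

/-! ### Maps of sections -/

/-- A bijective endomorphism of a bundle is invertible on sections, because inversion of operators
is continuous. -/
theorem IsEnd.exists_inverse {L : ∀ x, E.fiber x →ₗ[ℂ] E.fiber x} (hL : E.IsEnd L)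
    (h : ∀ x, Function.Bijective (L x)) :
    ∃ M : E.sections →ₗ[C(Orb G Y, ℂ)] E.sections,
      M ∘ₗ hL.onSections = LinearMap.id ∧ hL.onSections ∘ₗ M = LinearMap.id := by
  let M : ∀ x, E.fiber x ≃ₗ[ℂ] E.fiber x := fun x => LinearEquiv.ofBijective (L x) (h x)
  have hLM : ∀ x e, L x ((M x).symm e) = e := fun x e => (M x).apply_symm_apply e
  have hML : ∀ x e, (M x).symm (L x e) = e := fun x e => (M x).symm_apply_apply e
  have hL' := (isEnd_iff (L := fun x => LinearMap.toContinuousLinearMap (L x))).mp hL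
  have hM : E.IsEnd fun x => (M x).symm.toLinearMap := by
    refine (isEnd_iff (L := fun x => LinearMap.toContinuousLinearMap (M x).symm.toLinearMap)).mpr
      ⟨fun x₀ => ?_, fun g x y hxy e => ?_⟩
    · intro x hx
      set S := fun x => E.tr x₀ x ∘L LinearMap.toContinuousLinearMap (L x) ∘L E.trInv x₀ x with hS
      set R := fun x => E.tr x₀ x ∘L LinearMap.toContinuousLinearMap (M x).symm.toLinearMap ∘L
        E.trInv x₀ x with hR
      have h1 : ∀ x ∈ E.U x₀, S x * R x = 1 := fun x hx => by
        ext e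
        change E.tr x₀ x (L x (E.trInv x₀ x (E.tr x₀ x ((M x).symm (E.trInv x₀ x e))))) = e
        rw [trInv_tr hx, hLM, tr_trInv hx]
      have h2 : ∀ x ∈ E.U x₀, R x * S x = 1 := fun x hx => by
        ext e
        change E.tr x₀ x ((M x).symm (E.trInv x₀ x (E.tr x₀ x (L x (E.trInv x₀ x e))))) = e
        rw [trInv_tr hx, hML, tr_trInv hx]
      have h3 : ∀ x ∈ E.U x₀, Ring.inverse (S x) = R x := fun x hx =>
        Ring.inverse_unit ⟨S x, R x, h1 x hx, h2 x hx⟩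
      have h4 : ContinuousWithinAt (fun x => Ring.inverse (S x)) (E.U x₀) x :=
        ContinuousAt.comp_continuousWithinAt (f := S) (g := Ring.inverse)
          (NormedRing.inverse_continuousAt ⟨S x, R x, h1 x hx, h2 x hx⟩) (hL'.1 x₀ x hx)
      exact h4.congr (fun y hy => (h3 y hy).symm) (h3 x hx).symm
    · change E.act g hxy ((M x).symm e) = (M y).symm (E.act g hxy e)
      refine (h y).1 ?_
      rw [hLM, ← hL.equivariant, hLM]
  exact ⟨hM.onSections, LinearMap.ext fun s => Subtype.ext (funext fun x => hML x _),
    LinearMap.ext fun s => Subtype.ext (funext fun x => hLM x _)⟩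

theorem IsIso.continuousOn {V : ∀ x, E.fiber x ≃ₗᵢ[ℂ] F.fiber x} (hV : IsIso E F V) (x₀ : Y) :
    ContinuousOn (fun x => F.tr x₀ x ∘L
      (V x).toContinuousLinearEquiv.toContinuousLinearMap ∘L E.trInv x₀ x) (E.U x₀ ∩ F.U x₀) := by
  rw [continuousOn_clm_apply]
  intro e
  rw [continuousOn_iff_continuous_domRestrict]
  refine (hV.continuous x₀ e).congr fun x => ?_
  change _ = F.tr x₀ x.1 (V x.1 (E.trInv x₀ x.1 e))
  rw [trInv_apply x.2.1, tr_apply x.2.2]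

theorem IsIso.symm {V : ∀ x, E.fiber x ≃ₗᵢ[ℂ] F.fiber x} (hV : IsIso E F V) :
    IsIso F E fun x => (V x).symm where
  continuous x₀ e := by
    have h1 := (ContinuousLinearMap.adjoint (𝕜 := ℂ) (E := E.fiber x₀)
      (F := F.fiber x₀)).continuous.comp_continuousOn (hV.continuousOn x₀)
    have h2 := continuousOn_clm_apply.mp h1 e
    rw [continuousOn_iff_continuous_domRestrict] at h2
    refine (h2.comp (Continuous.subtype_mk continuous_subtype_val
      (fun x : {x // x ∈ F.U x₀ ∧ x ∈ E.U x₀} => ⟨x.2.2, x.2.1⟩))).congr fun x => ?_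
    refine ext_inner_right ℂ fun e' => ?_
    refine (ContinuousLinearMap.adjoint_inner_left _ _ _).trans ?_
    change inner ℂ e (F.tr x₀ x.1 (V x.1 (E.trInv x₀ x.1 e'))) = _
    rw [trInv_apply x.2.2, tr_apply x.2.1]
    have h3 := (F.triv x₀ x.1 x.2.1).inner_map_map ((F.triv x₀ x.1 x.2.1).symm e)
      (V x.1 ((E.triv x₀ x.1 x.2.2).symm e'))
    rw [LinearIsometryEquiv.apply_symm_apply] at h3
    rw [h3]
    have h4 := (V x.1).inner_map_map ((V x.1).symm ((F.triv x₀ x.1 x.2.1).symm e))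
      ((E.triv x₀ x.1 x.2.2).symm e')
    rw [LinearIsometryEquiv.apply_symm_apply] at h4
    rw [h4, ← (E.triv x₀ x.1 x.2.2).inner_map_map, LinearIsometryEquiv.apply_symm_apply]
  equivariant g x y h e := by
    apply (V y).injective
    rw [← hV.equivariant, LinearIsometryEquiv.apply_symm_apply,
      LinearIsometryEquiv.apply_symm_apply]

/-- The map of sections induced by an isomorphism of bundles. -/
def IsIso.onSections {V : ∀ x, E.fiber x ≃ₗᵢ[ℂ] F.fiber x} (hV : IsIso E F V) :
    E.sections →ₗ[C(Orb G Y, ℂ)] F.sections where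
  toFun s := mkSection (fun x => V x (s.1 x))
    (fun x => by
      have hU : E.U x ∩ F.U x ∈ 𝓝 x :=
        ((E.isOpen_U x).inter (F.isOpen_U x)).mem_nhds ⟨E.mem_U x, F.mem_U x⟩
      refine (((hV.continuousOn x).continuousAt hU).clm_apply (continuousAt_tr s x)).congr ?_
      filter_upwards [hU] with y hy
      change F.tr x y (V y (E.trInv x y (E.tr x y (s.1 y)))) = _
      rw [trInv_tr hy.1])
    (fun g x y h => by rw [hV.equivariant, s.2.2])
  map_add' s t := Subtype.ext (funext fun x => map_add (V x) (s.1 x) (t.1 x))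
  map_smul' f s := Subtype.ext (funext fun x => map_smul (V x) (f (orb G x)) (s.1 x))

/-- Pairs of sections are the sections of the direct sum. -/
def pairSections (E F : HermBundle.{v, w, z} G Y) :
    (E.sections × F.sections) ≃ₗ[C(Orb G Y, ℂ)] (E.directSum F).sections where
  toFun q := ⟨fun x => WithLp.toLp 2 (q.1.1 x, q.2.1 x), fun x₀ => by
      have h1 := (q.1.2.1 x₀).comp (Continuous.subtype_mk continuous_subtype_val
        (fun x : {x // x ∈ E.U x₀ ∩ F.U x₀} => x.2.1))
      have h2 := (q.2.2.1 x₀).comp (Continuous.subtype_mk continuous_subtype_val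
        (fun x : {x // x ∈ E.U x₀ ∩ F.U x₀} => x.2.2))
      exact (WithLp.prodContinuousLinearEquiv 2 ℂ _ _).symm.continuous.comp (h1.prodMk h2),
    fun g x y h => withLp_ext (q.1.2.2 g h) (q.2.2.2 g h)⟩
  map_add' _ _ := rfl
  map_smul' _ _ := rfl
  invFun s :=
    (mkSection (fun x => (show WithLp 2 (E.fiber x × F.fiber x) from s.1 x).fst)
      (fun x => by
        have h := continuousAt_tr s x
        have hc : Continuous fun e : WithLp 2 (E.fiber x × F.fiber x) => e.fst := by fun_prop
        refine (hc.continuousAt.comp h).congr ?_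
        filter_upwards [(E.isOpen_U x).mem_nhds (E.mem_U x),
          (F.isOpen_U x).mem_nhds (F.mem_U x)] with y h1 h2
        rw [tr_apply h1]
        have h3 := tr_apply (E := E.directSum F) (x₀ := x) (x := y) ⟨h1, h2⟩ (s.1 y)
        exact congrArg (fun e : WithLp 2 (E.fiber x × F.fiber x) => e.fst) h3)
      (fun g x y h => congrArg (fun e : WithLp 2 (E.fiber y × F.fiber y) => e.fst) (s.2.2 g h)),
    mkSection (fun x => (show WithLp 2 (E.fiber x × F.fiber x) from s.1 x).snd)
      (fun x => by
        have h := continuousAt_tr s x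
        have hc : Continuous fun e : WithLp 2 (E.fiber x × F.fiber x) => e.snd := by fun_prop
        refine (hc.continuousAt.comp h).congr ?_
        filter_upwards [(E.isOpen_U x).mem_nhds (E.mem_U x),
          (F.isOpen_U x).mem_nhds (F.mem_U x)] with y h1 h2
        rw [tr_apply h2]
        have h3 := tr_apply (E := E.directSum F) (x₀ := x) (x := y) ⟨h1, h2⟩ (s.1 y)
        exact congrArg (fun e : WithLp 2 (E.fiber x × F.fiber x) => e.snd) h3)
      (fun g x y h => congrArg (fun e : WithLp 2 (E.fiber y × F.fiber y) => e.snd) (s.2.2 g h)))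
  left_inv _ := rfl
  right_inv _ := rfl

end HermBundle

/-! ### Independence of the presentation -/

section Independence

variable {G : Type z} {Y : Type v} [Group G] [TopologicalSpace G] [TopologicalSpace Y]
  [MulAction G Y] {B : Set Y} {D : KData.{u} (Orb G Y)} (hD : D.IsKasparov)
  {p q : Cocycle.{v, w, z} G Y B} {P : Presentation p.E} {P' : Presentation q.E}

/-- The class of `T ⊗' 1` depends only on the graded range of the idempotent, up to an isomorphism
given by a matrix `M` of functions, because `M` commutes with `T` up to compact operators. -/
theorem mk_capBase_eq_of_matrix (hP : P.IsHermitian) (hP' : P'.IsHermitian)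
    (M : Matrix (Fin P'.n) (Fin P.n) C(Orb G Y, ℂ)) (h1 : P'.A * M = M) (h2 : M * P.A = M)
    (hb : Function.Bijective (D.imMap P.A P'.A M))
    (hε : P'.mat P' q.ε_isEnd.onSections * M = M * P.mat P p.ε_isEnd.onSections) :
    KHomology.mk (capBase hD hP) = KHomology.mk (capBase hD hP') := by
  have := P.completeSpace_im D
  have := P'.completeSpace_im D
  let U : D.im P.A ≃L[ℂ] D.im P'.A := ContinuousLinearEquiv.ofBijective (D.imMap P.A P'.A M)
    (LinearMap.ker_eq_bot.mpr hb.1) (LinearMap.range_eq_top.mpr hb.2)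
  refine KHomology.mk_eq_of_equiv (D := capBase hD hP) (D' := capBase hD hP') U ?_ ?_ ?_
  · have key : ∀ v : D.im P.A, D.imMap P.A P'.A M
        ((D.ampl P.A D.ε * P.op P D p.ε_isEnd.onSections) v) =
        (D.ampl P'.A D.ε * P'.op P' D q.ε_isEnd.onSections) (D.imMap P.A P'.A M v) := by
      intro v
      rw [mul_apply_eq_comp, mul_apply_eq_comp,
        D.imMap_ampl_of_commutes P.idem P'.idem hD.commutesAction_ε h1, Presentation.op,
        Presentation.op, D.imMap_imMap (P.mul_mat P _) h1, D.imMap_imMap h1 (P'.mul_mat P' _), hε]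
    rw [← capData_ε hD P, ← capData_ε hD P'] at key
    exact key
  · intro f v
    exact D.imMap_ampl_of_commutes P.idem P'.idem (D.commutesAction_φ f) h1 v
  · refine (congrArg IsCompactOperator (funext fun v => ?_)).mp
      (D.isCompactOperator_imMap_ampl P.idem P'.idem hD.compact_commutator h1 h2)
    rfl

variable (P P' D) in
/-- The isomorphism `1 ⊗ L` for an isomorphism `L` of section modules. -/
def Presentation.opEquiv (L : p.E.sections ≃ₗ[C(Orb G Y, ℂ)] q.E.sections) :
    D.im P.A ≃L[ℂ] D.im P'.A :=
  ContinuousLinearEquiv.equivOfInverse (P.op P' D L.toLinearMap) (P'.op P D L.symm.toLinearMap)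
    (fun v => by rw [P.op_op P' P, LinearEquiv.symm_comp, P.op_id])
    (fun v => by rw [P'.op_op P P', LinearEquiv.comp_symm, P'.op_id])

theorem mk_capBase_eq_of_equiv (hP : P.IsHermitian) (hP' : P'.IsHermitian)
    (L : p.E.sections ≃ₗ[C(Orb G Y, ℂ)] q.E.sections)
    (hL : ∀ s, L (p.ε_isEnd.onSections s) = q.ε_isEnd.onSections (L s)) :
    KHomology.mk (capBase hD hP) = KHomology.mk (capBase hD hP') := by
  refine mk_capBase_eq_of_matrix hD hP hP' (P.mat P' L.toLinearMap) (P.mul_mat P' _)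
    (P.mat_mul P' _) (P.opEquiv D P' L).bijective ?_
  rw [Presentation.mat_mul_mat, Presentation.mat_mul_mat]
  congr 1
  exact LinearMap.ext fun s => (hL s).symm

theorem Represents.of_equiv {X : Type v} [TopologicalSpace X] {K K' : KData.{u} X}
    {c : KHomology.{u} X} (h : Represents K c) (W : K'.H ≃L[ℂ] K.H)
    (hε : ∀ x, W (K'.ε x) = K.ε (W x)) (hφ : ∀ f x, W (K'.φ f x) = K.φ f (W x))
    (hT : IsCompactOperator fun x => W (K'.T x) - K.T (W x)) : Represents K' c := by
  obtain ⟨N, U, hc, h1, h2, h3⟩ := h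
  refine ⟨N, W.trans U, hc, fun x => ?_, fun f x => ?_, ?_⟩
  · exact (congrArg U (hε x)).trans (h1 _)
  · exact (congrArg U (hφ f x)).trans (h2 f _)
  · have h4 := (hT.clm_comp U.toContinuousLinearMap).add (h3.comp_clm W.toContinuousLinearMap)
    refine (congrArg IsCompactOperator (funext fun x => ?_)).mp h4
    change U (W (K'.T x) - K.T (W x)) + (U (K.T (W x)) - N.1.T (U (W x))) =
      U (W (K'.T x)) - N.1.T (U (W x))
    rw [map_sub]
    abel

theorem Represents.eq_mk {X : Type v} [TopologicalSpace X] {K : KModule.{u} X}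
    {c : KHomology.{u} X} (h : Represents K.1 c) : c = KHomology.mk K := by
  obtain ⟨N, U, hc, h1, h2, h3⟩ := h
  rw [← hc]
  exact (KHomology.mk_eq_of_equiv U h1 h2 h3).symm

theorem represents_mk {X : Type v} [TopologicalSpace X] (K : KModule.{u} X) :
    Represents K.1 (KHomology.mk K) :=
  ⟨K, ContinuousLinearEquiv.refl ℂ _, rfl, fun _ => rfl, fun _ _ => rfl, by
    refine (congrArg IsCompactOperator (funext fun x => ?_)).mp (isCompactOperator_zero
      (M₁ := K.1.H) (M₂ := K.1.H))
    exact (sub_self _).symm⟩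

include hD in
/-- What `H ⊗ C(E)` represents does not depend on the presentation. -/
theorem Represents.of_presentation (P₁ P₂ : Presentation p.E) {c : KHomology.{u} (Orb G Y)}
    (h : Represents (capData ⟨D, hD⟩ p P₂) c) : Represents (capData ⟨D, hD⟩ p P₁) c := by
  refine h.of_equiv (P₁.opEquiv D P₂ (LinearEquiv.refl _ _)) ?_ ?_ ?_
  · have key : ∀ v : D.im P₁.A, P₁.op P₂ D LinearMap.id
        ((D.ampl P₁.A D.ε * P₁.op P₁ D p.ε_isEnd.onSections) v) =
        (D.ampl P₂.A D.ε * P₂.op P₂ D p.ε_isEnd.onSections) (P₁.op P₂ D LinearMap.id v) := by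
      intro v
      rw [mul_apply_eq_comp, mul_apply_eq_comp, P₁.op_ampl P₂ D hD.commutesAction_ε, P₁.op_op P₁ P₂,
        P₁.op_op P₂ P₂]
      rfl
    rw [← capData_ε hD P₁, ← capData_ε hD P₂] at key
    exact key
  · intro f v
    exact P₁.op_ampl P₂ D (D.commutesAction_φ f) LinearMap.id v
  · have key : ∀ v : D.im P₁.A, P₁.op P₂ D LinearMap.id
        ((D.ampl P₁.A D.T - D.ampl P₁.A D.ε * P₁.op P₁ D p.α_isEnd.onSections) v) -
        (D.ampl P₂.A D.T - D.ampl P₂.A D.ε * P₂.op P₂ D p.α_isEnd.onSections)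
          (P₁.op P₂ D LinearMap.id v) =
        (P₁.op P₂ D LinearMap.id ∘L D.ampl P₁.A D.T -
          D.ampl P₂.A D.T ∘L P₁.op P₂ D LinearMap.id) v := by
      intro v
      have h1 : P₁.op P₂ D LinearMap.id
          ((D.ampl P₁.A D.ε * P₁.op P₁ D p.α_isEnd.onSections) v) =
          (D.ampl P₂.A D.ε * P₂.op P₂ D p.α_isEnd.onSections) (P₁.op P₂ D LinearMap.id v) := by
        rw [mul_apply_eq_comp, mul_apply_eq_comp, P₁.op_ampl P₂ D hD.commutesAction_ε,
          P₁.op_op P₁ P₂, P₁.op_op P₂ P₂]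
        rfl
      rw [sub_apply, sub_apply, map_sub, h1]
      exact sub_sub_sub_cancel_right _ _ _
    have h2 := P₁.isCompactOperator_op_ampl P₂ D hD.compact_commutator LinearMap.id
    have h3 := (congrArg IsCompactOperator (funext fun v => (key v).symm)).mp h2
    rw [← capData_T hD P₁, ← capData_T hD P₂] at h3
    exact h3

end Independence

/-! ### Functoriality in the Kasparov module -/

namespace KData

variable {X : Type v} [TopologicalSpace X] {D D' : KData.{u} X} {n : ℕ}

/-- The map `H^n → H'^n` given by a map on every component. -/
def powMap (W : D.H →L[ℂ] D'.H) : D.Pow n →L[ℂ] D'.Pow n :=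
  (PiLp.continuousLinearEquiv 2 ℂ (fun _ : Fin n => D'.H)).symm.toContinuousLinearMap ∘L
    (ContinuousLinearMap.pi fun i => W ∘L ContinuousLinearMap.proj i) ∘L
    (PiLp.continuousLinearEquiv 2 ℂ (fun _ : Fin n => D.H)).toContinuousLinearMap

theorem powMap_apply (W : D.H →L[ℂ] D'.H) (v : D.Pow n) (i : Fin n) :
    powMap W v i = W (v i) := by
  simp [powMap]

theorem powMap_rectOp {m : ℕ} {W : D.H →L[ℂ] D'.H} (hW : ∀ f x, W (D.φ f x) = D'.φ f (W x))
    (M : Matrix (Fin m) (Fin n) C(X, ℂ)) (v : D.Pow n) :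
    powMap W (D.rectOp M v) = D'.rectOp M (powMap W v) := by
  ext i
  simp only [powMap_apply, rectOp_apply, map_sum, hW]

/-- The map `W ⊗ 1` on the range of an idempotent. -/
def imPow {W : D.H →L[ℂ] D'.H} (hW : ∀ f x, W (D.φ f x) = D'.φ f (W x))
    (A : Matrix (Fin n) (Fin n) C(X, ℂ)) : D.im A →L[ℂ] D'.im A :=
  (powMap W ∘L (D.im A).subtypeL).codRestrict (D'.im A) (by
    rintro ⟨_, v, rfl⟩
    exact ⟨powMap W v, (powMap_rectOp hW A v).symm⟩)

theorem coe_imPow {W : D.H →L[ℂ] D'.H} (hW : ∀ f x, W (D.φ f x) = D'.φ f (W x))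
    (A : Matrix (Fin n) (Fin n) C(X, ℂ)) (v : D.im A) :
    (imPow hW A v : D'.Pow n) = powMap W (v : D.Pow n) := rfl

theorem imPow_ampl {W : D.H →L[ℂ] D'.H} (hW : ∀ f x, W (D.φ f x) = D'.φ f (W x))
    (A : Matrix (Fin n) (Fin n) C(X, ℂ)) {S : D.H →L[ℂ] D.H} {S' : D'.H →L[ℂ] D'.H}
    (hS : ∀ x, W (S x) = S' (W x)) (v : D.im A) :
    imPow hW A (D.ampl A S v) = D'.ampl A S' (imPow hW A v) := by
  apply Subtype.ext
  rw [coe_imPow, coe_ampl, coe_ampl, powMap_rectOp hW]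
  congr 1
  ext i
  simp only [powMap_apply, diagOp_apply, hS, coe_imPow]

theorem imPow_imMap {m : ℕ} {W : D.H →L[ℂ] D'.H} (hW : ∀ f x, W (D.φ f x) = D'.φ f (W x))
    {A : Matrix (Fin n) (Fin n) C(X, ℂ)} {A' : Matrix (Fin m) (Fin m) C(X, ℂ)}
    (M : Matrix (Fin m) (Fin n) C(X, ℂ)) (v : D.im A) :
    imPow hW A' (D.imMap A A' M v) = D'.imMap A A' M (imPow hW A v) := by
  apply Subtype.ext
  rw [coe_imPow, coe_imMap, coe_imMap, matOp_eq_rectOp, powMap_rectOp hW, powMap_rectOp hW]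
  rfl

end KData

section ModuleVariable

variable {G : Type z} {Y : Type v} [Group G] [TopologicalSpace G] [TopologicalSpace Y]
  [MulAction G Y] {B : Set Y} {D D' : KData.{u} (Orb G Y)} (hD : D.IsKasparov)
  (hD' : D'.IsKasparov) {p : Cocycle.{v, w, z} G Y B} {P : Presentation p.E}

/-- A map of modules of degree `0` induces a map of degree `0`. -/
theorem imPow_capData_ε {W : D.H →L[ℂ] D'.H} (hW : ∀ f x, W (D.φ f x) = D'.φ f (W x))
    (hε : ∀ x, W (D.ε x) = D'.ε (W x)) (v : D.im P.A) :
    KData.imPow hW P.A ((capData ⟨D, hD⟩ p P).ε v) =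
      (capData ⟨D', hD'⟩ p P).ε (KData.imPow hW P.A v) := by
  have key : KData.imPow hW P.A ((D.ampl P.A D.ε * P.op P D p.ε_isEnd.onSections) v) =
      (D'.ampl P.A D'.ε * P.op P D' p.ε_isEnd.onSections) (KData.imPow hW P.A v) := by
    rw [mul_apply_eq_comp, mul_apply_eq_comp, KData.imPow_ampl hW P.A hε]
    congr 1
    exact KData.imPow_imMap hW _ v
  rw [← capData_ε hD P, ← capData_ε hD' P] at key
  exact key

theorem mk_capBase_eq_of_unitaryEquiv (hP : P.IsHermitian)
    (h : KModule.UnitaryEquiv ⟨D, hD⟩ ⟨D', hD'⟩) :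
    KHomology.mk (capBase hD hP) = KHomology.mk (capBase hD' hP) := by
  obtain ⟨U, hε, hφ, hT⟩ := h
  dsimp only at U hε hφ hT
  let W : D.H →L[ℂ] D'.H := U.toContinuousLinearEquiv.toContinuousLinearMap
  let W' : D'.H →L[ℂ] D.H := U.symm.toContinuousLinearEquiv.toContinuousLinearMap
  have hW : ∀ f x, W (D.φ f x) = D'.φ f (W x) := hφ
  have hW' : ∀ f x, W' (D'.φ f x) = D.φ f (W' x) := fun f x => by
    apply U.injective
    change U (U.symm _) = U (D.φ f (U.symm x))
    rw [hφ, U.apply_symm_apply, U.apply_symm_apply]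
  let V : D.im P.A ≃L[ℂ] D'.im P.A := ContinuousLinearEquiv.equivOfInverse
    (KData.imPow hW P.A) (KData.imPow hW' P.A)
    (fun v => by
      apply Subtype.ext
      ext i
      rw [KData.coe_imPow, KData.powMap_apply, KData.coe_imPow, KData.powMap_apply]
      exact U.symm_apply_apply _)
    (fun v => by
      apply Subtype.ext
      ext i
      rw [KData.coe_imPow, KData.powMap_apply, KData.coe_imPow, KData.powMap_apply]
      exact U.apply_symm_apply _)
  refine KHomology.mk_eq_of_equiv (D := capBase hD hP) (D' := capBase hD' hP) V ?_ ?_ ?_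
  · exact fun v => imPow_capData_ε hD hD' hW hε v
  · exact fun f v => KData.imPow_ampl hW P.A (hφ f) v
  · refine (congrArg IsCompactOperator (funext fun v => ?_)).mp (isCompactOperator_zero
      (M₁ := D.im P.A) (M₂ := D'.im P.A))
    exact (sub_eq_zero.mpr (KData.imPow_ampl hW P.A hT v)).symm

theorem mk_capBase_directSum (hP : P.IsHermitian) :
    KHomology.mk (capBase (hD.directSum hD') hP) =
      KHomology.mk (capBase hD hP) + KHomology.mk (capBase hD' hP) := by
  have := P.completeSpace_im D
  have := P.completeSpace_im D'
  let i₁ : D.H →L[ℂ] (D.directSum D').H :=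
    (WithLp.prodContinuousLinearEquiv 2 ℂ D.H D'.H).symm.toContinuousLinearMap ∘L
      ContinuousLinearMap.inl ℂ D.H D'.H
  let i₂ : D'.H →L[ℂ] (D.directSum D').H :=
    (WithLp.prodContinuousLinearEquiv 2 ℂ D.H D'.H).symm.toContinuousLinearMap ∘L
      ContinuousLinearMap.inr ℂ D.H D'.H
  let p₁ : (D.directSum D').H →L[ℂ] D.H := ContinuousLinearMap.fst ℂ D.H D'.H ∘L
    (WithLp.prodContinuousLinearEquiv 2 ℂ D.H D'.H).toContinuousLinearMap
  let p₂ : (D.directSum D').H →L[ℂ] D'.H := ContinuousLinearMap.snd ℂ D.H D'.H ∘L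
    (WithLp.prodContinuousLinearEquiv 2 ℂ D.H D'.H).toContinuousLinearMap
  have hi₁ : ∀ f x, i₁ (D.φ f x) = (D.directSum D').φ f (i₁ x) := fun f x =>
    withLp_ext rfl (map_zero (D'.φ f)).symm
  have hi₂ : ∀ f x, i₂ (D'.φ f x) = (D.directSum D').φ f (i₂ x) := fun f x =>
    withLp_ext (map_zero (D.φ f)).symm rfl
  have hp₁ : ∀ f x, p₁ ((D.directSum D').φ f x) = D.φ f (p₁ x) := fun f x => rfl
  have hp₂ : ∀ f x, p₂ ((D.directSum D').φ f x) = D'.φ f (p₂ x) := fun f x => rfl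
  let V : (D.directSum D').im P.A ≃L[ℂ] WithLp 2 (D.im P.A × D'.im P.A) :=
    ContinuousLinearEquiv.equivOfInverse
      ((WithLp.prodContinuousLinearEquiv 2 ℂ (D.im P.A) (D'.im P.A)).symm.toContinuousLinearMap ∘L
        (KData.imPow hp₁ P.A).prod (KData.imPow hp₂ P.A))
      ((KData.imPow hi₁ P.A).coprod (KData.imPow hi₂ P.A) ∘L
        (WithLp.prodContinuousLinearEquiv 2 ℂ (D.im P.A) (D'.im P.A)).toContinuousLinearMap)
      (fun v => by
        apply Subtype.ext
        ext j
        change (KData.powMap i₁ (KData.powMap p₁ (v : (D.directSum D').Pow P.n)) +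
          KData.powMap i₂ (KData.powMap p₂ (v : (D.directSum D').Pow P.n))) j = _
        rw [PiLp.add_apply, KData.powMap_apply, KData.powMap_apply, KData.powMap_apply,
          KData.powMap_apply]
        exact withLp_ext (add_zero _) (zero_add _))
      (fun v => by
        refine withLp_ext (Subtype.ext ?_) (Subtype.ext ?_)
        · ext j
          change KData.powMap p₁ (KData.powMap i₁ (v.fst : D.Pow P.n) +
            KData.powMap i₂ (v.snd : D'.Pow P.n)) j = _
          rw [KData.powMap_apply, PiLp.add_apply, KData.powMap_apply, KData.powMap_apply]
          exact add_zero _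
        · ext j
          change KData.powMap p₂ (KData.powMap i₁ (v.fst : D.Pow P.n) +
            KData.powMap i₂ (v.snd : D'.Pow P.n)) j = _
          rw [KData.powMap_apply, PiLp.add_apply, KData.powMap_apply, KData.powMap_apply]
          exact zero_add _)
  rw [← KHomology.mk_add]
  refine KHomology.mk_eq_of_equiv (D := capBase (hD.directSum hD') hP)
    (D' := capBase hD hP + capBase hD' hP) V ?_ ?_ ?_
  · intro v
    exact withLp_ext
      (imPow_capData_ε (hD.directSum hD') hD hp₁ (fun _ => rfl) v)
      (imPow_capData_ε (hD.directSum hD') hD' hp₂ (fun _ => rfl) v)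
  · intro f v
    exact withLp_ext (KData.imPow_ampl hp₁ P.A (hp₁ f) v) (KData.imPow_ampl hp₂ P.A (hp₂ f) v)
  · refine (congrArg IsCompactOperator (funext fun v => ?_)).mp (isCompactOperator_zero
      (M₁ := (D.directSum D').im P.A) (M₂ := WithLp 2 (D.im P.A × D'.im P.A)))
    refine (sub_eq_zero.mpr ?_).symm
    exact withLp_ext (KData.imPow_ampl hp₁ P.A (S := (D.directSum D').T) (S' := D.T)
      (fun _ => rfl) v) (KData.imPow_ampl hp₂ P.A (S := (D.directSum D').T) (S' := D'.T)
      (fun _ => rfl) v)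

theorem mk_capBase_eq_of_homotopy (hP : P.IsHermitian) (S : unitInterval → (D.H →L[ℂ] D.H))
    (hS : Continuous S) (h : ∀ t, (D.withOp (S t)).IsKasparov) :
    KHomology.mk (capBase (h 0) hP) = KHomology.mk (capBase (h 1) hP) :=
  KHomology.mk_eq_of_homotopy (D := (capBase (h 0) hP).1) (fun t => D.ampl P.A (S t))
    (D.continuous_ampl.comp hS) (fun t => (capBase (h t) hP).2) rfl rfl _ _

theorem mk_capBase_eq_zero_of_isDegenerate (hP : P.IsHermitian)
    (h : KModule.IsDegenerate ⟨D, hD⟩) : KHomology.mk (capBase hD hP) = 0 := by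
  obtain ⟨⟨u, hu⟩, hc⟩ := h
  have hc' : D.CommutesAction u := fun f => by
    have := hc f
    rwa [← hu] at this
  have hci : D.CommutesAction (↑u⁻¹ : D.H →L[ℂ] D.H) := fun f =>
    ((Commute.units_inv_left (hc' f : Commute _ _)) :)
  refine KHomology.mk_eq_zero_of_isDegenerate (D := capBase hD hP) ⟨?_, fun f => ?_⟩
  · have h1 : IsUnit (D.ampl P.A u) := by
      refine ⟨⟨D.ampl P.A u, D.ampl P.A (↑u⁻¹ : D.H →L[ℂ] D.H), ?_, ?_⟩, rfl⟩
      · rw [← D.ampl_mul_of_commutes_left P.idem hc', Units.mul_inv, D.ampl_one P.idem]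
      · rw [← D.ampl_mul_of_commutes_left P.idem hci, Units.inv_mul, D.ampl_one P.idem]
    have hu' : (u : D.H →L[ℂ] D.H) = D.T := hu
    rw [hu'] at h1
    exact h1
  · have h1 : D.ampl P.A D.T * D.ampl P.A (D.φ f) = D.ampl P.A (D.φ f) * D.ampl P.A D.T := by
      rw [ampl_mul_ampl_φ, ampl_φ_mul_ampl, hc f]
    exact h1

end ModuleVariable

/-! ### Functoriality in the bundle -/

section BundleVariable

variable {G : Type z} {Y : Type v} [Group G] [TopologicalSpace G] [TopologicalSpace Y]
  [MulAction G Y] {B : Set Y} {D : KData.{u} (Orb G Y)} (hD : D.IsKasparov)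
  {p q : Cocycle.{v, w, z} G Y B}

theorem mk_capBase_eq_of_iso {P : Presentation p.E} {P' : Presentation q.E} (hP : P.IsHermitian)
    (hP' : P'.IsHermitian) (h : Cocycle.Iso p q) :
    KHomology.mk (capBase hD hP) = KHomology.mk (capBase hD hP') := by
  obtain ⟨V, hV, hε, -⟩ := h
  refine mk_capBase_eq_of_equiv hD hP hP' (LinearEquiv.ofLinearMap hV.onSections hV.symm.onSections
    ?_ ?_) fun s => Subtype.ext (funext fun x => hε x _)
  · exact LinearMap.ext fun s => Subtype.ext (funext fun x => (V x).apply_symm_apply _)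
  · exact LinearMap.ext fun s => Subtype.ext (funext fun x => (V x).symm_apply_apply _)

theorem mk_capBase_eq_zero_of_bijective {P : Presentation p.E} (hP : P.IsHermitian)
    (h : p.IsDegenerate) : KHomology.mk (capBase hD hP) = 0 := by
  rw [← mk_capData hD hP]
  exact mk_capData_eq_zero hD hP (p.α_isEnd.exists_inverse h)

/-- A homomorphism of section modules of degree `0` induces a map of degree `0`. -/
theorem op_capData_ε (P : Presentation p.E) (P' : Presentation q.E)
    (L : p.E.sections →ₗ[C(Orb G Y, ℂ)] q.E.sections)
    (hL : L ∘ₗ p.ε_isEnd.onSections = q.ε_isEnd.onSections ∘ₗ L) (v : D.im P.A) :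
    P.op P' D L ((capData ⟨D, hD⟩ p P).ε v) = (capData ⟨D, hD⟩ q P').ε (P.op P' D L v) := by
  have key : P.op P' D L ((D.ampl P.A D.ε * P.op P D p.ε_isEnd.onSections) v) =
      (D.ampl P'.A D.ε * P'.op P' D q.ε_isEnd.onSections) (P.op P' D L v) := by
    rw [mul_apply_eq_comp, mul_apply_eq_comp, P.op_ampl P' D hD.commutesAction_ε, P.op_op P P',
      P.op_op P' P', hL]
  rw [← capData_ε hD P, ← capData_ε hD P'] at key
  exact key

theorem isCompactOperator_toLp {E F F' : Type*} [NormedAddCommGroup E] [NormedSpace ℂ E]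
    [NormedAddCommGroup F] [NormedSpace ℂ F] [NormedAddCommGroup F'] [NormedSpace ℂ F']
    {f : E → F} {g : E → F'} (hf : IsCompactOperator f) (hg : IsCompactOperator g) :
    IsCompactOperator fun x => WithLp.toLp 2 (f x, g x) := by
  have h := (hf.clm_comp ((WithLp.prodContinuousLinearEquiv 2 ℂ F F').symm.toContinuousLinearMap ∘L
      ContinuousLinearMap.inl ℂ F F')).add
    (hg.clm_comp ((WithLp.prodContinuousLinearEquiv 2 ℂ F F').symm.toContinuousLinearMap ∘L
      ContinuousLinearMap.inr ℂ F F'))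
  refine (congrArg IsCompactOperator (funext fun x => ?_)).mp h
  apply (WithLp.equiv 2 (F × F')).injective
  exact Prod.ext (add_zero _) (zero_add _)

theorem mk_capBase_add {P : Presentation (p + q).E} {P₁ : Presentation p.E}
    {P₂ : Presentation q.E} (hP : P.IsHermitian) (hP₁ : P₁.IsHermitian) (hP₂ : P₂.IsHermitian) :
    KHomology.mk (capBase hD hP) =
      KHomology.mk (capBase hD hP₁) + KHomology.mk (capBase hD hP₂) := by
  let L : (p.E.sections × q.E.sections) ≃ₗ[C(Orb G Y, ℂ)] (p + q).E.sections :=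
    HermBundle.pairSections p.E q.E
  let p₁ : (p + q).E.sections →ₗ[C(Orb G Y, ℂ)] p.E.sections :=
    LinearMap.fst _ _ _ ∘ₗ L.symm.toLinearMap
  let p₂ : (p + q).E.sections →ₗ[C(Orb G Y, ℂ)] q.E.sections :=
    LinearMap.snd _ _ _ ∘ₗ L.symm.toLinearMap
  let i₁ : p.E.sections →ₗ[C(Orb G Y, ℂ)] (p + q).E.sections := L.toLinearMap ∘ₗ LinearMap.inl _ _ _
  let i₂ : q.E.sections →ₗ[C(Orb G Y, ℂ)] (p + q).E.sections := L.toLinearMap ∘ₗ LinearMap.inr _ _ _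
  have h11 : p₁ ∘ₗ i₁ = LinearMap.id := LinearMap.ext fun _ => rfl
  have h12 : p₁ ∘ₗ i₂ = 0 := LinearMap.ext fun _ => rfl
  have h21 : p₂ ∘ₗ i₁ = 0 := LinearMap.ext fun _ => rfl
  have h22 : p₂ ∘ₗ i₂ = LinearMap.id := LinearMap.ext fun _ => rfl
  have hsum : i₁ ∘ₗ p₁ + i₂ ∘ₗ p₂ = LinearMap.id := LinearMap.ext fun s => by
    apply L.symm.injective
    change L.symm (L (_, 0) + L (0, _)) = L.symm s
    rw [← map_add, LinearEquiv.symm_apply_apply, Prod.mk_add_mk, add_zero, zero_add]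
    rfl
  have := P₁.completeSpace_im D
  have := P₂.completeSpace_im D
  let V : D.im P.A ≃L[ℂ] WithLp 2 (D.im P₁.A × D.im P₂.A) :=
    ContinuousLinearEquiv.equivOfInverse
      ((WithLp.prodContinuousLinearEquiv 2 ℂ (D.im P₁.A) (D.im P₂.A)).symm.toContinuousLinearMap ∘L
        (P.op P₁ D p₁).prod (P.op P₂ D p₂))
      ((P₁.op P D i₁).coprod (P₂.op P D i₂) ∘L
        (WithLp.prodContinuousLinearEquiv 2 ℂ (D.im P₁.A) (D.im P₂.A)).toContinuousLinearMap)
      (fun v => by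
        change P₁.op P D i₁ (P.op P₁ D p₁ v) + P₂.op P D i₂ (P.op P₂ D p₂ v) = v
        rw [P.op_op P₁ P, P.op_op P₂ P, ← add_apply, ← P.op_add, hsum, P.op_id])
      (fun v => by
        refine withLp_ext ?_ ?_
        · change P.op P₁ D p₁ (P₁.op P D i₁ v.fst + P₂.op P D i₂ v.snd) = v.fst
          rw [map_add, P₁.op_op P P₁, P₂.op_op P P₁, h11, h12, P₁.op_id, P₂.op_zero, add_zero]
        · change P.op P₂ D p₂ (P₁.op P D i₁ v.fst + P₂.op P D i₂ v.snd) = v.snd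
          rw [map_add, P₁.op_op P P₂, P₂.op_op P P₂, h21, h22, P₂.op_id, P₁.op_zero, zero_add])
  rw [← KHomology.mk_add]
  refine KHomology.mk_eq_of_equiv (D := capBase hD hP)
    (D' := capBase hD hP₁ + capBase hD hP₂) V ?_ ?_ ?_
  · intro v
    exact withLp_ext (op_capData_ε hD P P₁ p₁ (LinearMap.ext fun _ => rfl) v)
      (op_capData_ε hD P P₂ p₂ (LinearMap.ext fun _ => rfl) v)
  · intro f v
    exact withLp_ext (P.op_ampl P₁ D (D.commutesAction_φ f) p₁ v)
      (P.op_ampl P₂ D (D.commutesAction_φ f) p₂ v)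
  · refine (congrArg IsCompactOperator (funext fun v => ?_)).mp (isCompactOperator_toLp
      (P.isCompactOperator_op_ampl P₁ D hD.compact_commutator p₁)
      (P.isCompactOperator_op_ampl P₂ D hD.compact_commutator p₂))
    rfl

end BundleVariable

/-! ### Homotopies of bundles -/

namespace KData

variable {X : Type v} [TopologicalSpace X] {D : KData.{u} X} {n : ℕ}

/-- On `im A` the projection to `im A'` followed by the projection back to `im A` is close to the
identity. -/
theorem imMap_mul_bijective_aux {A A' : Matrix (Fin n) (Fin n) C(X, ℂ)}
    (hA : IsIdempotentElem A) (hA' : IsIdempotentElem A')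
    (h : ‖D.matOp A‖ * ‖D.matOp A - D.matOp A'‖ < 1) :
    Function.Bijective fun v : D.im A => D.imMap A' A (A * A') (D.imMap A A' (A' * A) v) := by
  have hi : IsIdempotentElem (D.matOp A) := by rw [IsIdempotentElem, ← matOp_mul, hA.eq]
  have : CompleteSpace (D.im A) :=
    (ContinuousLinearMap.IsIdempotentElem.isClosed_range hi).completeSpace_coe
  let R : D.im A →L[ℂ] D.im A := D.compress A (D.matOp A - D.matOp A')
  have hR : ‖R‖ < 1 := by
    refine lt_of_le_of_lt (ContinuousLinearMap.opNorm_le_bound _ (by positivity) fun v => ?_) h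
    change ‖D.matOp A ((D.matOp A - D.matOp A') v)‖ ≤ _
    rw [mul_assoc]
    exact (ContinuousLinearMap.le_opNorm _ _).trans (by
      gcongr
      exact ContinuousLinearMap.le_opNorm _ _)
  have hu := ContinuousLinearMap.isUnit_iff_bijective.mp (isUnit_one_sub_of_norm_lt_one hR)
  convert hu using 1
  funext v
  apply Subtype.ext
  change _ = (v : D.Pow n) - D.matOp A (D.matOp A v - D.matOp A' v)
  rw [D.imMap_imMap (by rw [← Matrix.mul_assoc, hA'.eq]) (by rw [← Matrix.mul_assoc, hA.eq]),
    D.imMap_apply (by simp only [← Matrix.mul_assoc, hA.eq]), rectOp_mul, rectOp_mul,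
    rectOp_mul, rectOp_coe _ hA, D.matOp_of_mem hA, map_sub, D.matOp_of_mem hA]
  have h2 : D.rectOp A' (D.rectOp A' (v : D.Pow n)) = D.rectOp A' v := by
    rw [← rectOp_mul, hA'.eq]
  rw [h2]
  exact (sub_sub_cancel _ _).symm

/-- Idempotents that are close to each other have isomorphic ranges. -/
theorem imMap_mul_bijective {A A' : Matrix (Fin n) (Fin n) C(X, ℂ)}
    (hA : IsIdempotentElem A) (hA' : IsIdempotentElem A')
    (h : ‖D.matOp A‖ * ‖D.matOp A - D.matOp A'‖ < 1)
    (h' : ‖D.matOp A'‖ * ‖D.matOp A' - D.matOp A‖ < 1) :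
    Function.Bijective (D.imMap A A' (A' * A)) :=
  ⟨Function.Injective.of_comp (imMap_mul_bijective_aux hA hA' h).1,
    Function.Surjective.of_comp (imMap_mul_bijective_aux hA' hA h').2⟩

theorem continuous_matOp {Z : Type*} [TopologicalSpace Z] [CompactSpace X]
    (hφ : ∀ f : C(X, ℂ), D.φ (star f) = star (D.φ f)) {A : Z → Matrix (Fin n) (Fin n) C(X, ℂ)}
    (hA : ∀ i j, Continuous fun z => A z i j) : Continuous fun z => D.matOp (A z) := by
  let ι : Fin n → D.H →L[ℂ] D.Pow n := fun i =>
    (PiLp.continuousLinearEquiv 2 ℂ (fun _ : Fin n => D.H)).symm.toContinuousLinearMap ∘L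
      ContinuousLinearMap.single ℂ (fun _ : Fin n => D.H) i
  let π : Fin n → D.Pow n →L[ℂ] D.H := fun i =>
    ContinuousLinearMap.proj i ∘L
      (PiLp.continuousLinearEquiv 2 ℂ (fun _ : Fin n => D.H)).toContinuousLinearMap
  have e : ∀ M : Matrix (Fin n) (Fin n) C(X, ℂ),
      D.matOp M = ∑ i, ∑ j, ι i ∘L D.φ (M i j) ∘L π j := by
    intro M
    ext x k
    simp only [sum_apply, WithLp.ofLp_sum, Finset.sum_apply, matOp_apply]
    refine Eq.symm ((Finset.sum_eq_single k ?_ ?_).trans ?_)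
    · intro i _ hik
      simp [ι, π, hik.symm]
    · simp
    · simp [ι, π]
  have hc : Continuous D.φ := by
    let Φ : C(X, ℂ) →⋆ₐ[ℂ] (D.H →L[ℂ] D.H) := { D.φ with map_star' := hφ }
    have h : Continuous Φ := by
      open scoped CStarAlgebra in exact map_continuous Φ
    exact h
  simp only [e]
  refine continuous_finsetSum _ fun i _ => continuous_finsetSum _ fun j _ => ?_
  exact continuous_const.clm_comp ((hc.comp (hA i j)).clm_comp continuous_const)

end KData

section Cylinder

open HermBundle

variable {G : Type z} {Y : Type v} [Group G] [TopologicalSpace G] [TopologicalSpace Y]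
  [MulAction G Y] {B : Set Y}

instance [CompactSpace Y] : CompactSpace (Cyl Y) :=
  inferInstanceAs (CompactSpace (Y × unitInterval))

instance [T2Space Y] : T2Space (Cyl Y) := inferInstanceAs (T2Space (Y × unitInterval))

instance [ContinuousSMul G Y] : ContinuousSMul G (Cyl Y) where
  continuous_smul := by
    have h : Continuous fun q : G × (Y × unitInterval) => (q.1 • q.2.1, q.2.2) := by fun_prop
    exact h

/-- The restriction of a section over the cylinder to `Y × {t}`. -/
def restrictSection {E : HermBundle.{v, w, z} G (Cyl Y)} (s : E.sections) (t : unitInterval) :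
    (E.pullback (cylIncl (Y := Y) t) (fun _ _ => rfl)).sections :=
  ⟨fun y => s.1 (cylIncl t y), fun y₀ => (s.2.1 (cylIncl t y₀)).comp (Continuous.subtype_mk
    ((cylIncl t).continuous.comp continuous_subtype_val)
    (fun y : {y // y ∈ (cylIncl t) ⁻¹' E.U (cylIncl t y₀)} => y.2)), fun g x y h => s.2.2 g _⟩

variable {p : Cocycle.{v, w, z} G (Cyl Y) {q : Cyl Y | q.1 ∈ B}} {n : ℕ}

/-- The restriction of a Parseval frame over the cylinder to `Y × {t}`. -/
def HermBundle.ParsevalFrame.restrict (F : ParsevalFrame p n) (t : unitInterval) :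
    ParsevalFrame (p.restrict t) n where
  s i := restrictSection (F.s i) t
  sum_eq y e := F.sum_eq (cylIncl t y) e
  d := F.d
  ε_eq i y := F.ε_eq i (cylIncl t y)

theorem continuous_gram_restrict [ContinuousSMul G Y] [CompactSpace Y] (F : ParsevalFrame p n)
    (i j : Fin n) :
    Continuous fun t : unitInterval => (F.restrict t).gram i j := by
  have h1 : Continuous fun q : unitInterval × Y => (F.restrict q.1).gram i j (orb G q.2) := by
    have h2 : Continuous fun q : unitInterval × Y => ((q.2, q.1) : Cyl Y) :=
      continuous_snd.prodMk continuous_fst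
    exact (continuous_inner_sections (F.s i) (F.s j)).comp h2
  have ho : IsOpenQuotientMap (orb G : Y → Orb G Y) :=
    ⟨Quotient.mk_surjective, continuous_orb G, isOpenMap_quotient_mk'_mul⟩
  have h3 : Continuous fun q : unitInterval × Orb G Y => (F.restrict q.1).gram i j q.2 :=
    (IsOpenQuotientMap.id.prodMap ho).isQuotientMap.continuous_iff.mpr h1
  exact (ContinuousMap.curry ⟨_, h3⟩).continuous

/-- The matrix of the grading of the sections. -/
def HermBundle.ParsevalFrame.gradingMatrix {q : Cocycle.{v, w, z} G Y B} (F : ParsevalFrame q n) :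
    Matrix (Fin n) (Fin n) C(Orb G Y, ℂ) :=
  F.presentation.mat F.presentation q.ε_isEnd.onSections

/-- The grading of the sections is given by a diagonal matrix, which commutes with the Gram
matrix. -/
theorem HermBundle.ParsevalFrame.gradingMatrix_eq {q : Cocycle.{v, w, z} G Y B}
    (F : ParsevalFrame q n) :
    F.gradingMatrix =
        Matrix.diagonal (fun i => algebraMap ℂ C(Orb G Y, ℂ) ((F.d i : ℤ) : ℂ)) * F.gram ∧
      Matrix.diagonal (fun i => algebraMap ℂ C(Orb G Y, ℂ) ((F.d i : ℤ) : ℂ)) * F.gram =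
        F.gram * Matrix.diagonal (fun i => algebraMap ℂ C(Orb G Y, ℂ) ((F.d i : ℤ) : ℂ)) := by
  obtain ⟨h1, h2⟩ := F.presentation_isHermitian.mat_ε_apply F.presentation_graded
  refine ⟨Matrix.ext fun (i j : Fin n) => ?_, Matrix.ext fun (i j : Fin n) => ?_⟩
  · rw [Matrix.diagonal_mul, ← Algebra.smul_def]
    exact h1 i j
  · rw [Matrix.diagonal_mul, Matrix.mul_diagonal, mul_comm (F.gram i j), ← Algebra.smul_def,
      ← Algebra.smul_def]
    exact h2 i j

theorem mul_mul_of_idempotent {R : Type*} [Semigroup R] {a a' δ : R} (ha : IsIdempotentElem a)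
    (ha' : IsIdempotentElem a') (h : δ * a = a * δ) (h' : δ * a' = a' * δ) :
    δ * a' * (a' * a) = a' * a * (δ * a) := by
  calc δ * a' * (a' * a) = δ * (a' * a') * a := by simp only [mul_assoc]
    _ = a' * (δ * a) := by rw [ha'.eq, h', mul_assoc]
    _ = a' * (δ * a * a) := by rw [mul_assoc δ, ha.eq]
    _ = a' * (a * δ * a) := congrArg (fun x => a' * (x * a)) h
    _ = a' * a * (δ * a) := by simp only [mul_assoc]

/-- The class of `T ⊗' 1` is locally constant along a homotopy of bundles, because close idempotents
have isomorphic ranges. -/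
theorem mk_capBase_restrict_eq [IsTopologicalGroup G] [CompactSpace Y]
    [ContinuousSMul G Y] {D : KData.{u} (Orb G Y)} (hD : D.IsKasparov) (F : ParsevalFrame p n)
    (t t' : unitInterval) :
    KHomology.mk (capBase hD (F.restrict t).presentation_isHermitian) =
      KHomology.mk (capBase hD (F.restrict t').presentation_isHermitian) := by
  set f : unitInterval → KHomology.{u} (Orb G Y) := fun t =>
    KHomology.mk (capBase hD (F.restrict t).presentation_isHermitian) with hf
  have hc : Continuous fun t => D.matOp (F.restrict t).gram :=
    KData.continuous_matOp hD.map_star fun i j => continuous_gram_restrict F i j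
  have hlc : IsLocallyConstant f := by
    rw [IsLocallyConstant.iff_eventually_eq]
    intro t
    have h1 : ∀ᶠ t' in nhds t, ‖D.matOp (F.restrict t').gram‖ *
        ‖D.matOp (F.restrict t').gram - D.matOp (F.restrict t).gram‖ < 1 := by
      have h : Continuous fun t' => ‖D.matOp (F.restrict t').gram‖ *
        ‖D.matOp (F.restrict t').gram - D.matOp (F.restrict t).gram‖ := by fun_prop
      exact h.continuousAt.eventually_lt_const (by simp)
    have h2 : ∀ᶠ t' in nhds t, ‖D.matOp (F.restrict t).gram‖ *
        ‖D.matOp (F.restrict t).gram - D.matOp (F.restrict t').gram‖ < 1 := by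
      have h : Continuous fun t' => ‖D.matOp (F.restrict t).gram‖ *
        ‖D.matOp (F.restrict t).gram - D.matOp (F.restrict t').gram‖ := by fun_prop
      exact h.continuousAt.eventually_lt_const (by simp)
    filter_upwards [h1, h2] with t' h1 h2
    have hA := (F.restrict t').gram_idem
    have hA' := (F.restrict t).gram_idem
    refine mk_capBase_eq_of_matrix hD (F.restrict t').presentation_isHermitian
      (F.restrict t).presentation_isHermitian ((F.restrict t).gram * (F.restrict t').gram) ?_ ?_
      (KData.imMap_mul_bijective hA hA' h1 h2) ?_
    · exact (Matrix.mul_assoc _ _ _).symm.trans (congrArg (· * _) hA'.eq)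
    · exact (Matrix.mul_assoc _ _ _).trans (congrArg (_ * ·) hA.eq)
    · obtain ⟨h3, h4⟩ := (F.restrict t').gradingMatrix_eq
      obtain ⟨h5, h6⟩ := (F.restrict t).gradingMatrix_eq
      change (F.restrict t).gradingMatrix * ((F.restrict t).gram * (F.restrict t').gram) =
        (F.restrict t).gram * (F.restrict t').gram * (F.restrict t').gradingMatrix
      rw [h3, h5]
      exact mul_mul_of_idempotent hA hA' h4 h6
  exact hlc.apply_eq_of_isPreconnected isPreconnected_univ (Set.mem_univ t) (Set.mem_univ t')

end Cylinder

/-! ### The cap product -/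

theorem eq_of_addConGen {M N : Type*} [Add M] [Add N] {r : M → M → Prop} {f : M → N}
    (hf : ∀ a b, f (a + b) = f a + f b) (h : ∀ a b, r a b → f a = f b) {a b : M}
    (hab : addConGen r a b) : f a = f b := by
  induction hab with
  | of a b hr => exact h a b hr
  | refl => rfl
  | symm _ ih => exact ih.symm
  | trans _ _ ih ih' => exact ih.trans ih'
  | add _ _ ih ih' => rw [hf, hf, ih, ih']

section Cap

variable {G : Type z} {Y : Type v} [Group G] [TopologicalSpace G] [IsTopologicalGroup G]
  [CompactSpace G] [TopologicalSpace Y] [CompactSpace Y] [T2Space Y] [MulAction G Y]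
  [ContinuousSMul G Y] {B : Set Y}

open HermBundle

/-- The cap product of representatives, as a class: the scaling homotopy to the operator `T ⊗' 1`
shows that it does not depend on `α`. -/
def capClass (D : KModule.{u} (Orb G Y)) (p : Cocycle.{v, w, z} G Y B) :
    KHomology.{u} (Orb G Y) :=
  KHomology.mk (capBase D.2 (exists_isHermitian p).choose_spec)

/-- The class can be computed with any Hermitian presentation. -/
theorem mk_capBase {D : KData.{u} (Orb G Y)} (hD : D.IsKasparov) {p : Cocycle.{v, w, z} G Y B}
    {P : Presentation p.E} (hP : P.IsHermitian) :
    KHomology.mk (capBase hD hP) = capClass ⟨D, hD⟩ p :=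
  mk_capBase_eq_of_equiv hD hP _ (LinearEquiv.refl _ _) fun _ => rfl

theorem capClass_add_left (D D' : KModule.{u} (Orb G Y)) (p : Cocycle.{v, w, z} G Y B) :
    capClass (D + D') p = capClass D p + capClass D' p :=
  mk_capBase_directSum D.2 D'.2 _

theorem capClass_add_right (D : KModule.{u} (Orb G Y)) (p q : Cocycle.{v, w, z} G Y B) :
    capClass D (p + q) = capClass D p + capClass D q :=
  mk_capBase_add D.2 _ _ _

theorem capClass_eq_zero_left {D : KModule.{u} (Orb G Y)} (h : D.IsDegenerate)
    (p : Cocycle.{v, w, z} G Y B) : capClass D p = 0 :=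
  mk_capBase_eq_zero_of_isDegenerate D.2 _ h

theorem capClass_eq_zero_right (D : KModule.{u} (Orb G Y)) {p : Cocycle.{v, w, z} G Y B}
    (h : p.IsDegenerate) : capClass D p = 0 :=
  mk_capBase_eq_zero_of_bijective D.2 _ h

theorem capClass_rel_left {D D' : KModule.{u} (Orb G Y)} (h : KModule.Rel D D')
    (p : Cocycle.{v, w, z} G Y B) : capClass D p = capClass D' p := by
  cases h with
  | unitary _ _ h => exact mk_capBase_eq_of_unitaryEquiv D.2 D'.2 _ h
  | homotopy D S hS h => exact mk_capBase_eq_of_homotopy _ S hS h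
  | degenerate _ D'' h => rw [capClass_add_left, capClass_eq_zero_left h, add_zero]

theorem capClass_rel_right (D : KModule.{u} (Orb G Y)) {p q : Cocycle.{v, w, z} G Y B}
    (h : Cocycle.Rel p q) : capClass D p = capClass D q := by
  cases h with
  | iso _ _ h => exact mk_capBase_eq_of_iso D.2 _ _ h
  | homotopy p =>
    obtain ⟨n, ⟨F⟩⟩ := exists_parsevalFrame p
    exact (mk_capBase D.2 (F.restrict 0).presentation_isHermitian).symm.trans
      ((mk_capBase_restrict_eq D.2 F 0 1).trans
        (mk_capBase D.2 (F.restrict 1).presentation_isHermitian))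
  | degenerate _ p' h => rw [capClass_add_right, capClass_eq_zero_right D h, add_zero]

/-- The cap product with a Kasparov module. -/
def capLeft (B : Set Y) (D : KModule.{u} (Orb G Y)) :
    KFake.{v, w, z} G Y B →+ KHomology.{u} (Orb G Y) where
  toFun e := AddCon.liftOn e (capClass D) fun _ _ h =>
    eq_of_addConGen (capClass_add_right D) (fun _ _ => capClass_rel_right D) h
  map_zero' := capClass_eq_zero_right D (p := 0) fun _ => Function.bijective_id
  map_add' a b := by
    induction a using KFake.ind
    induction b using KFake.ind
    exact capClass_add_right D _ _

variable (G B) in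
/-- The fake cap product. -/
def cap : KHomology.{u} (Orb G Y) →+ KFake.{v, w, z} G Y B →+ KHomology.{u} (Orb G Y) where
  toFun x := AddCon.liftOn x (capLeft B) fun D D' h => by
    refine DFunLike.ext _ _ fun e => ?_
    induction e using KFake.ind with
    | h p =>
      exact eq_of_addConGen (f := fun D => capClass D p) (fun _ _ => capClass_add_left _ _ p)
        (fun _ _ h => capClass_rel_left h p) h
  map_zero' := by
    refine DFunLike.ext _ _ fun e => ?_
    induction e using KFake.ind with
    | h p =>
      refine capClass_eq_zero_left (D := 0) ⟨⟨1, ?_⟩, fun f => ?_⟩ p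
      · exact Subsingleton.elim (α := (KData.zero.{u} (Orb G Y)).H →L[ℂ] _) _ _
      · exact Subsingleton.elim (α := (KData.zero.{u} (Orb G Y)).H →L[ℂ] _) _ _
  map_add' x y := by
    refine DFunLike.ext _ _ fun e => ?_
    induction e using KFake.ind with
    | h p =>
      induction x using KHomology.ind
      induction y using KHomology.ind
      exact capClass_add_left _ _ p

theorem cap_eq_mk_capData (D : KModule.{u} (Orb G Y)) (p : Cocycle.{v, w, z} G Y B)
    {P : Presentation p.E} (hP : P.IsHermitian) :
    cap G B (KHomology.mk D) (KFake.mk p) =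
      KHomology.mk ⟨capData D p P, capData_isKasparov D.2 hP⟩ :=
  (mk_capBase D.2 hP).symm.trans (mk_capData D.2 hP).symm

theorem represents_capData_iff (D : KModule.{u} (Orb G Y)) (p : Cocycle.{v, w, z} G Y B)
    (P : Presentation p.E) (c : KHomology.{u} (Orb G Y)) :
    Represents (capData D p P) c ↔ c = cap G B (KHomology.mk D) (KFake.mk p) := by
  obtain ⟨P', hP'⟩ := exists_isHermitian p
  rw [cap_eq_mk_capData D p hP']
  constructor
  · intro h
    exact (Represents.of_presentation D.2 P' P h).eq_mk
      (K := ⟨capData D p P', capData_isKasparov D.2 hP'⟩)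
  · rintro rfl
    exact Represents.of_presentation D.2 P P'
      (represents_mk ⟨capData D p P', capData_isKasparov D.2 hP'⟩)

end Cap

/-- A biadditive map extends uniquely to a bilinear map of the complexifications. -/
theorem existsUnique_complexification {K F N : Type*} [AddCommMonoid K] [AddCommMonoid F]
    [AddCommMonoid N] (b : K →+ F →+ N) :
    ∃! bC : (ℂ ⊗[ℕ] K) ⊗[ℂ] (ℂ ⊗[ℕ] F) →ₗ[ℂ] (ℂ ⊗[ℕ] N),
      ∀ x e, bC (((1 : ℂ) ⊗ₜ[ℕ] x) ⊗ₜ[ℂ] ((1 : ℂ) ⊗ₜ[ℕ] e)) = (1 : ℂ) ⊗ₜ[ℕ] b x e := by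
  let bN : K →ₗ[ℕ] F →ₗ[ℕ] N :=
    { toFun := fun x => (b x).toNatLinearMap
      map_add' := fun x y => by ext e; simp
      map_smul' := fun n x => by ext e; simp }
  refine ⟨(TensorProduct.lift bN).baseChange ℂ ∘ₗ
    (TensorProduct.AlgebraTensorModule.distribBaseChange ℕ ℂ K F).symm.toLinearMap, ?_, ?_⟩
  · intro x e
    have h : (1 : ℂ) ⊗ₜ[ℕ] x ⊗ₜ[ℂ] ((1 : ℂ) ⊗ₜ[ℕ] e) =
        TensorProduct.AlgebraTensorModule.distribBaseChange ℕ ℂ K F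
          ((1 : ℂ) ⊗ₜ[ℕ] (x ⊗ₜ[ℕ] e)) := by simp
    rw [LinearMap.comp_apply, h, LinearEquiv.coe_coe, LinearEquiv.symm_apply_apply,
      LinearMap.baseChange_tmul]
    rfl
  · intro g hg
    ext x e
    simpa [TensorProduct.AlgebraTensorModule.distribBaseChange_symm_tmul, bN] using hg x e

end FakeCap

end

theorem proposition3p1
    {G : Type z} {Y : Type v} [Group G] [TopologicalSpace G] [IsTopologicalGroup G]
    [CompactSpace G] [T2Space G] [TopologicalSpace Y] [CompactSpace Y] [T2Space Y]
    [MulAction G Y] [ContinuousSMul G Y]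
    (B : Set Y) (hB : IsClosed B) (hGB : ∀ (g : G), ∀ y ∈ B, g • y ∈ B) :
    (∀ p : FakeCap.Cocycle.{v, w, z} G Y B,
      ∃ P : FakeCap.Presentation p.E, P.IsHermitian) ∧
    ∃ cap : FakeCap.KHomology.{u} (FakeCap.Orb G Y) →+ FakeCap.KFake.{v, w, z} G Y B →+
        FakeCap.KHomology.{u} (FakeCap.Orb G Y),
      (∀ (D : FakeCap.KModule.{u} (FakeCap.Orb G Y)) (p : FakeCap.Cocycle.{v, w, z} G Y B)
        (P : FakeCap.Presentation p.E), P.IsHermitian →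
        ∃ h : (FakeCap.capData D p P).IsKasparov,
          cap (FakeCap.KHomology.mk D) (FakeCap.KFake.mk p) =
            FakeCap.KHomology.mk ⟨FakeCap.capData D p P, h⟩) ∧
      (∀ (D : FakeCap.KModule.{u} (FakeCap.Orb G Y)) (p : FakeCap.Cocycle.{v, w, z} G Y B)
        (P : FakeCap.Presentation p.E) (c : FakeCap.KHomology.{u} (FakeCap.Orb G Y)),
        FakeCap.Represents (FakeCap.capData D p P) c ↔
          c = cap (FakeCap.KHomology.mk D) (FakeCap.KFake.mk p)) ∧
      (∀ cap' : FakeCap.KHomology.{u} (FakeCap.Orb G Y) → FakeCap.KFake.{v, w, z} G Y B →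
          FakeCap.KHomology.{u} (FakeCap.Orb G Y),
        (∀ (D : FakeCap.KModule.{u} (FakeCap.Orb G Y)) (p : FakeCap.Cocycle.{v, w, z} G Y B)
          (P : FakeCap.Presentation p.E), P.IsHermitian →
          ∃ h : (FakeCap.capData D p P).IsKasparov,
            cap' (FakeCap.KHomology.mk D) (FakeCap.KFake.mk p) =
              FakeCap.KHomology.mk ⟨FakeCap.capData D p P, h⟩) →
        ∀ x e, cap' x e = cap x e) ∧
      ∃! capC : (ℂ ⊗[ℕ] FakeCap.KHomology.{u} (FakeCap.Orb G Y)) ⊗[ℂ]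
          (ℂ ⊗[ℕ] FakeCap.KFake.{v, w, z} G Y B) →ₗ[ℂ]
          (ℂ ⊗[ℕ] FakeCap.KHomology.{u} (FakeCap.Orb G Y)),
        ∀ x e, capC (((1 : ℂ) ⊗ₜ[ℕ] x) ⊗ₜ[ℂ] ((1 : ℂ) ⊗ₜ[ℕ] e)) = (1 : ℂ) ⊗ₜ[ℕ] cap x e := by
  refine ⟨FakeCap.HermBundle.exists_isHermitian, FakeCap.cap G B,
    fun D p P hP => ⟨FakeCap.capData_isKasparov D.2 hP, FakeCap.cap_eq_mk_capData D p hP⟩,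
    FakeCap.represents_capData_iff, fun cap' h x e => ?_,
    FakeCap.existsUnique_complexification _⟩
  induction x using FakeCap.KHomology.ind with
  | h D =>
    induction e using FakeCap.KFake.ind with
    | h p =>
      obtain ⟨P, hP⟩ := FakeCap.HermBundle.exists_isHermitian p
      obtain ⟨hK, h1⟩ := h D p P hP
      rw [h1, FakeCap.cap_eq_mk_capData D p hP]
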